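/- For a finite simple graph $G$ on $n$ vertices let $\omega(G)$ be the maximum size of a clique in $G$, and let $\bar\mu(G)$ be the maximum size of a matching in the complement $\overline{G}$. The $\ell$-Coloring problem is: given a graph $G$ and an integer $\ell\ge 0$, decide whether $G$ has a proper coloring with at most $\ell$ colors. Theorem. For every integer $k\ge 1$ and every graph $G$ with $\omega(G)+\bar\mu(G)-k\ge 0$, the $(\omega(G)+\bar\mu(G)-k)$-Coloring problem on $G$ can be solved in randomized $O^*(2^{6k})$ time, where $O^*(f(k))$ stands for $f(k)\cdot n^{O(1)}$. Precisely: for every constant $d\ge 0$ there are a single randomized algorithm $A$ (a program for a random access machine with fair coin flips, under the logarithmic cost criterion) and constants $C,c$ such that for all $n$, all graphs $G$ on $n$ vertices and all integers $k\ge 1$ and $\ell\ge 0$ with $\ell=\omega(G)+\bar\mu(G)-k$, the algorithm $A$ on input $(G,\ell)$ (with $G$ given by its adjacency matrix) halts in time at most $C\cdot 2^{6k}\cdot n^{c}$ for every outcome of its coin flips, and with probability at least $1-(n+1)^{-d}$ it correctly decides whether $G$ has a proper coloring with at most $\ell$ colors. -/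

import Mathlib

/-- The matching number of a graph: the largest number of edges in a matching
(for a finite graph the supremum is attained). -/
noncomputable def matchingNumber {V : Type*} (G : SimpleGraph V) : ℕ :=
  sSup {m | ∃ M : G.Subgraph, M.IsMatching ∧ M.edgeSet.ncard = m}

/-! A random access machine with coin flips, programmed in structured form and charged by the
logarithmic cost criterion: every value that is computed costs its length in binary plus one. -/

namespace CoinRAM

/-- The arithmetic and comparison operations of the machine. -/
inductive Op where
  | add | sub | mul | div | mod | lt | eq

/-- The value of an operation on natural numbers: truncated subtraction, division with remainder
(with `a / 0 = 0` and `a % 0 = a`), and comparisons that return `1` for true and `0` for false. -/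
def Op.eval : Op → ℕ → ℕ → ℕ
  | .add, a, b => a + b
  | .sub, a, b => a - b
  | .mul, a, b => a * b
  | .div, a, b => a / b
  | .mod, a, b => a % b
  | .lt, a, b => if a < b then 1 else 0
  | .eq, a, b => if a = b then 1 else 0

/-- Expressions: constants, registers, array cells with a computed index, and operations. -/
inductive Expr where
  | const (c : ℕ)
  | reg (x : ℕ)
  | cell (a : ℕ) (i : Expr)
  | op (o : Op) (e₁ e₂ : Expr)

/-- Commands. `flip x` puts the outcome of a fresh coin flip into register `x`. -/
inductive Cmd where
  | skip
  | assign (x : ℕ) (e : Expr)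
  | store (a : ℕ) (i e : Expr)
  | flip (x : ℕ)
  | seq (p q : Cmd)
  | ite (e : Expr) (p q : Cmd)
  | loop (e : Expr) (p : Cmd)

/-- A state: registers, arrays, and the outcomes of the coin flips that are still to come.
A program mentions only finitely many registers and arrays. -/
@[ext] structure State where
  regs : ℕ → ℕ
  arrays : ℕ → ℕ → ℕ
  coins : ℕ → Bool

/-- The value of an expression in a state. -/
def Expr.eval (s : State) : Expr → ℕ
  | .const c => c
  | .reg x => s.regs x
  | .cell a i => s.arrays a (i.eval s)
  | .op o e₁ e₂ => o.eval (e₁.eval s) (e₂.eval s)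

/-- The logarithmic cost of evaluating an expression: each of its subexpressions, array indices
included, is charged one plus the number of binary digits of its value. -/
def Expr.cost (s : State) : Expr → ℕ
  | .const c => 1 + c.size
  | .reg x => 1 + (s.regs x).size
  | .cell a i => i.cost s + (1 + (s.arrays a (i.eval s)).size)
  | .op o e₁ e₂ => e₁.cost s + e₂.cost s + (1 + (o.eval (e₁.eval s) (e₂.eval s)).size)

/-- Write the value `v` into register `x`. -/
def State.setReg (s : State) (x v : ℕ) : State :=
  { s with regs := Function.update s.regs x v }

/-- Write the value `v` into cell `i` of array `a`. -/
def State.setCell (s : State) (a i v : ℕ) : State :=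
  { s with arrays := Function.update s.arrays a (Function.update (s.arrays a) i v) }

/-- Consume the next coin flip and write its outcome, as `0` or `1`, into register `x`. -/
def State.flipCoin (s : State) (x : ℕ) : State :=
  { s with regs := Function.update s.regs x (s.coins 0).toNat, coins := fun i => s.coins (i + 1) }

/-- `Exec p s s' t`: started in the state `s`, the command `p` halts in the state `s'`, and the
whole run costs `t`. -/
inductive Exec : Cmd → State → State → ℕ → Prop where
  | skip (s : State) : Exec .skip s s 1
  | assign (s : State) (x : ℕ) (e : Expr) :
      Exec (.assign x e) s (s.setReg x (e.eval s)) (1 + e.cost s)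
  | store (s : State) (a : ℕ) (i e : Expr) :
      Exec (.store a i e) s (s.setCell a (i.eval s) (e.eval s)) (1 + i.cost s + e.cost s)
  | flip (s : State) (x : ℕ) : Exec (.flip x) s (s.flipCoin x) 1
  | seq {p q : Cmd} {s s' s'' : State} {t t' : ℕ} :
      Exec p s s' t → Exec q s' s'' t' → Exec (.seq p q) s s'' (t + t')
  | ite_true {e : Expr} {p q : Cmd} {s s' : State} {t : ℕ} :
      e.eval s ≠ 0 → Exec p s s' t → Exec (.ite e p q) s s' (1 + e.cost s + t)
  | ite_false {e : Expr} {p q : Cmd} {s s' : State} {t : ℕ} :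
      e.eval s = 0 → Exec q s s' t → Exec (.ite e p q) s s' (1 + e.cost s + t)
  | loop_true {e : Expr} {p : Cmd} {s s' s'' : State} {t t' : ℕ} :
      e.eval s ≠ 0 → Exec p s s' t → Exec (.loop e p) s' s'' t' →
        Exec (.loop e p) s s'' (1 + e.cost s + t + t')
  | loop_false {e : Expr} {p : Cmd} {s : State} :
      e.eval s = 0 → Exec (.loop e p) s s (1 + e.cost s)

/-- For a given sequence of coin flips a run is deterministic. -/
theorem Exec.unique {p : Cmd} {s s₁ s₂ : State} {t₁ t₂ : ℕ}
    (h₁ : Exec p s s₁ t₁) (h₂ : Exec p s s₂ t₂) : s₁ = s₂ ∧ t₁ = t₂ := by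
  induction h₁ generalizing s₂ t₂ with
  | skip | assign | store | flip => cases h₂; exact ⟨rfl, rfl⟩
  | seq _ _ ih ih' =>
    cases h₂ with
    | seq g g' =>
      obtain ⟨rfl, rfl⟩ := ih g
      obtain ⟨rfl, rfl⟩ := ih' g'
      exact ⟨rfl, rfl⟩
  | ite_true he _ ih =>
    cases h₂ with
    | ite_true _ g => obtain ⟨rfl, rfl⟩ := ih g; exact ⟨rfl, rfl⟩
    | ite_false he' _ => exact absurd he' he
  | ite_false he _ ih =>
    cases h₂ with
    | ite_true he' _ => exact absurd he he'
    | ite_false _ g => obtain ⟨rfl, rfl⟩ := ih g; exact ⟨rfl, rfl⟩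
  | loop_true he _ _ ih ih' =>
    cases h₂ with
    | loop_true _ g g' =>
      obtain ⟨rfl, rfl⟩ := ih g
      obtain ⟨rfl, rfl⟩ := ih' g'
      exact ⟨rfl, rfl⟩
    | loop_false he' => exact absurd he' he
  | loop_false he =>
    cases h₂ with
    | loop_true he' _ _ => exact absurd he he'
    | loop_false _ => exact ⟨rfl, rfl⟩

/-- The program `p`, started in `s`, halts at cost at most `T`. -/
def HaltsWithin (p : Cmd) (s : State) (T : ℕ) : Prop :=
  ∃ (s' : State) (t : ℕ), Exec p s s' t ∧ t ≤ T

/-- The program `p`, started in `s`, halts and gives the correct answer to the question whether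
`Q` holds: register `0` is nonzero at the end if and only if `Q` is true. -/
def Decides (p : Cmd) (s : State) (Q : Prop) : Prop :=
  ∃ (s' : State) (t : ℕ), Exec p s s' t ∧ (s'.regs 0 ≠ 0 ↔ Q)

open Classical in
/-- The start state for an instance `(G, l)` of graph coloring and a sequence of coin flips:
register `0` holds the number of vertices, register `1` the number of colors, array `0` the
adjacency matrix row by row, and everything else is `0`. -/
noncomputable def coloringInput {n : ℕ} (G : SimpleGraph (Fin n)) (l : ℕ) (coins : ℕ → Bool) :
    State where
  regs x := if x = 0 then n else if x = 1 then l else 0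
  arrays a i := if a = 0 ∧ ∃ u v : Fin n, i = u.val * n + v.val ∧ G.Adj u v then 1 else 0
  coins := coins

/-- The law of an infinite sequence of independent fair coin flips. -/
noncomputable def fairCoins : MeasureTheory.Measure (ℕ → Bool) :=
  MeasureTheory.Measure.infinitePi fun _ => (PMF.uniformOfFintype Bool).toMeasure

end CoinRAM

namespace CoinRAM

/-- Programs whose only loops are counting loops: `count x e p` runs `p` with `x = 0, 1, …` up to
the value of `e`. -/
inductive Prog where
  | skip
  | assign (x : ℕ) (e : Expr)
  | store (a : ℕ) (i e : Expr)
  | flip (x : ℕ)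
  | seq (p q : Prog)
  | ite (e : Expr) (p q : Prog)
  | count (x : ℕ) (e : Expr) (p : Prog)

namespace Prog

/-- The machine command of a program. -/
def toCmd : Prog → Cmd
  | skip => .skip
  | assign x e => .assign x e
  | store a i e => .store a i e
  | flip x => .flip x
  | seq p q => .seq p.toCmd q.toCmd
  | ite e p q => .ite e p.toCmd q.toCmd
  | count x e p => .seq (.assign x (.const 0))
      (.loop (.op .lt (.reg x) e) (.seq p.toCmd (.assign x (.op .add (.reg x) (.const 1)))))

/-- The state of a counting loop with body `f` and counter `x` before the `k`-th round. -/
def rounds (f : State → State) (x : ℕ) (s : State) : ℕ → State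
  | 0 => s.setReg x 0
  | k + 1 => (f (rounds f x s k)).setReg x (k + 1)

/-- The final state of a program. -/
def run : Prog → State → State
  | skip, s => s
  | assign x e, s => s.setReg x (e.eval s)
  | store a i e, s => s.setCell a (i.eval s) (e.eval s)
  | flip x, s => s.flipCoin x
  | seq p q, s => q.run (p.run s)
  | ite e p q, s => if e.eval s ≠ 0 then p.run s else q.run s
  | count x e p, s => rounds p.run x s (e.eval s)

/-- Whether a program writes the register `x`. -/
def writesReg (x : ℕ) : Prog → Bool
  | skip => false
  | assign y _ => y == x
  | store _ _ _ => false
  | flip y => y == x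
  | seq p q => p.writesReg x || q.writesReg x
  | ite _ p q => p.writesReg x || q.writesReg x
  | count y _ p => y == x || p.writesReg x

/-- Whether a program writes the array `a`. -/
def writesArray (a : ℕ) : Prog → Bool
  | skip => false
  | assign _ _ => false
  | store b _ _ => b == a
  | flip _ => false
  | seq p q => p.writesArray a || q.writesArray a
  | ite _ p q => p.writesArray a || q.writesArray a
  | count _ _ p => p.writesArray a

/-- Whether a program flips coins. -/
def flips : Prog → Bool
  | skip => false
  | assign _ _ => false
  | store _ _ _ => false
  | flip _ => true
  | seq p q => p.flips || q.flips
  | ite _ p q => p.flips || q.flips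
  | count _ _ p => p.flips

end Prog

section simpLemmas

variable (s : State)

@[simp] theorem regs_setReg (x v y : ℕ) :
    (s.setReg x v).regs y = if y = x then v else s.regs y := by
  simp [State.setReg, Function.update_apply]

@[simp] theorem arrays_setReg (x v : ℕ) : (s.setReg x v).arrays = s.arrays := rfl

@[simp] theorem coins_setReg (x v : ℕ) : (s.setReg x v).coins = s.coins := rfl

@[simp] theorem regs_setCell (a i v : ℕ) : (s.setCell a i v).regs = s.regs := rfl

@[simp] theorem arrays_setCell (a i v b j : ℕ) :
    (s.setCell a i v).arrays b j = if b = a ∧ j = i then v else s.arrays b j := by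
  by_cases h : b = a
  · subst h; simp [State.setCell, Function.update_apply]
  · simp [State.setCell, h]

@[simp] theorem coins_setCell (a i v : ℕ) : (s.setCell a i v).coins = s.coins := rfl

@[simp] theorem regs_flipCoin (x y : ℕ) :
    (s.flipCoin x).regs y = if y = x then (s.coins 0).toNat else s.regs y := by
  simp [State.flipCoin, Function.update_apply]

@[simp] theorem arrays_flipCoin (x : ℕ) : (s.flipCoin x).arrays = s.arrays := rfl

@[simp] theorem coins_flipCoin (x : ℕ) : (s.flipCoin x).coins = fun i => s.coins (i + 1) := rfl

@[simp] theorem eval_const (c : ℕ) : (Expr.const c).eval s = c := rfl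

@[simp] theorem eval_reg (x : ℕ) : (Expr.reg x).eval s = s.regs x := rfl

@[simp] theorem eval_cell (a : ℕ) (i : Expr) :
    (Expr.cell a i).eval s = s.arrays a (i.eval s) := rfl

@[simp] theorem eval_add (e f : Expr) : (Expr.op .add e f).eval s = e.eval s + f.eval s := rfl

@[simp] theorem eval_sub (e f : Expr) : (Expr.op .sub e f).eval s = e.eval s - f.eval s := rfl

@[simp] theorem eval_mul (e f : Expr) : (Expr.op .mul e f).eval s = e.eval s * f.eval s := rfl

@[simp] theorem eval_div (e f : Expr) : (Expr.op .div e f).eval s = e.eval s / f.eval s := rfl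

@[simp] theorem eval_mod (e f : Expr) : (Expr.op .mod e f).eval s = e.eval s % f.eval s := rfl

@[simp] theorem eval_lt (e f : Expr) :
    (Expr.op .lt e f).eval s = if e.eval s < f.eval s then 1 else 0 := rfl

@[simp] theorem eval_eq (e f : Expr) :
    (Expr.op .eq e f).eval s = if e.eval s = f.eval s then 1 else 0 := rfl

@[simp] theorem run_skip : Prog.skip.run s = s := rfl

@[simp] theorem run_assign (x : ℕ) (e : Expr) :
    (Prog.assign x e).run s = s.setReg x (e.eval s) := rfl

@[simp] theorem run_store (a : ℕ) (i e : Expr) :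
    (Prog.store a i e).run s = s.setCell a (i.eval s) (e.eval s) := rfl

@[simp] theorem run_flip (x : ℕ) : (Prog.flip x).run s = s.flipCoin x := rfl

@[simp] theorem run_seq (p q : Prog) : (Prog.seq p q).run s = q.run (p.run s) := rfl

@[simp] theorem run_ite (e : Expr) (p q : Prog) :
    (Prog.ite e p q).run s = if e.eval s ≠ 0 then p.run s else q.run s := rfl

end simpLemmas

namespace Prog

theorem rounds_counter (f : State → State) (x : ℕ) (s : State) (k : ℕ) :
    (rounds f x s k).regs x = k := by
  cases k <;> simp [rounds]

/-- The invariant rule for counting loops. -/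
theorem run_count_induction {x : ℕ} {e : Expr} {p : Prog} {s : State} (I : ℕ → State → Prop)
    (h0 : I 0 (s.setReg x 0))
    (hs : ∀ k s', k < e.eval s → s'.regs x = k → I k s' → I (k + 1) ((p.run s').setReg x (k + 1))) :
    I (e.eval s) ((count x e p).run s) := by
  have : ∀ k, k ≤ e.eval s → I k (rounds p.run x s k) := by
    intro k
    induction k with
    | zero => intro _; exact h0
    | succ k ih =>
      intro hk
      exact hs k _ hk (rounds_counter _ _ _ _) (ih (by omega))
  exact this _ le_rfl

theorem run_regs {x : ℕ} (p : Prog) (h : p.writesReg x = false) (s : State) :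
    (p.run s).regs x = s.regs x := by
  induction p generalizing s with
  | skip => rfl
  | assign y e => simp [writesReg] at h; simp [Ne.symm h]
  | store a i e => rfl
  | flip y => simp [writesReg] at h; simp [Ne.symm h]
  | seq p q ihp ihq => simp [writesReg] at h; simp [ihp h.1, ihq h.2]
  | ite e p q ihp ihq => simp [writesReg] at h; simp; split <;> simp [ihp h.1, ihq h.2]
  | count y e p ih =>
    simp [writesReg] at h
    apply run_count_induction (fun _ s' => s'.regs x = s.regs x)
    · simp [Ne.symm h.1]
    · intro k s' _ _ hs'; simp [Ne.symm h.1, ih h.2, hs']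

theorem run_arrays {a : ℕ} (p : Prog) (h : p.writesArray a = false) (s : State) :
    (p.run s).arrays a = s.arrays a := by
  induction p generalizing s with
  | skip => rfl
  | assign y e => rfl
  | store b i e => simp [writesArray] at h; funext j; simp [Ne.symm h]
  | flip y => rfl
  | seq p q ihp ihq => simp [writesArray] at h; simp [ihp h.1, ihq h.2]
  | ite e p q ihp ihq => simp [writesArray] at h; simp; split <;> simp [ihp h.1, ihq h.2]
  | count y e p ih =>
    simp [writesArray] at h
    apply run_count_induction (fun _ s' => s'.arrays a = s.arrays a)
    · simp
    · intro k s' _ _ hs'; simp [ih h, hs']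

/-- A counting loop that fills an array from left to right; the entries may depend on earlier
entries of the same array. -/
theorem run_fill {x a : ℕ} {e g : Expr} {s : State} (F : ℕ → ℕ)
    (h : ∀ k < e.eval s, g.eval { s with
        regs := Function.update s.regs x k
        arrays := Function.update s.arrays a (fun i => if i < k then F i else s.arrays a i) }
      = F k) :
    (count x e (store a (.reg x) g)).run s = { s with
        regs := Function.update s.regs x (e.eval s)
        arrays := Function.update s.arrays a
          (fun i => if i < e.eval s then F i else s.arrays a i) } := by
  apply run_count_induction (fun k s' => s' = { s with
        regs := Function.update s.regs x k
        arrays := Function.update s.arrays a (fun i => if i < k then F i else s.arrays a i) })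
  · ext <;> simp [State.setReg]
  · rintro k s' hk - rfl
    have := h k hk
    ext b i
    · simp [State.setReg, State.setCell]
    · by_cases hb : b = a
      · subst hb
        simp only [run_store, arrays_setReg, arrays_setCell, this, true_and, Function.update_self,
          eval_reg]
        by_cases hi : i = k
        · simp [hi]
        · have : i < k + 1 ↔ i < k := by omega
          simp [hi, this]
      · simp [hb]
    · simp

end Prog

/-! ### Costs -/

namespace Expr

/-- A measure of the length of an expression. -/
def len : Expr → ℕ
  | const c => c + 1
  | reg _ => 1
  | cell _ i => i.len + 1
  | op _ e f => e.len + f.len + 1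

/-- The expression is built from constants and registers of `R` with sums and products. -/
def isPoly (R : List ℕ) : Expr → Bool
  | const _ => true
  | reg x => R.contains x
  | op .add e f => e.isPoly R && f.isPoly R
  | op .mul e f => e.isPoly R && f.isPoly R
  | _ => false

/-- The degree of a polynomial expression in the value of the register `mr`. -/
def degM (mr : ℕ) : Expr → ℕ
  | reg x => if x = mr then 1 else 0
  | op .add e f => max (e.degM mr) (f.degM mr)
  | op .mul e f => e.degM mr + f.degM mr
  | _ => 0

/-- A bound for the degree of a polynomial expression in the other registers. -/
def degL : Expr → ℕ
  | const c => c
  | reg _ => 1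
  | op .add e f => max e.degL f.degL + 1
  | op .mul e f => e.degL + f.degL
  | _ => 0

/-- A syntactic condition under which the value of an expression is not larger than the values
that are already present. -/
def isSafe (R Z : List ℕ) : Expr → Bool
  | const _ => true
  | reg _ => true
  | cell _ _ => true
  | op .add e f => (op .add e f).isPoly R
  | op .mul e f => (op .mul e f).isPoly R
  | op .sub e _ => e.isSafe R Z
  | op .div e _ => e.isSafe R Z
  | op .mod e (reg r) => Z.contains r || e.isSafe R Z
  | op .mod e _ => e.isSafe R Z
  | op .lt _ _ => true
  | op .eq _ _ => true

/-- The number of binary digits, in units of the bound for the registers in `R`, that suffice for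
the value of a safe expression. -/
def need (mr : ℕ) : Expr → ℕ
  | const c => c + 1
  | reg _ => 0
  | cell _ _ => 0
  | op .add e f => (op .add e f).degM mr + (op .add e f).degL + 1
  | op .mul e f => (op .mul e f).degM mr + (op .mul e f).degL + 1
  | op .sub e _ => e.need mr
  | op .div e _ => e.need mr
  | op .mod e _ => e.need mr
  | op .lt _ _ => 1
  | op .eq _ _ => 1

end Expr

namespace Prog

/-- A syntactic condition under which the values and the cost of a program can be bounded: the
registers in `R` and `Z` are never written, and loop bounds are polynomials in the registers of
`R`. -/
def isTame (R Z : List ℕ) : Prog → Bool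
  | skip => true
  | assign x e => !R.contains x && !Z.contains x && e.isSafe R Z
  | store _ _ e => e.isSafe R Z
  | flip x => !R.contains x && !Z.contains x
  | seq p q => p.isTame R Z && q.isTame R Z
  | ite _ p q => p.isTame R Z && q.isTame R Z
  | count x e p => !R.contains x && !Z.contains x && e.isPoly R && !p.writesReg x && p.isTame R Z

/-- The largest `need` of an expression or loop bound of a program. -/
def need (mr : ℕ) : Prog → ℕ
  | skip => 0
  | assign _ e => e.need mr
  | store _ _ e => e.need mr
  | flip _ => 1
  | seq p q => max (p.need mr) (q.need mr)
  | ite _ p q => max (p.need mr) (q.need mr)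
  | count _ e p => max (e.degM mr + e.degL + 1) (p.need mr)

/-- The degree of the cost of a program in the value of the register `mr`. -/
def degM (mr : ℕ) : Prog → ℕ
  | seq p q => max (p.degM mr) (q.degM mr)
  | ite _ p q => max (p.degM mr) (q.degM mr)
  | count _ e p => e.degM mr + p.degM mr
  | _ => 0

/-- A bound for the degree of the cost of a program in the bound for the registers in `R`. -/
def degL : Prog → ℕ
  | skip => 0
  | assign _ e => e.len * e.len + 1
  | store _ i e => i.len * i.len + e.len * e.len + 1
  | flip _ => 0
  | seq p q => p.degL + q.degL + 1
  | ite e p q => e.len * e.len + 1 + (p.degL + q.degL) + 1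
  | count _ e p => e.degL + (p.degL + ((e.len + 2) * (e.len + 2) + 20) + 2) + 1

end Prog

/-- All registers and array cells hold numbers with at most `B` binary digits. -/
def State.Bounded (B : ℕ) (s : State) : Prop :=
  (∀ x, s.regs x < 2 ^ B) ∧ ∀ a i, s.arrays a i < 2 ^ B

theorem State.Bounded.setReg {B : ℕ} {s : State} (h : s.Bounded B) {x v : ℕ} (hv : v < 2 ^ B) :
    (s.setReg x v).Bounded B := by
  refine ⟨fun y => ?_, h.2⟩
  rw [regs_setReg]
  split
  · exact hv
  · exact h.1 y

theorem State.Bounded.setCell {B : ℕ} {s : State} (h : s.Bounded B) {a i v : ℕ}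
    (hv : v < 2 ^ B) : (s.setCell a i v).Bounded B := by
  refine ⟨h.1, fun b j => ?_⟩
  rw [arrays_setCell]
  split
  · exact hv
  · exact h.2 b j

theorem size_add_le (a b : ℕ) : (a + b).size ≤ a.size + b.size + 1 := by
  rw [Nat.size_le]
  have ha := Nat.lt_size_self a
  have hb := Nat.lt_size_self b
  have h1 : 2 ^ a.size ≤ 2 ^ (a.size + b.size) := Nat.pow_le_pow_right (by norm_num) (by omega)
  have h2 : 2 ^ b.size ≤ 2 ^ (a.size + b.size) := Nat.pow_le_pow_right (by norm_num) (by omega)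
  rw [pow_succ]; omega

theorem size_mul_le (a b : ℕ) : (a * b).size ≤ a.size + b.size := by
  rw [Nat.size_le, pow_add]
  exact Nat.mul_lt_mul'' (Nat.lt_size_self a) (Nat.lt_size_self b)

theorem size_le_self (a : ℕ) : a.size ≤ a := Nat.size_le.2 Nat.lt_two_pow_self

theorem size_eval_le {B : ℕ} {s : State} (hs : s.Bounded B) (e : Expr) :
    (e.eval s).size ≤ e.len * (B + 1) := by
  induction e with
  | const c => simp only [eval_const, Expr.len]; have := size_le_self c; nlinarith
  | reg x => simpa [Expr.len] using (Nat.size_le.2 (hs.1 x)).trans (Nat.le_succ B)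
  | cell a i ih =>
    have := Nat.size_le.2 (hs.2 a (i.eval s))
    simp only [eval_cell, Expr.len]; nlinarith
  | op o e f ihe ihf =>
    have key : (e.len + f.len + 1) * (B + 1) = e.len * (B + 1) + f.len * (B + 1) + (B + 1) := by
      ring
    simp only [Expr.len, key]
    cases o with
    | add => have := size_add_le (e.eval s) (f.eval s); rw [eval_add]; omega
    | sub =>
      have := Nat.size_le_size (Nat.sub_le (e.eval s) (f.eval s)); rw [eval_sub]; omega
    | mul => have := size_mul_le (e.eval s) (f.eval s); rw [eval_mul]; omega
    | div =>
      have := Nat.size_le_size (Nat.div_le_self (e.eval s) (f.eval s)); rw [eval_div]; omega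
    | mod =>
      have := Nat.size_le_size (Nat.mod_le (e.eval s) (f.eval s)); rw [eval_mod]; omega
    | lt =>
      have : (if e.eval s < f.eval s then 1 else 0).size ≤ 1 := by split <;> simp
      rw [eval_lt]; omega
    | eq =>
      have : (if e.eval s = f.eval s then 1 else 0).size ≤ 1 := by split <;> simp
      rw [eval_eq]; omega

theorem cost_le {B : ℕ} {s : State} (hs : s.Bounded B) (e : Expr) :
    e.cost s ≤ e.len * e.len * (B + 2) := by
  induction e with
  | const c => simp only [Expr.cost, Expr.len]; have := size_le_self c; nlinarith
  | reg x => simp only [Expr.cost, Expr.len]; have := Nat.size_le.2 (hs.1 x); omega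
  | cell a i ih =>
    have := Nat.size_le.2 (hs.2 a (i.eval s))
    simp only [Expr.cost, Expr.len]; nlinarith
  | op o e f ihe ihf =>
    have h := size_eval_le hs (.op o e f)
    simp only [Expr.eval] at h
    simp only [Expr.cost, Expr.len] at *
    have h1 : (e.len + f.len + 1) * (B + 1) + 1 ≤ (e.len + f.len + 1) * (B + 2) := by nlinarith
    have h2 : (e.len * e.len + f.len * f.len + (e.len + f.len + 1)) * (B + 2) ≤
        (e.len + f.len + 1) * (e.len + f.len + 1) * (B + 2) :=
      Nat.mul_le_mul_right _ (by nlinarith)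
    nlinarith

section bounds

variable {R : List ℕ} {mr M L : ℕ} {s : State}

/-- The registers of `R` are at most `L`, except that `mr` is at most `M`. -/
def ParamBound (R : List ℕ) (mr M L : ℕ) (s : State) : Prop :=
  ∀ r ∈ R, s.regs r ≤ if r = mr then M else L

theorem eval_poly_le (hL : 2 ≤ L) (hM : 1 ≤ M) (hR : ParamBound R mr M L s) (e : Expr)
    (he : e.isPoly R) : e.eval s ≤ M ^ e.degM mr * L ^ e.degL := by
  induction e with
  | const c =>
    simp only [eval_const, Expr.degM, Expr.degL, pow_zero, one_mul]
    exact Nat.lt_two_pow_self.le.trans (Nat.pow_le_pow_left hL c)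
  | reg x =>
    have := hR x (by simpa [Expr.isPoly] using he)
    simp only [eval_reg, Expr.degM, Expr.degL]
    split at this <;> simp_all
    nlinarith
  | cell a i ih => simp [Expr.isPoly] at he
  | op o e f ihe ihf =>
    cases o with
    | add =>
      simp only [Expr.isPoly, Bool.and_eq_true] at he
      have h1 := ihe he.1
      have h2 := ihf he.2
      simp only [eval_add, Expr.degM, Expr.degL]
      set i := max (e.degM mr) (f.degM mr)
      set j := max e.degL f.degL
      have a1 : M ^ e.degM mr * L ^ e.degL ≤ M ^ i * L ^ j :=
        Nat.mul_le_mul (Nat.pow_le_pow_right hM (le_max_left _ _))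
          (Nat.pow_le_pow_right (by omega) (le_max_left _ _))
      have a2 : M ^ f.degM mr * L ^ f.degL ≤ M ^ i * L ^ j :=
        Nat.mul_le_mul (Nat.pow_le_pow_right hM (le_max_right _ _))
          (Nat.pow_le_pow_right (by omega) (le_max_right _ _))
      rw [pow_succ, ← mul_assoc]
      nlinarith
    | mul =>
      simp only [Expr.isPoly, Bool.and_eq_true] at he
      calc e.eval s * f.eval s ≤ _ := Nat.mul_le_mul (ihe he.1) (ihf he.2)
        _ = _ := by simp only [Expr.degM, Expr.degL, pow_add]; ring
    | _ => simp [Expr.isPoly] at he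

theorem monomial_lt {i j B : ℕ} (hM : M ≤ 2 ^ L) (hL : 1 ≤ L) (hB : L * (i + j + 1) ≤ B) :
    M ^ i * L ^ j < 2 ^ B := by
  calc M ^ i * L ^ j ≤ (2 ^ L) ^ i * (2 ^ L) ^ j :=
        Nat.mul_le_mul (Nat.pow_le_pow_left hM i) (Nat.pow_le_pow_left Nat.lt_two_pow_self.le j)
    _ = 2 ^ (L * (i + j)) := by rw [← pow_add, ← pow_mul]
    _ < 2 ^ B := Nat.pow_lt_pow_right (by norm_num) (by nlinarith)

theorem eval_safe_lt {Z : List ℕ} {B : ℕ} (hL : 2 ≤ L) (hM : 1 ≤ M) (hML : M ≤ 2 ^ L)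
    (hR : ParamBound R mr M L s) (hZ : ∀ r ∈ Z, 0 < s.regs r) (hs : s.Bounded B) (e : Expr)
    (he : e.isSafe R Z) (hB : L * e.need mr ≤ B) : e.eval s < 2 ^ B := by
  induction e with
  | const c =>
    simp only [Expr.need] at hB
    exact Nat.lt_two_pow_self.trans_le (Nat.pow_le_pow_right (by norm_num)
      (by simp only [eval_const]; nlinarith))
  | reg x => exact hs.1 x
  | cell a i ih => exact hs.2 a _
  | op o e f ihe ihf =>
    cases o with
    | add =>
      exact (eval_poly_le hL hM hR _ he).trans_lt
        (monomial_lt hML (by omega) (by simpa only [Expr.need] using hB))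
    | mul =>
      exact (eval_poly_le hL hM hR _ he).trans_lt
        (monomial_lt hML (by omega) (by simpa only [Expr.need] using hB))
    | sub => exact (Nat.sub_le _ _).trans_lt (ihe he hB)
    | div => exact (Nat.div_le_self _ _).trans_lt (ihe he hB)
    | mod =>
      by_cases h : e.isSafe R Z = true
      · exact (Nat.mod_le _ _).trans_lt (ihe h hB)
      · cases f with
        | reg r =>
          simp only [Expr.isSafe, Bool.or_eq_true, h] at he
          rw [eval_mod]
          exact (Nat.mod_lt _ (hZ r (by simpa using he))).trans (hs.1 r)
        | const | cell | op => simp [Expr.isSafe, h] at he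
    | lt =>
      have : 1 < 2 ^ B := Nat.one_lt_two_pow (by simp only [Expr.need] at hB; omega)
      rw [eval_lt]; split <;> omega
    | eq =>
      have : 1 < 2 ^ B := Nat.one_lt_two_pow (by simp only [Expr.need] at hB; omega)
      rw [eval_eq]; split <;> omega

end bounds

theorem le_pow_self' {L : ℕ} (hL : 2 ≤ L) (c : ℕ) : c ≤ L ^ c :=
  Nat.lt_two_pow_self.le.trans (Nat.pow_le_pow_left hL c)

theorem eval_poly_congr {R : List ℕ} {s s' : State} (h : ∀ r ∈ R, s'.regs r = s.regs r) (e : Expr)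
    (he : e.isPoly R) : e.eval s' = e.eval s := by
  induction e with
  | const c => rfl
  | reg x => exact h x (by simpa [Expr.isPoly] using he)
  | cell a i ih => simp [Expr.isPoly] at he
  | op o e f ihe ihf =>
    cases o with
    | add | mul =>
      simp only [Expr.isPoly, Bool.and_eq_true] at he
      simp [ihe he.1, ihf he.2]
    | _ => simp [Expr.isPoly] at he

namespace Prog

theorem writesReg_of_isTame {R Z : List ℕ} (p : Prog) (h : p.isTame R Z) {r : ℕ}
    (hr : r ∈ R ∨ r ∈ Z) : p.writesReg r = false := by
  induction p with
  | skip | store => rfl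
  | assign x e | flip x =>
    simp only [isTame, Bool.and_eq_true, Bool.not_eq_true', List.contains_eq_mem,
      decide_eq_false_iff_not] at h
    simp only [writesReg, beq_eq_false_iff_ne]
    rintro rfl
    tauto
  | seq p q ihp ihq | ite e p q ihp ihq =>
    simp only [isTame, Bool.and_eq_true] at h
    simp [writesReg, ihp h.1, ihq h.2]
  | count x e p ih =>
    simp only [isTame, Bool.and_eq_true, Bool.not_eq_true', List.contains_eq_mem,
      decide_eq_false_iff_not] at h
    simp only [writesReg, Bool.or_eq_false_iff, beq_eq_false_iff_ne]
    refine ⟨?_, ih h.2⟩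
    rintro rfl
    tauto

/-- A counting loop executes as its rounds do, if its bound does not change. -/
theorem exec_count {x : ℕ} {e : Expr} {p : Prog} {s : State} {T c : ℕ}
    (he : ∀ k ≤ e.eval s, e.eval (rounds p.run x s k) = e.eval s)
    (hx : p.writesReg x = false)
    (hc : ∀ k ≤ e.eval s, (Expr.op .lt (.reg x) e).cost (rounds p.run x s k) ≤ c)
    (hc' : ∀ k < e.eval s, (Expr.op .add (.reg x) (.const 1)).cost
      (p.run (rounds p.run x s k)) ≤ c)
    (hp : ∀ k < e.eval s, ∃ t, Exec p.toCmd (rounds p.run x s k) (p.run (rounds p.run x s k)) t ∧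
      t ≤ T) :
    ∃ t, Exec (count x e p).toCmd s ((count x e p).run s) t ∧
      t ≤ (e.eval s + 1) * (T + (2 * c + 4)) := by
  set N := e.eval s
  have loop : ∀ d k, k + d = N → ∃ t, Exec (.loop (.op .lt (.reg x) e)
      (.seq p.toCmd (.assign x (.op .add (.reg x) (.const 1))))) (rounds p.run x s k)
      (rounds p.run x s N) t ∧ t ≤ d * (T + (2 * c + 2)) + (c + 1) := by
    intro d
    induction d with
    | zero =>
      intro k hk
      obtain rfl : k = N := by omega
      refine ⟨_, Exec.loop_false ?_, ?_⟩
      · simp [rounds_counter, he N le_rfl]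
      · have := hc N le_rfl; omega
    | succ d ih =>
      intro k hk
      obtain ⟨t', ht', hl'⟩ := ih (k + 1) (by omega)
      obtain ⟨t, ht, hl⟩ := hp k (by omega)
      have h1 := hc k (by omega)
      have h2 := hc' k (by omega)
      have hass := Exec.assign (p.run (rounds p.run x s k)) x (.op .add (.reg x) (.const 1))
      have hv : (Expr.op .add (.reg x) (.const 1)).eval (p.run (rounds p.run x s k)) = k + 1 := by
        simp [run_regs p hx, rounds_counter]
      rw [hv] at hass
      refine ⟨_, Exec.loop_true ?_ (Exec.seq ht hass) ht', ?_⟩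
      · have : k < N := by omega
        simp [rounds_counter, he k (by omega), this]
      · have : (d + 1) * (T + (2 * c + 2)) = d * (T + (2 * c + 2)) + (T + (2 * c + 2)) := by ring
        omega
  obtain ⟨t, ht, hl⟩ := loop N 0 (by omega)
  refine ⟨_, Exec.seq (Exec.assign s x (.const 0)) ht, ?_⟩
  simp only [Expr.cost, Nat.size_zero]
  have : N * (T + (2 * c + 2)) ≤ N * (T + (2 * c + 4)) := Nat.mul_le_mul_left _ (by omega)
  have : (N + 1) * (T + (2 * c + 4)) = N * (T + (2 * c + 4)) + (T + (2 * c + 4)) := by ring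
  omega

theorem add_monomial_le {M L i i' j j' : ℕ} (hM : 1 ≤ M) (hL : 2 ≤ L) :
    M ^ i * L ^ j + M ^ i' * L ^ j' ≤ M ^ max i i' * L ^ (j + j' + 1) := by
  have h1 : M ^ i * L ^ j ≤ M ^ max i i' * L ^ (j + j') :=
    Nat.mul_le_mul (Nat.pow_le_pow_right hM (le_max_left _ _))
      (Nat.pow_le_pow_right (by omega) (by omega))
  have h2 : M ^ i' * L ^ j' ≤ M ^ max i i' * L ^ (j + j') :=
    Nat.mul_le_mul (Nat.pow_le_pow_right hM (le_max_right _ _))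
      (Nat.pow_le_pow_right (by omega) (by omega))
  rw [pow_succ, ← mul_assoc]
  have := Nat.mul_le_mul_left (M ^ max i i' * L ^ (j + j')) hL
  omega

/-- A tame program halts, its values stay bounded, and its cost is bounded by a monomial. -/
theorem exec_of_isTame {R Z : List ℕ} {mr M L B : ℕ} (hL : 2 ≤ L) (hM : 1 ≤ M) (hML : M ≤ 2 ^ L)
    (p : Prog) (hp : p.isTame R Z) (hB : L * p.need mr ≤ B) (s : State) (hs : s.Bounded B)
    (hR : ParamBound R mr M L s) (hZ : ∀ r ∈ Z, 0 < s.regs r) :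
    (p.run s).Bounded B ∧ ∃ t, Exec p.toCmd s (p.run s) t ∧
      t ≤ (B + 2) * (M ^ p.degM mr * L ^ p.degL) := by
  induction p generalizing s with
  | skip =>
    refine ⟨hs, _, .skip s, ?_⟩
    simp [degM, degL]
  | assign x e =>
    simp only [isTame, Bool.and_eq_true] at hp
    refine ⟨hs.setReg (eval_safe_lt hL hM hML hR hZ hs e hp.2 hB), _, .assign s x e, ?_⟩
    have h1 := cost_le hs e
    have h2 := le_pow_self' hL (e.len * e.len + 1)
    have h3 := Nat.mul_le_mul_left (B + 2) h2
    simp only [degM, degL, pow_zero, one_mul]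
    nlinarith
  | store a i e =>
    simp only [isTame] at hp
    refine ⟨hs.setCell (eval_safe_lt hL hM hML hR hZ hs e hp hB), _, .store s a i e, ?_⟩
    have h1 := cost_le hs e
    have h1' := cost_le hs i
    have h2 := le_pow_self' hL (i.len * i.len + e.len * e.len + 1)
    have h3 := Nat.mul_le_mul_left (B + 2) h2
    simp only [degM, degL, pow_zero, one_mul]
    nlinarith
  | flip x =>
    refine ⟨⟨fun y => ?_, hs.2⟩, _, .flip s x, ?_⟩
    · simp only [need, mul_one] at hB
      have : 1 < 2 ^ B := Nat.one_lt_two_pow (by omega)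
      rw [run_flip, regs_flipCoin]
      split
      · exact (Bool.toNat_le _).trans_lt this
      · exact hs.1 y
    · simp [degM, degL]
  | seq p q ihp ihq =>
    simp only [isTame, Bool.and_eq_true] at hp
    simp only [need] at hB
    obtain ⟨b1, t1, e1, l1⟩ := ihp hp.1
      ((Nat.mul_le_mul_left _ (le_max_left _ _)).trans hB) s hs hR hZ
    obtain ⟨b2, t2, e2, l2⟩ := ihq hp.2
      ((Nat.mul_le_mul_left _ (le_max_right _ _)).trans hB) (p.run s) b1
      (fun r hr => by rw [run_regs p (writesReg_of_isTame p hp.1 (.inl hr))]; exact hR r hr)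
      (fun r hr => by rw [run_regs p (writesReg_of_isTame p hp.1 (.inr hr))]; exact hZ r hr)
    refine ⟨b2, _, .seq e1 e2, (Nat.add_le_add l1 l2).trans ?_⟩
    rw [← mul_add]
    exact Nat.mul_le_mul_left _ (add_monomial_le hM hL)
  | ite e p q ihp ihq =>
    simp only [isTame, Bool.and_eq_true] at hp
    simp only [need] at hB
    obtain ⟨b1, t1, e1, l1⟩ := ihp hp.1
      ((Nat.mul_le_mul_left _ (le_max_left _ _)).trans hB) s hs hR hZ
    obtain ⟨b2, t2, e2, l2⟩ := ihq hp.2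
      ((Nat.mul_le_mul_left _ (le_max_right _ _)).trans hB) s hs hR hZ
    have hc := cost_le hs e
    have h2 := le_pow_self' hL (e.len * e.len + 1)
    have h3 := Nat.mul_le_mul_left (B + 2) h2
    have h4 : 1 + e.cost s ≤ (B + 2) * (M ^ 0 * L ^ (e.len * e.len + 1)) := by
      rw [pow_zero, one_mul]; nlinarith
    have key : ∀ i j, i ≤ max (p.degM mr) (q.degM mr) → j ≤ p.degL + q.degL →
        (B + 2) * (M ^ 0 * L ^ (e.len * e.len + 1)) + (B + 2) * (M ^ i * L ^ j) ≤
        (B + 2) * (M ^ (ite e p q).degM mr * L ^ (ite e p q).degL) := by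
      intro i j hi hj
      rw [← mul_add]
      refine Nat.mul_le_mul_left _ ((add_monomial_le hM hL).trans ?_)
      refine Nat.mul_le_mul (Nat.pow_le_pow_right hM ?_) (Nat.pow_le_pow_right (by omega) ?_)
      · simpa [degM] using hi
      · simp only [degL]; omega
    by_cases he : e.eval s = 0
    · have hr : (ite e p q).run s = q.run s := by simp [he]
      rw [hr]
      exact ⟨b2, _, .ite_false he e2, (Nat.add_le_add h4 l2).trans
        (key _ _ (le_max_right _ _) (by omega))⟩
    · have hr : (ite e p q).run s = p.run s := by simp [he]
      rw [hr]
      exact ⟨b1, _, .ite_true he e1, (Nat.add_le_add h4 l1).trans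
        (key _ _ (le_max_left _ _) (by omega))⟩
  | count x e p ih =>
    simp only [isTame, Bool.and_eq_true, Bool.not_eq_true', List.contains_eq_mem,
      decide_eq_false_iff_not] at hp
    obtain ⟨⟨⟨⟨hxR, hxZ⟩, he⟩, hx⟩, hp⟩ := hp
    simp only [need] at hB
    have hN := eval_poly_le hL hM hR e he
    have hN' : e.eval s < 2 ^ B := hN.trans_lt (monomial_lt hML (by omega)
      ((Nat.mul_le_mul_left _ (le_max_left _ _)).trans hB))
    have hBp : L * p.need mr ≤ B := (Nat.mul_le_mul_left _ (le_max_right _ _)).trans hB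
    have inv : ∀ k ≤ e.eval s, (rounds p.run x s k).Bounded B ∧
        ∀ r, r ∈ R ∨ r ∈ Z → (rounds p.run x s k).regs r = s.regs r := by
      intro k
      induction k with
      | zero =>
        refine fun _ => ⟨hs.setReg (by positivity), fun r hr => ?_⟩
        have : r ≠ x := by rintro rfl; tauto
        simp [rounds, this]
      | succ k ihk =>
        intro hk
        obtain ⟨b, hr⟩ := ihk (by omega)
        refine ⟨(ih hp hBp _ b (fun r h => by rw [hr r (.inl h)]; exact hR r h)
          (fun r h => by rw [hr r (.inr h)]; exact hZ r h)).1.setReg (by omega), fun r h => ?_⟩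
        have : r ≠ x := by rintro rfl; tauto
        simp [rounds, this, run_regs p (writesReg_of_isTame p hp h), hr r h]
    have body : ∀ k ≤ e.eval s, (p.run (rounds p.run x s k)).Bounded B ∧
        ∃ t, Exec p.toCmd (rounds p.run x s k) (p.run (rounds p.run x s k)) t ∧
          t ≤ (B + 2) * (M ^ p.degM mr * L ^ p.degL) := fun k hk =>
      ih hp hBp _ (inv k hk).1 (fun r h => by rw [(inv k hk).2 r (.inl h)]; exact hR r h)
        (fun r h => by rw [(inv k hk).2 r (.inr h)]; exact hZ r h)
    refine ⟨(inv _ le_rfl).1, ?_⟩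
    set c := (B + 2) * ((e.len + 2) * (e.len + 2) + 16) with hc
    obtain ⟨t, ht, hl⟩ := exec_count (c := c)
      (fun k hk => eval_poly_congr (fun r hr => (inv k hk).2 r (.inl hr)) e he) hx
      (fun k hk => by
        refine (cost_le (inv k hk).1 _).trans ?_
        simp only [Expr.len, hc]; nlinarith)
      (fun k hk => by
        refine (cost_le (body k hk.le).1 _).trans ?_
        simp only [Expr.len, hc]; nlinarith)
      (fun k hk => (body k hk.le).2)
    refine ⟨t, ht, hl.trans ?_⟩
    have hpos : 1 ≤ M ^ e.degM mr * L ^ e.degL := Nat.mul_pos (by positivity) (by positivity)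
    set D := (e.len + 2) * (e.len + 2) + 20 with hD
    have h1 : 2 * c + 4 ≤ (B + 2) * (2 * D) := by rw [hc, hD]; nlinarith
    have h2 : 2 * D ≤ M ^ 0 * (L ^ (D + 1)) := by
      rw [pow_zero, one_mul, pow_succ]; nlinarith [le_pow_self' hL D]
    have h3 : (B + 2) * (M ^ p.degM mr * L ^ p.degL) + (2 * c + 4) ≤
        (B + 2) * (M ^ p.degM mr * L ^ (p.degL + (D + 1) + 1)) := by
      have := Nat.mul_le_mul_left (B + 2) h2
      have h4 := Nat.mul_le_mul_left (B + 2)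
        (add_monomial_le (i := p.degM mr) (j := p.degL) (i' := 0) (j' := D + 1) hM hL)
      simp only [Nat.max_zero] at h4
      nlinarith
    calc (e.eval s + 1) * ((B + 2) * (M ^ p.degM mr * L ^ p.degL) + (2 * c + 4))
        ≤ (M ^ e.degM mr * L ^ (e.degL + 1)) *
          ((B + 2) * (M ^ p.degM mr * L ^ (p.degL + (D + 1) + 1))) := by
          refine Nat.mul_le_mul ?_ h3
          rw [pow_succ, ← mul_assoc]
          nlinarith
      _ = (B + 2) * (M ^ (e.degM mr + p.degM mr) *
          L ^ (e.degL + 1 + (p.degL + (D + 1) + 1))) := by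
          rw [pow_add M, pow_add L]; ring
      _ ≤ _ := by
          simp only [degM, degL]
          refine Nat.mul_le_mul_left _ (Nat.mul_le_mul_left _
            (Nat.pow_le_pow_right (by omega) (by omega)))

end Prog

end CoinRAM

/-! ### A sieve with determinants in characteristic two -/

section pairingSieve

open Finset

/-- Involutions without fixed points. -/
def IsPairing {α : Type*} (τ : Equiv.Perm α) : Prop :=
  (∀ a, τ (τ a) = a) ∧ ∀ a, τ a ≠ a

variable {N m : ℕ} {R : Type*} [CommRing R]

open Classical in
theorem prod_pairing {M : Type*} [CommMonoid M] {τ : Equiv.Perm (Fin N)} (hτ : IsPairing τ)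
    (g : Fin N → M) :
    ∏ a, g a = ∏ a, if a < τ a then g a * g (τ a) else 1 := by
  have h1 : ∏ a, g a = (∏ a, if a < τ a then g a else 1) * ∏ a, if a < τ a then 1 else g a := by
    rw [← Finset.prod_mul_distrib]
    refine Finset.prod_congr rfl fun a _ => ?_
    split <;> simp
  have h2 : (∏ a, if a < τ a then 1 else g a) = ∏ a, if a < τ a then g (τ a) else 1 := by
    rw [← Equiv.prod_comp τ]
    refine Finset.prod_congr rfl fun a _ => ?_
    rw [hτ.1 a]
    rcases lt_or_gt_of_ne (hτ.2 a) with h | h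
    · rw [if_pos h, if_neg (not_lt_of_gt h)]
    · rw [if_neg (not_lt_of_gt h), if_pos h]
  rw [h1, h2, ← Finset.prod_mul_distrib]
  refine Finset.prod_congr rfl fun a _ => ?_
  split <;> simp

open Classical in
/-- In characteristic two the determinant of a symmetric matrix with zero diagonal is a sum over
perfect matchings. -/
theorem det_eq_sum_pairing [CharP R 2] (A : Matrix (Fin N) (Fin N) R)
    (hA : ∀ a b, A a b = A b a) (hd : ∀ a, A a a = 0) :
    A.det = ∑ τ : Equiv.Perm (Fin N) with IsPairing τ,
      ∏ a, if a < τ a then A a (τ a) ^ 2 else 1 := by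
  have h2 (x : R) : x + x = 0 := CharTwo.add_self_eq_zero x
  have h1 : A.det = ∑ τ : Equiv.Perm (Fin N), ∏ a, A (τ a) a := by
    rw [Matrix.det_apply']
    refine Finset.sum_congr rfl fun τ _ => ?_
    rcases Int.units_eq_one_or (Equiv.Perm.sign τ) with h | h
    · simp [h]
    · simp [h, CharTwo.neg_eq]
  have hinv (τ : Equiv.Perm (Fin N)) : ∏ a, A (τ⁻¹ a) a = ∏ a, A (τ a) a := by
    rw [← Equiv.prod_comp τ]
    refine Finset.prod_congr rfl fun a _ => ?_
    rw [show τ⁻¹ (τ a) = a by simp, hA]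
  rw [h1, ← Finset.sum_filter_add_sum_filter_not univ IsPairing]
  have h3 : ∑ τ : Equiv.Perm (Fin N) with ¬ IsPairing τ, ∏ a, A (τ a) a = 0 := by
    refine Finset.sum_involution (fun τ _ => τ⁻¹) ?_ ?_ ?_ ?_
    · intro τ _; rw [hinv, h2]
    · intro τ hτ hne heq
      simp only [mem_filter, mem_univ, true_and] at hτ
      apply hτ
      refine ⟨fun a => ?_, fun a ha => hne ?_⟩
      · have := congrArg (fun σ => σ (τ a)) heq
        simpa using this.symm
      · exact Finset.prod_eq_zero (mem_univ a) (by rw [ha, hd])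
    · intro τ hτ
      simp only [mem_filter, mem_univ, true_and] at hτ ⊢
      intro h
      apply hτ
      refine ⟨fun a => ?_, fun a ha => h.2 a ?_⟩
      · have := h.1 (τ (τ a)); simpa using this.symm
      · rw [Equiv.Perm.inv_eq_iff_eq, ha]
    · intro τ _; simp
  rw [h3, add_zero]
  refine Finset.sum_congr rfl fun τ hτ => ?_
  simp only [mem_filter, mem_univ, true_and] at hτ
  rw [prod_pairing hτ]
  refine Finset.prod_congr rfl fun a _ => ?_
  rw [hτ.1 a, hA (τ a) a, sq]

/-- The symmetric matrix with zero diagonal and the given entries above the diagonal. -/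
def symmMatrix (w : Fin N → Fin N → R) : Matrix (Fin N) (Fin N) R :=
  fun a b => if a < b then w a b else if b < a then w b a else 0

/-- Labels for the pairs of `τ`, given at the smaller elements, that together cover `Fin m`. -/
def IsCover (τ : Equiv.Perm (Fin N)) (f : Fin N → Finset (Fin m)) : Prop :=
  (∀ a, ¬ a < τ a → f a = ∅) ∧ ∀ x, ∃ a, x ∈ f a

open Classical in
theorem card_supersets_cast [CharP R 2] (f : Fin N → Finset (Fin m)) :
    ((#{Y : Finset (Fin m) | ∀ a, f a ⊆ Y} : ℕ) : R) = if ∀ x, ∃ a, x ∈ f a then 1 else 0 := by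
  have h1 : ({Y : Finset (Fin m) | ∀ a, f a ⊆ Y} : Finset (Finset (Fin m))) =
      Finset.Icc (univ.biUnion f) univ := by
    ext Y; simp
  rw [h1, Finset.card_Icc_finset (subset_univ _)]
  split_ifs with h
  · have : univ.biUnion f = univ := by ext x; simpa using h x
    simp [this]
  · have hlt : #(univ.biUnion f) < #(univ : Finset (Fin m)) := by
      apply Finset.card_lt_card
      rw [Finset.ssubset_univ_iff]
      intro h'
      apply h
      intro x
      have : x ∈ univ.biUnion f := by rw [h']; simp
      simpa using this
    obtain ⟨d, hd⟩ := Nat.exists_eq_add_of_lt hlt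
    have : #(univ : Finset (Fin m)) - #(univ.biUnion f) = d + 1 := by omega
    rw [this, pow_succ, Nat.cast_mul]
    have : ((2 : ℕ) : R) = 0 := CharP.cast_eq_zero R 2
    rw [this, mul_zero]

open Classical in
/-- The sum of the determinants over all label sets is a square of a sum over perfect matchings
with labels that cover everything. -/
theorem sum_det_symmMatrix [CharP R 2] (g : Fin N → Fin N → Finset (Fin m) → R) :
    ∑ Y : Finset (Fin m), (symmMatrix fun a b => ∑ X ∈ Y.powerset, g a b X).det =
      (∑ τ : Equiv.Perm (Fin N) with IsPairing τ,
        ∑ f : Fin N → Finset (Fin m) with IsCover τ f,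
          ∏ a, if a < τ a then g a (τ a) (f a) else 1) ^ 2 := by
  have : Fact (Nat.Prime 2) := ⟨Nat.prime_two⟩
  have key (Y : Finset (Fin m)) (τ : Equiv.Perm (Fin N)) :
      (∏ a, if a < τ a then (symmMatrix fun a b => ∑ X ∈ Y.powerset, g a b X) a (τ a) ^ 2 else 1) =
      ∑ f : Fin N → Finset (Fin m), if (∀ a, ¬ a < τ a → f a = ∅) ∧ ∀ a, f a ⊆ Y then
        (∏ a, if a < τ a then g a (τ a) (f a) else 1) ^ 2 else 0 := by
    rw [← Finset.sum_filter]
    have e1 : ({f : Fin N → Finset (Fin m) | (∀ a, ¬ a < τ a → f a = ∅) ∧ ∀ a, f a ⊆ Y} :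
        Finset _) = Fintype.piFinset fun a => if a < τ a then Y.powerset else {∅} := by
      ext f
      simp only [mem_filter, mem_univ, true_and, Fintype.mem_piFinset]
      constructor
      · rintro ⟨h1, h2⟩ a
        split_ifs with h
        · simpa using h2 a
        · simpa using h1 a h
      · intro h
        refine ⟨fun a ha => by simpa [ha] using h a, fun a => ?_⟩
        by_cases ha : a < τ a
        · simpa [ha] using h a
        · have : f a = ∅ := by simpa [ha] using h a
          simp [this]
    rw [e1]
    simp_rw [← Finset.prod_pow]
    rw [← Finset.prod_univ_sum (fun a => if a < τ a then Y.powerset else {∅})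
      (fun a X => (if a < τ a then g a (τ a) X else 1) ^ 2)]
    refine Finset.prod_congr rfl fun a _ => ?_
    split_ifs with h
    · simp only [symmMatrix, if_pos h]
      rw [sum_pow_char]
    · simp
  have h1 (Y : Finset (Fin m)) := det_eq_sum_pairing
    (symmMatrix fun a b => ∑ X ∈ Y.powerset, g a b X)
    (fun a b => by
      simp only [symmMatrix]
      rcases lt_trichotomy a b with h | h | h
      · simp [h, not_lt_of_gt h]
      · simp [h]
      · simp [h, not_lt_of_gt h])
    (fun a => by simp [symmMatrix])
  simp_rw [h1, key]
  rw [Finset.sum_comm, sum_pow_char]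
  refine Finset.sum_congr rfl fun τ _ => ?_
  rw [Finset.sum_comm, sum_pow_char, Finset.sum_filter]
  refine Finset.sum_congr rfl fun f _ => ?_
  rw [← Finset.sum_filter, Finset.sum_const, nsmul_eq_mul]
  by_cases hf : ∀ a, ¬ a < τ a → f a = ∅
  · have : ({Y : Finset (Fin m) | (∀ a, ¬ a < τ a → f a = ∅) ∧ ∀ a, f a ⊆ Y} : Finset _) =
        ({Y : Finset (Fin m) | ∀ a, f a ⊆ Y} : Finset _) := by
      ext Y; simp only [mem_filter, mem_univ, true_and]; tauto
    rw [this, card_supersets_cast]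
    by_cases hc : ∀ x, ∃ a, x ∈ f a
    · rw [if_pos hc, if_pos ⟨hf, hc⟩, one_mul]
    · rw [if_neg hc, if_neg (fun h => hc h.2), zero_mul]
  · rw [if_neg (fun h => hf h.1)]
    have : ({Y : Finset (Fin m) | (∀ a, ¬ a < τ a → f a = ∅) ∧ ∀ a, f a ⊆ Y} : Finset _) = ∅ := by
      ext Y; simp only [mem_filter, mem_univ, true_and, notMem_empty, iff_false]; tauto
    rw [this]
    simp

/-- A perfect matching whose pairs carry admissible labels that cover everything. -/
def IsAdmissibleCover (ok : Fin N → Fin N → Finset (Fin m) → Prop) (τ : Equiv.Perm (Fin N))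
    (f : Fin N → Finset (Fin m)) : Prop :=
  IsPairing τ ∧ IsCover τ f ∧ ∀ a, a < τ a → ok a (τ a) (f a)

open Classical in
theorem sum_det_eq_zero_of_forall_not [CharP R 2] (ok : Fin N → Fin N → Finset (Fin m) → Prop)
    (h : ∀ τ f, ¬ IsAdmissibleCover ok τ f) (r : Fin N → Fin N → Finset (Fin m) → R) :
    ∑ Y : Finset (Fin m),
      (symmMatrix fun a b => ∑ X ∈ Y.powerset, if ok a b X then r a b X else 0).det = 0 := by
  rw [sum_det_symmMatrix]
  suffices hsum : ∑ τ : Equiv.Perm (Fin N) with IsPairing τ,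
      ∑ f : Fin N → Finset (Fin m) with IsCover τ f,
        ∏ a, (if a < τ a then if ok a (τ a) (f a) then r a (τ a) (f a) else 0 else 1) = 0 by
    rw [hsum]; simp
  refine Finset.sum_eq_zero fun τ hτ => Finset.sum_eq_zero fun f hf => ?_
  simp only [mem_filter, mem_univ, true_and] at hτ hf
  have : ∃ a, a < τ a ∧ ¬ ok a (τ a) (f a) := by
    by_contra hcon
    push Not at hcon
    exact h τ f ⟨hτ, hf, hcon⟩
  obtain ⟨a, ha, hok⟩ := this
  exact Finset.prod_eq_zero (mem_univ a) (by simp [ha, hok])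

open Classical in
/-- The polynomial that is tested for being zero. -/
noncomputable def coverPolynomial (F : Type*) [CommRing F] {K : ℕ}
    (ok : Fin N → Fin N → Finset (Fin m) → Prop)
    (enc : Fin N → Fin N → Finset (Fin m) → Fin K) : MvPolynomial (Fin K) F :=
  ∑ p : Equiv.Perm (Fin N) × (Fin N → Finset (Fin m)) with IsAdmissibleCover ok p.1 p.2,
    MvPolynomial.monomial (∑ a, if a < p.1 a then Finsupp.single (enc a (p.1 a) (p.2 a)) 1 else 0) 1

variable {F : Type*} [Field F] {K : ℕ} {ok : Fin N → Fin N → Finset (Fin m) → Prop}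
  {enc : Fin N → Fin N → Finset (Fin m) → Fin K}

theorem sum_single_ne_zero_iff {ι : Type*} [Fintype ι] (P : ι → Prop) [DecidablePred P]
    (e : ι → Fin K) (x : Fin K) :
    (∑ a, if P a then Finsupp.single (e a) 1 else 0 : Fin K →₀ ℕ) x ≠ 0 ↔ ∃ a, P a ∧ e a = x := by
  rw [Finsupp.finsetSum_apply, ne_eq, Finset.sum_eq_zero_iff, not_forall]
  refine exists_congr fun a => ?_
  by_cases h : P a <;> simp [h, Finsupp.single_apply]

open Classical in
theorem coverPolynomial_ne_zero
    (henc : ∀ a b X a' b' X', enc a b X = enc a' b' X' → a = a' ∧ b = b' ∧ X = X')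
    {τ : Equiv.Perm (Fin N)} {f : Fin N → Finset (Fin m)} (h : IsAdmissibleCover ok τ f) :
    coverPolynomial F ok enc ≠ 0 := by
  intro h0
  have hc := congrArg (MvPolynomial.coeff
    (∑ a, if a < τ a then Finsupp.single (enc a (τ a) (f a)) 1 else 0)) h0
  rw [coverPolynomial, MvPolynomial.coeff_sum, MvPolynomial.coeff_zero,
    Finset.sum_eq_single (τ, f)] at hc
  · simp [MvPolynomial.coeff_monomial] at hc
  · rintro ⟨τ', f'⟩ hp hne
    simp only [mem_filter, mem_univ, true_and] at hp
    rw [MvPolynomial.coeff_monomial, if_neg]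
    intro heq
    apply hne
    have hx : ∀ a, a < τ' a → a < τ a ∧ τ a = τ' a ∧ f a = f' a := by
      intro a ha
      have : (∑ b, if b < τ' b then Finsupp.single (enc b (τ' b) (f' b)) 1 else 0 : Fin K →₀ ℕ)
          (enc a (τ' a) (f' a)) ≠ 0 :=
        (sum_single_ne_zero_iff (fun b => b < τ' b) (fun b => enc b (τ' b) (f' b)) _).2 ⟨a, ha, rfl⟩
      rw [heq] at this
      obtain ⟨b, hb, he⟩ := (sum_single_ne_zero_iff (fun b => b < τ b)
        (fun b => enc b (τ b) (f b)) _).1 this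
      obtain ⟨rfl, h1, h2⟩ := henc _ _ _ _ _ _ he
      exact ⟨hb, h1, h2⟩
    have hτ : ∀ a, τ a = τ' a := by
      intro a
      rcases lt_or_gt_of_ne (hp.1.2 a) with ha | ha
      · have h1 := (hx (τ' a) (by rwa [hp.1.1 a])).2.1
        rw [hp.1.1 a] at h1
        have := h.1.1 (τ' a)
        rw [h1] at this
        exact this
      · exact (hx a ha).2.1
    have hτ' : τ' = τ := Equiv.ext fun a => (hτ a).symm
    subst hτ'
    refine Prod.ext rfl (funext fun a => ?_)
    by_cases ha : a < τ' a
    · exact (hx a ha).2.2.symm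
    · exact (hp.2.1.1 a ha).trans (h.2.1.1 a ha).symm
  · intro hn
    exact absurd (by simpa using h) hn

theorem totalDegree_coverPolynomial_le : (coverPolynomial F ok enc).totalDegree ≤ N := by
  classical
  refine MvPolynomial.totalDegree_finsetSum_le fun p _ => ?_
  refine (MvPolynomial.totalDegree_monomial_le _ _).trans ?_
  have : (∑ a, if a < p.1 a then Finsupp.single (enc a (p.1 a) (p.2 a)) 1 else 0 :
      Fin K →₀ ℕ).degree ≤ N := by
    rw [map_sum]
    refine (Finset.sum_le_card_nsmul univ _ 1 fun a _ => ?_).trans (by simp)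
    split <;> simp
  exact this

open Classical in
theorem sum_det_eq_sq_eval [CharP F 2] (ρ : Fin K → F) :
    ∑ Y : Finset (Fin m), (symmMatrix fun a b =>
      ∑ X ∈ Y.powerset, if ok a b X then ρ (enc a b X) else 0).det =
      (MvPolynomial.eval ρ (coverPolynomial F ok enc)) ^ 2 := by
  rw [sum_det_symmMatrix, coverPolynomial, map_sum]
  congr 1
  rw [Finset.sum_filter, Finset.sum_filter, Fintype.sum_prod_type]
  refine Finset.sum_congr rfl fun τ _ => ?_
  by_cases hτ : IsPairing τ
  swap
  · rw [if_neg hτ]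
    exact (Finset.sum_eq_zero fun f _ => if_neg fun h => hτ h.1).symm
  rw [if_pos hτ, Finset.sum_filter]
  refine Finset.sum_congr rfl fun f _ => ?_
  by_cases hf : IsCover τ f
  swap
  · rw [if_neg hf, if_neg fun h => hf h.2.1]
  rw [if_pos hf]
  by_cases hok : ∀ a, a < τ a → ok a (τ a) (f a)
  · rw [if_pos ⟨hτ, hf, hok⟩, MvPolynomial.eval_monomial, one_mul,
      ← Finsupp.prod_finsetSum_index (fun _ => pow_zero _) (fun _ _ _ => pow_add _ _ _)]
    refine Finset.prod_congr rfl fun a _ => ?_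
    by_cases ha : a < τ a
    · simp [ha, hok a ha]
    · simp [ha]
  · rw [if_neg fun h => hok h.2.2]
    push Not at hok
    obtain ⟨a, ha, hn⟩ := hok
    exact Finset.prod_eq_zero (mem_univ a) (by simp [ha, hn])

open Classical in
/-- The number of random choices for which a nonzero test is missed. -/
theorem card_sum_det_eq_zero_mul_le [CharP F 2] [Fintype F]
    (henc : ∀ a b X a' b' X', enc a b X = enc a' b' X' → a = a' ∧ b = b' ∧ X = X')
    {τ : Equiv.Perm (Fin N)} {f : Fin N → Finset (Fin m)} (h : IsAdmissibleCover ok τ f) :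
    #{ρ : Fin K → F | ∑ Y : Finset (Fin m), (symmMatrix fun a b =>
      ∑ X ∈ Y.powerset, if ok a b X then ρ (enc a b X) else 0).det = 0} * Fintype.card F ≤
      N * Fintype.card F ^ K := by
  have hS := MvPolynomial.schwartz_zippel_totalDegree (coverPolynomial_ne_zero (F := F) henc h)
    (univ : Finset F)
  have hF : (0 : ℚ≥0) < Fintype.card F := by exact_mod_cast Fintype.card_pos
  rw [Finset.card_univ, div_le_div_iff₀ (pow_pos hF K) hF] at hS
  have hd : ((coverPolynomial F ok enc).totalDegree : ℚ≥0) ≤ N := by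
    exact_mod_cast totalDegree_coverPolynomial_le
  have hS' := hS.trans (mul_le_mul_of_nonneg_right hd (by positivity))
  have : #{ρ : Fin K → F | ∑ Y : Finset (Fin m), (symmMatrix fun a b =>
      ∑ X ∈ Y.powerset, if ok a b X then ρ (enc a b X) else 0).det = 0} =
      #{ρ ∈ Fintype.piFinset fun _ : Fin K => (univ : Finset F) |
        MvPolynomial.eval ρ (coverPolynomial F ok enc) = 0} := by
    congr 1
    ext ρ
    simp [sum_det_eq_sq_eval]
  rw [this]
  exact_mod_cast hS'

end pairingSieve

/-! ### Colorings with a co-triangle-free part -/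

namespace SimpleGraph

open Finset

section matching

variable {V : Type*} [Finite V] (G : SimpleGraph V)

theorem ncard_edgeSet_le_of_isMatching {M : G.Subgraph} (_ : M.IsMatching) :
    M.edgeSet.ncard ≤ (Set.univ : Set (Sym2 V)).ncard :=
  Set.ncard_le_ncard (Set.subset_univ _) (Set.toFinite _)

theorem exists_isMatching_ncard_eq_matchingNumber :
    ∃ M : G.Subgraph, M.IsMatching ∧ M.edgeSet.ncard = matchingNumber G := by
  have h : matchingNumber G ∈ {m | ∃ M : G.Subgraph, M.IsMatching ∧ M.edgeSet.ncard = m} := by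
    apply Nat.sSup_mem
    · exact ⟨_, ⊥, by simp [Subgraph.IsMatching], rfl⟩
    · refine ⟨(Set.univ : Set (Sym2 V)).ncard, ?_⟩
      rintro _ ⟨M, hM, rfl⟩
      exact G.ncard_edgeSet_le_of_isMatching hM
  exact h

theorem ncard_edgeSet_le_matchingNumber {M : G.Subgraph} (hM : M.IsMatching) :
    M.edgeSet.ncard ≤ matchingNumber G := by
  apply le_csSup
  · refine ⟨(Set.univ : Set (Sym2 V)).ncard, ?_⟩
    rintro _ ⟨M, hM, rfl⟩
    exact G.ncard_edgeSet_le_of_isMatching hM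
  · exact ⟨M, hM, rfl⟩

variable {G} in
theorem Subgraph.IsMatching.ncard_verts_le {M : G.Subgraph} (hM : M.IsMatching) :
    M.verts.ncard ≤ 2 * M.edgeSet.ncard := by
  classical
  rw [hM.verts_eq_biUnion_edgeSet]
  have hfin : M.edgeSet.Finite := Set.toFinite _
  have : (⋃ e ∈ M.edgeSet, (e : Set V)) = ⋃ e ∈ hfin.toFinset, (e : Set V) := by simp
  rw [this]
  refine (Finset.set_ncard_biUnion_le _ _).trans ?_
  rw [Set.ncard_eq_toFinset_card _ hfin, mul_comm]
  refine Finset.sum_le_card_nsmul _ _ 2 fun e _ => ?_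
  induction e with
  | _ a b => 
    have : ((s(a, b) : Sym2 V) : Set V) = {a, b} := by ext; simp
    rw [this]
    exact (Set.ncard_insert_le a {b}).trans (by simp)

theorem card_le_cliqueNum_add_matchingNumber_compl [Fintype V] :
    Fintype.card V ≤ G.cliqueNum + 2 * matchingNumber Gᶜ := by
  classical
  obtain ⟨M, hM, hc⟩ := Gᶜ.exists_isMatching_ncard_eq_matchingNumber
  have hcl : G.IsClique (((M.verts)ᶜ).toFinset : Finset V) := by
    intro u hu v hv huv
    simp only [Set.coe_toFinset, Set.mem_compl_iff] at hu hv
    by_contra hadj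
    have hadj' : Gᶜ.Adj u v := by rw [compl_adj]; exact ⟨huv, hadj⟩
    have hM' : (M ⊔ Gᶜ.subgraphOfAdj hadj').IsMatching := by
      refine hM.sup (Subgraph.IsMatching.subgraphOfAdj hadj') ?_
      rw [hM.support_eq_verts, (Subgraph.IsMatching.subgraphOfAdj hadj').support_eq_verts]
      rw [Set.disjoint_right]
      rintro w (rfl | rfl) <;> assumption
    have h1 := Gᶜ.ncard_edgeSet_le_matchingNumber hM'
    rw [Subgraph.edgeSet_sup, edgeSet_subgraphOfAdj, Set.union_singleton,
      Set.ncard_insert_of_notMem, hc] at h1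
    · omega
    · intro h
      exact hu (M.edge_vert (by simpa using h))
  have h1 := hcl.card_le_cliqueNum
  have h2 := hM.ncard_verts_le
  have h3 := Set.ncard_add_ncard_compl M.verts
  rw [Set.ncard_eq_toFinset_card' (M.vertsᶜ), Nat.card_eq_fintype_card] at h3
  omega

theorem matchingNumber_le_card [Fintype V] : matchingNumber G ≤ Fintype.card V := by
  classical
  obtain ⟨M, hM, hc⟩ := G.exists_isMatching_ncard_eq_matchingNumber
  have h := Nat.card_le_card_of_surjective _ (Subgraph.IsMatching.toEdge.surjective hM)
  rw [Nat.card_coe_set_eq, Nat.card_coe_set_eq, hc] at h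
  refine h.trans ?_
  rw [← Nat.card_eq_fintype_card, ← Set.ncard_univ]
  exact Set.ncard_le_ncard (Set.subset_univ _) (Set.toFinite _)

theorem cliqueNum_comap_le (f : V ↪ V) : (G.comap f).cliqueNum ≤ G.cliqueNum := by
  obtain ⟨s, hs⟩ := (G.comap f).exists_isNClique_cliqueNum
  have hcl : G.IsClique (s.map f : Finset V) := by
    rw [Finset.coe_map]
    rintro _ ⟨u, hu, rfl⟩ _ ⟨v, hv, rfl⟩ huv
    exact hs.isClique hu hv fun h => huv (congrArg f h)
  have h := hcl.card_le_cliqueNum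
  rwa [Finset.card_map, hs.card_eq] at h

theorem matchingNumber_compl_comap_le (f : V ↪ V) :
    matchingNumber (G.comap f)ᶜ ≤ matchingNumber Gᶜ := by
  obtain ⟨M, hM, hc⟩ := ((G.comap f)ᶜ).exists_isMatching_ncard_eq_matchingNumber
  let φ : (G.comap f)ᶜ →g Gᶜ := ⟨f, fun {u v} h => by
    rw [compl_adj] at h ⊢
    exact ⟨fun h' => h.1 (f.injective h'), h.2⟩⟩
  have h := Gᶜ.ncard_edgeSet_le_matchingNumber (hM.map φ f.injective)
  rwa [Subgraph.edgeSet_map, Set.ncard_image_of_injective _ (Sym2.map.injective (f := φ) f.injective), hc]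
    at h

end matching

theorem cliqueNum_le_card {V : Type*} [Fintype V] (G : SimpleGraph V) :
    G.cliqueNum ≤ Fintype.card V := by
  obtain ⟨s, hs⟩ := G.exists_isNClique_cliqueNum
  exact hs.card_eq ▸ Finset.card_le_univ s

/-- The vertices are listed so that the first `m` form non-adjacent triples, the next vertices up
to `c` form non-adjacent pairs, no triple of pairwise distinct, non-adjacent vertices is left after
position `m`, and no non-adjacent pair after position `c`. -/
structure IsGreedyListing {n : ℕ} (G : SimpleGraph (Fin n)) (m c : ℕ) : Prop where
  le₁ : m ≤ c
  le₂ : c ≤ n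
  dvd₁ : 3 ∣ m
  dvd₂ : 2 ∣ c - m
  triples : ∀ i j : Fin n, i.val < m → j.val < m → i.val / 3 = j.val / 3 → ¬ G.Adj i j
  pairs : ∀ i j : Fin n, m ≤ i.val → m ≤ j.val → i.val < c → j.val < c →
    (i.val - m) / 2 = (j.val - m) / 2 → ¬ G.Adj i j
  no_triple : ∀ i j k : Fin n, m ≤ i.val → m ≤ j.val → m ≤ k.val → i ≠ j → i ≠ k → j ≠ k →
    G.Adj i j ∨ G.Adj i k ∨ G.Adj j k
  no_pair : ∀ i j : Fin n, c ≤ i.val → c ≤ j.val → i ≠ j → G.Adj i j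

section listing

variable {n m c l : ℕ} {G : SimpleGraph (Fin n)}

theorem IsGreedyListing.colorable (h : G.IsGreedyListing m c)
    (hl : m / 3 + (c - m) / 2 + (n - c) ≤ l) : G.Colorable l := by
  obtain ⟨t, ht⟩ := h.dvd₁
  obtain ⟨u, hu⟩ := h.dvd₂
  have h1 := h.le₁
  have h2 := h.le₂
  let col : Fin n → ℕ := fun i =>
    if i.val < m then i.val / 3 else if i.val < c then t + (i.val - m) / 2
    else t + u + (i.val - c)
  have hcol : ∀ i, col i < l := by
    intro i
    have := i.isLt
    simp only [col]
    split_ifs <;> omega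
  refine ⟨Coloring.mk (fun i => ⟨col i, hcol i⟩) ?_⟩
  intro i j hij heq
  simp only [Fin.mk.injEq, col] at heq
  have hi := i.isLt
  have hj := j.isLt
  have hne : i.val ≠ j.val := fun h' => hij.ne (Fin.ext h')
  by_cases ci : i.val < m <;> by_cases cj : j.val < m
  · rw [if_pos ci, if_pos cj] at heq
    exact h.triples i j ci cj heq hij
  · rw [if_pos ci, if_neg cj] at heq; split_ifs at heq <;> omega
  · rw [if_neg ci, if_pos cj] at heq; split_ifs at heq <;> omega
  · rw [if_neg ci, if_neg cj] at heq
    by_cases di : i.val < c <;> by_cases dj : j.val < c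
    · rw [if_pos di, if_pos dj] at heq
      exact h.pairs i j (by omega) (by omega) di dj (by omega) hij
    · rw [if_pos di, if_neg dj] at heq; omega
    · rw [if_neg di, if_pos dj] at heq; omega
    · rw [if_neg di, if_neg dj] at heq; omega

theorem IsGreedyListing.le_six_mul {k : ℕ} (h : G.IsGreedyListing m c)
    (hl : l < m / 3 + (c - m) / 2 + (n - c)) (hk : G.cliqueNum + matchingNumber Gᶜ ≤ l + k) :
    m ≤ 6 * k := by
  have h1 := G.card_le_cliqueNum_add_matchingNumber_compl
  rw [Fintype.card_fin] at h1
  have h2 : n - c ≤ G.cliqueNum := by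
    have hcl : G.IsClique ((univ.filter fun i : Fin n => c ≤ i.val : Finset (Fin n)) :
        Set (Fin n)) := by
      intro i hi j hj hij
      simp only [coe_filter, mem_univ, true_and, Set.mem_ofPred_eq] at hi hj
      exact h.no_pair i j hi hj hij
    have h3 := hcl.card_le_cliqueNum
    have h4 : #(univ.filter fun i : Fin n => c ≤ i.val) = n - c := by
      have : #(univ.filter fun i : Fin n => i.val < c) = min n c := Fin.card_filter_val_lt
      have h5 := Finset.card_filter_add_card_filter_not (s := (univ : Finset (Fin n)))
        (fun i : Fin n => i.val < c)
      simp only [not_lt, card_univ, Fintype.card_fin] at h5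
      omega
    omega
  have h3 := h.le₁
  have h4 := h.le₂
  obtain ⟨t, ht⟩ := h.dvd₁
  obtain ⟨u, hu⟩ := h.dvd₂
  omega

theorem IsGreedyListing.le_of_colorable (h : G.IsGreedyListing m c) (hc : G.Colorable l) :
    n - m ≤ 2 * l := by
  classical
  obtain ⟨f⟩ := hc
  by_contra hlt
  have hcard : #(univ.filter fun i : Fin n => m ≤ i.val) = n - m := by
    have h4 : #(univ.filter fun i : Fin n => i.val < m) = min n m := Fin.card_filter_val_lt
    have h5 := Finset.card_filter_add_card_filter_not (s := (univ : Finset (Fin n)))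
      (fun i : Fin n => i.val < m)
    simp only [not_lt, card_univ, Fintype.card_fin] at h5
    omega
  obtain ⟨y, -, hy⟩ := Finset.exists_lt_card_fiber_of_mul_lt_card_of_maps_to
    (s := univ.filter fun i : Fin n => m ≤ i.val) (t := univ) (f := f) (n := 2)
    (fun _ _ => mem_univ _) (by rw [card_univ, Fintype.card_fin, hcard]; omega)
  obtain ⟨i, hi, j, hj, k, hk, hij, hik, hjk⟩ := Finset.two_lt_card.1 hy
  simp only [mem_filter, mem_univ, true_and] at hi hj hk
  rcases h.no_triple i j k hi.1 hj.1 hk.1 hij hik hjk with hA | hA | hA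
  · exact f.valid hA (hi.2.trans hj.2.symm)
  · exact f.valid hA (hi.2.trans hk.2.symm)
  · exact f.valid hA (hj.2.trans hk.2.symm)

/-- The label set `X` together with the positions `m + a` and `m + b` is independent. -/
def IsIndepLabel {N : ℕ} (G : SimpleGraph (Fin n)) (m : ℕ) (a b : Fin N)
    (X : Finset (Fin m)) : Prop :=
  ∀ i j : Fin n, ((∃ h : i.val < m, ⟨i.val, h⟩ ∈ X) ∨ i.val = m + a ∨ i.val = m + b) →
    ((∃ h : j.val < m, ⟨j.val, h⟩ ∈ X) ∨ j.val = m + a ∨ j.val = m + b) → ¬ G.Adj i j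

theorem two_mul_card_lt_pairing {N : ℕ} {τ : Equiv.Perm (Fin N)} (hτ : IsPairing τ) :
    2 * Fintype.card {a // a < τ a} = N := by
  have h1 := Finset.card_filter_add_card_filter_not (s := (univ : Finset (Fin N)))
    (fun a => a < τ a)
  have h2 : #(univ.filter fun a => ¬ a < τ a) = #(univ.filter fun a => a < τ a) := by
    refine Finset.card_bij (fun a _ => τ a) ?_ ?_ ?_
    · intro a ha
      simp only [mem_filter, mem_univ, true_and] at ha ⊢
      rw [hτ.1 a]
      exact lt_of_le_of_ne (not_lt.1 ha) (hτ.2 a)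
    · intro a _ b _ hab; exact τ.injective hab
    · intro b hb
      simp only [mem_filter, mem_univ, true_and] at hb
      refine ⟨τ b, ?_, hτ.1 b⟩
      simp only [mem_filter, mem_univ, true_and, hτ.1 b]
      exact not_lt_of_gt hb
  rw [card_univ, Fintype.card_fin] at h1
  rw [Fintype.card_subtype]
  omega

theorem colorable_of_isAdmissibleCover (hm : n - m ≤ 2 * l) {τ : Equiv.Perm (Fin (2 * l))}
    {f : Fin (2 * l) → Finset (Fin m)}
    (h : IsAdmissibleCover (G.IsIndepLabel m) τ f) : G.Colorable l := by
  classical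
  obtain ⟨hτ, ⟨hf, hcov⟩, hok⟩ := h
  have key : ∀ i : Fin n, ∃ a : {a // a < τ a},
      (∃ h : i.val < m, ⟨i.val, h⟩ ∈ f a) ∨ i.val = m + (a : Fin (2 * l)) ∨
        i.val = m + τ (a : Fin (2 * l)) := by
    intro i
    by_cases hi : i.val < m
    · obtain ⟨a, ha⟩ := hcov ⟨i.val, hi⟩
      have : a < τ a := by
        by_contra hn
        rw [hf a hn] at ha
        simp at ha
      exact ⟨⟨a, this⟩, .inl ⟨hi, ha⟩⟩
    · have hlt : i.val - m < 2 * l := by omega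
      rcases lt_or_gt_of_ne (hτ.2 ⟨i.val - m, hlt⟩) with ha | ha
      · refine ⟨⟨τ ⟨i.val - m, hlt⟩, by rwa [hτ.1]⟩, .inr (.inr ?_)⟩
        simp only [hτ.1]
        omega
      · refine ⟨⟨⟨i.val - m, hlt⟩, ha⟩, .inr (.inl ?_)⟩
        simp only
        omega
  choose col hcol using key
  have hcard : Fintype.card {a // a < τ a} = l := by
    have := two_mul_card_lt_pairing hτ
    omega
  rw [← hcard]
  refine Coloring.colorable (Coloring.mk col ?_)
  intro i j hij heq
  refine hok (col i) (col i).2 i j (hcol i) ?_ hij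
  rw [heq]
  exact hcol j

theorem exists_isAdmissibleCover (hn : m ≤ n)
    (htri : ∀ i j k : Fin n, m ≤ i.val → m ≤ j.val → m ≤ k.val → i ≠ j → i ≠ k → j ≠ k →
      G.Adj i j ∨ G.Adj i k ∨ G.Adj j k) (hc : G.Colorable l) :
    ∃ (τ : Equiv.Perm (Fin (2 * l))) (f : Fin (2 * l) → Finset (Fin m)),
      IsAdmissibleCover (G.IsIndepLabel m) τ f := by
  classical
  obtain ⟨c⟩ := hc
  let second : Fin n → Bool := fun i => decide (∃ j : Fin n, m ≤ j.val ∧ j < i ∧ c j = c i)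
  have hslot : ∀ i j : Fin n, m ≤ i.val → m ≤ j.val → i < j → c i = c j →
      second i = second j → False := by
    intro i j hi hj hij hcol hs
    have h1 : second j = true := by simp only [second, decide_eq_true_eq]; exact ⟨i, hi, hij, hcol⟩
    rw [h1] at hs
    simp only [second, decide_eq_true_eq] at hs
    obtain ⟨k, hk, hki, hkc⟩ := hs
    rcases htri k i j hk hi hj hki.ne (hki.trans hij).ne hij.ne with h | h | h
    · exact c.valid h hkc
    · exact c.valid h (hkc.trans hcol)
    · exact c.valid h hcol
  let s : Finset (Fin (2 * l)) := univ.filter fun a => m + a.val < n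
  let slot : Fin (2 * l) → Option (Fin l × Bool) := fun a =>
    if h : m + a.val < n then some (c ⟨m + a.val, h⟩, second ⟨m + a.val, h⟩) else none
  have hinj : Set.InjOn slot s := by
    intro a ha b hb hab
    simp only [s, coe_filter, mem_univ, true_and, Set.mem_ofPred_eq] at ha hb
    simp only [slot, dif_pos ha, dif_pos hb, Option.some.injEq, Prod.mk.injEq] at hab
    by_contra hne
    rcases lt_or_gt_of_ne hne with h | h
    · exact hslot _ _ (Nat.le_add_right _ _) (Nat.le_add_right _ _)
        (Fin.lt_def.2 (Nat.add_lt_add_left h m)) hab.1 hab.2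
    · exact hslot _ _ (Nat.le_add_right _ _) (Nat.le_add_right _ _)
        (Fin.lt_def.2 (Nat.add_lt_add_left h m)) hab.1.symm hab.2.symm
  let t : Finset (Option (Fin l × Bool)) := univ.filter fun o => o.isSome
  have ht : t = univ.map Function.Embedding.some := by
    ext o
    cases o <;> simp [t]
  have hst : s.image slot ⊆ t := by
    intro o ho
    simp only [mem_image, s, mem_filter, mem_univ, true_and] at ho
    obtain ⟨a, ha, rfl⟩ := ho
    simp [t, slot, dif_pos ha]
  have hcard : Fintype.card (Fin (2 * l)) = #t := by
    rw [ht, card_map]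
    simp [mul_comm]
  obtain ⟨g, hg⟩ := Finset.exists_equiv_extend_of_card_eq hcard hst hinj
  let u : t ≃ Fin l × Bool :=
    { toFun := fun o => o.1.get (by have := o.2; rw [mem_filter] at this; exact this.2)
      invFun := fun p => ⟨some p, by simp [t]⟩
      left_inv := fun o => by simp
      right_inv := fun p => by simp }
  let e : Fin (2 * l) ≃ Fin l × Bool := g.trans u
  have he : ∀ (a : Fin (2 * l)) (i : Fin n), i.val = m + a.val → (e a).1 = c i := by
    intro a i hi
    have hlt : m + a.val < n := by rw [← hi]; exact i.isLt
    have h1 := hg a (by simp [s, hlt])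
    simp only [slot, dif_pos hlt] at h1
    have : e a = (c ⟨m + a.val, hlt⟩, second ⟨m + a.val, hlt⟩) := by
      simp only [e, Equiv.trans_apply, u, Equiv.coe_fn_mk]
      simp [h1]
    rw [this]
    exact congrArg c (Fin.ext hi.symm)
  let τ : Equiv.Perm (Fin (2 * l)) :=
    (e.trans ((Equiv.refl (Fin l)).prodCongr Equiv.boolNot)).trans e.symm
  have hτe : ∀ a, e (τ a) = ((e a).1, !(e a).2) := by
    intro a
    simp only [τ, Equiv.trans_apply, Equiv.apply_symm_apply]
    rfl
  have hτ : IsPairing τ := by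
    refine ⟨fun a => e.injective ?_, fun a ha => ?_⟩
    · rw [hτe, hτe]; simp
    · have := hτe a
      rw [ha] at this
      have := congrArg Prod.snd this
      simp at this
  refine ⟨τ, fun a => if a < τ a then univ.filter fun x : Fin m =>
    c ⟨x.val, x.isLt.trans_le hn⟩ = (e a).1 else ∅, hτ, ⟨?_, ?_⟩, ?_⟩
  · intro a ha; simp [ha]
  · intro x
    set a := e.symm (c ⟨x.val, x.isLt.trans_le hn⟩, false) with hadef
    have hea : (e a).1 = c ⟨x.val, x.isLt.trans_le hn⟩ := by simp [a]
    rcases lt_or_gt_of_ne (hτ.2 a) with h | h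
    · refine ⟨τ a, ?_⟩
      have h' : τ a < τ (τ a) := by rwa [hτ.1 a]
      simp only [if_pos h']
      simp [hτe, hea]
    · exact ⟨a, by simp [if_pos h, hea]⟩
  · intro a ha i j hi hj hij
    simp only [if_pos ha] at hi hj
    have hcol : ∀ i : Fin n, ((∃ h : i.val < m, (⟨i.val, h⟩ : Fin m) ∈ univ.filter fun x : Fin m =>
        c ⟨x.val, x.isLt.trans_le hn⟩ = (e a).1) ∨ i.val = m + a ∨ i.val = m + τ a) →
        c i = (e a).1 := by
      rintro i (⟨h, hi⟩ | hi | hi)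
      · simpa using hi
      · exact (he a i hi).symm
      · rw [← he (τ a) i hi, hτe]
    exact c.valid hij ((hcol i hi).trans (hcol j hj).symm)

end listing

end SimpleGraph

/-! ### Arithmetic in finite fields of characteristic two -/

namespace BinaryField

open Polynomial

/-- The polynomial over the field with two elements whose coefficients are the binary digits. -/
noncomputable def poly (a : ℕ) : (ZMod 2)[X] :=
  if a = 0 then 0 else C (a : ZMod 2) + X * poly (a / 2)
termination_by a
decreasing_by omega

/-- Multiplication by `X` modulo `X ^ q + poly p`, where `Q = 2 ^ q`. -/
def shift (Q p t : ℕ) : ℕ := (2 * t % Q) ^^^ (2 * t / Q * p)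

/-- Multiplication modulo `X ^ q + poly p`, where `Q = 2 ^ q`. -/
def mul (Q p a b : ℕ) : ℕ :=
  if b = 0 then 0 else shift Q p (mul Q p a (b / 2)) ^^^ (b % 2 * a)
termination_by b
decreasing_by omega

@[simp] theorem poly_zero : poly 0 = 0 := by rw [poly]; simp

theorem poly_eq (a : ℕ) : poly a = C (a : ZMod 2) + X * poly (a / 2) := by
  by_cases h : a = 0
  · subst h; simp
  · rw [poly, if_neg h]

theorem poly_one : poly 1 = 1 := by rw [poly_eq]; simp

theorem poly_two_mul (a : ℕ) : poly (2 * a) = X * poly a := by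
  rw [poly_eq]
  have : ((2 : ℕ) : ZMod 2) = 0 := CharP.cast_eq_zero _ 2
  rw [Nat.cast_mul, this]
  simp

theorem poly_two_pow (q : ℕ) : poly (2 ^ q) = X ^ q := by
  induction q with
  | zero => simpa using poly_one
  | succ q ih => rw [pow_succ', poly_two_mul, ih, pow_succ']

theorem cast_xor (a b : ℕ) : ((a ^^^ b : ℕ) : ZMod 2) = a + b := by
  rw [← Nat.cast_add, ZMod.natCast_eq_natCast_iff, Nat.ModEq, Nat.xor_mod_two_eq]

theorem poly_xor (a b : ℕ) : poly (a ^^^ b) = poly a + poly b := by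
  induction a using Nat.strong_induction_on generalizing b with
  | _ a ih =>
    by_cases h : a = 0
    · subst h; simp
    · rw [poly_eq (a ^^^ b), poly_eq a, poly_eq b, Nat.xor_div_two, ih (a / 2) (by omega), cast_xor,
        C_add]
      ring

theorem divX_X_mul_eq (f : (ZMod 2)[X]) : (X * f).divX = f := by
  ext i
  rw [coeff_divX, coeff_X_mul]

theorem poly_injective : Function.Injective poly := by
  intro a
  induction a using Nat.strong_induction_on with
  | _ a ih =>
    intro b hab
    rw [poly_eq a, poly_eq b] at hab
    have h0 := congrArg (fun f => f.coeff 0) hab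
    simp only [coeff_add, coeff_C_zero, coeff_X_mul_zero, add_zero] at h0
    have h1 := congrArg divX hab
    simp only [divX_add, divX_C, zero_add, divX_X_mul_eq] at h1
    rw [ZMod.natCast_eq_natCast_iff, Nat.ModEq] at h0
    by_cases h : a = 0
    · subst h
      rw [poly_zero] at h1
      by_contra hb
      have hlt : ∀ c, poly c = 0 → c = 0 := by
        intro c
        induction c using Nat.strong_induction_on with
        | _ c ihc =>
          intro hc
          by_contra hne
          rw [poly_eq c] at hc
          have g0 := congrArg (fun f => f.coeff 0) hc
          simp only [coeff_add, coeff_C_zero, coeff_X_mul_zero, add_zero, coeff_zero] at g0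
          have g1 := congrArg divX hc
          simp only [divX_add, divX_C, zero_add, divX_X_mul_eq, divX_zero] at g1
          have g2 := ihc (c / 2) (by omega) g1
          rw [ZMod.natCast_eq_zero_iff] at g0
          omega
      have := hlt (b / 2) (by simpa using h1.symm)
      omega
    · have := ih (a / 2) (by omega) h1
      omega

theorem degree_poly_lt {q a : ℕ} (h : a < 2 ^ q) : (poly a).degree < q := by
  induction q generalizing a with
  | zero =>
    obtain rfl : a = 0 := by simpa using h
    simp
  | succ q ih =>
    rw [poly_eq]
    have h2 := ih (a := a / 2) (by rw [pow_succ] at h; omega)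
    refine (degree_add_le _ _).trans_lt (max_lt ?_ ?_)
    · exact degree_C_le.trans_lt (by exact_mod_cast Nat.succ_pos q)
    · by_cases hp : poly (a / 2) = 0
      · rw [hp]; simp
      · rw [degree_mul, degree_X, degree_eq_natDegree hp] at *
        have : (poly (a / 2)).natDegree < q := by exact_mod_cast h2
        have : 1 + (poly (a / 2)).natDegree < q + 1 := by omega
        exact_mod_cast this

theorem exists_poly_eq {q : ℕ} {f : (ZMod 2)[X]} (h : f.degree < q) :
    ∃ a < 2 ^ q, poly a = f := by
  induction q generalizing f with
  | zero =>
    have : f = 0 := by simpa using h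
    exact ⟨0, by simp, by simp [this]⟩
  | succ q ih =>
    have hd : f.divX.degree < q := by
      by_cases h0 : f.divX = 0
      · rw [h0]; exact bot_lt_iff_ne_bot.2 (by simp)
      · have hf : f ≠ 0 := by rintro rfl; simp at h0
        rw [degree_eq_natDegree h0]
        rw [degree_eq_natDegree hf] at h
        have h1 : f.natDegree < q + 1 := by exact_mod_cast h
        have h2 : 0 < f.natDegree := by
          by_contra h3
          apply h0
          rw [divX_eq_zero_iff]
          exact eq_C_of_natDegree_eq_zero (by omega)
        have : f.divX.natDegree < q := by rw [natDegree_divX_eq_natDegree_tsub_one]; omega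
        exact_mod_cast this
    obtain ⟨a, ha, hfa⟩ := ih hd
    have hc : (f.coeff 0).val < 2 := ZMod.val_lt _
    refine ⟨2 * a + (f.coeff 0).val, by rw [pow_succ]; omega, ?_⟩
    rw [poly_eq]
    have h1 : (2 * a + (f.coeff 0).val) / 2 = a := by omega
    have h2 : ((2 : ℕ) : ZMod 2) = 0 := CharP.cast_eq_zero _ 2
    rw [h1, hfa, Nat.cast_add, Nat.cast_mul, h2, zero_mul, zero_add, ZMod.natCast_zmod_val,
      add_comm]
    exact X_mul_divX_add f

/-- The modulus `X ^ q + poly p`. -/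
noncomputable def modulus (q p : ℕ) : (ZMod 2)[X] := X ^ q + poly p

section

variable {q p : ℕ}

theorem monic_modulus (hp : p < 2 ^ q) : (modulus q p).Monic :=
  monic_X_pow_add (degree_poly_lt hp)

theorem degree_modulus (hp : p < 2 ^ q) : (modulus q p).degree = q := by
  rw [modulus, degree_add_eq_left_of_degree_lt] <;> rw [degree_X_pow]
  exact degree_poly_lt hp

/-- The residue class of a number. -/
noncomputable def toRing (q p a : ℕ) : AdjoinRoot (modulus q p) := AdjoinRoot.mk _ (poly a)

theorem toRing_xor (a b : ℕ) : toRing q p (a ^^^ b) = toRing q p a + toRing q p b := by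
  simp [toRing, poly_xor]

theorem toRing_injOn (hp : p < 2 ^ q) {a b : ℕ} (ha : a < 2 ^ q) (hb : b < 2 ^ q)
    (h : toRing q p a = toRing q p b) : a = b := by
  rw [toRing, toRing, AdjoinRoot.mk_eq_mk] at h
  apply poly_injective
  rw [← sub_eq_zero]
  refine eq_zero_of_dvd_of_degree_lt h ?_
  rw [degree_modulus hp]
  exact (degree_sub_le _ _).trans_lt (max_lt (degree_poly_lt ha) (degree_poly_lt hb))

theorem toRing_surjective (hp : p < 2 ^ q) (x : AdjoinRoot (modulus q p)) :
    ∃ a < 2 ^ q, toRing q p a = x := by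
  obtain ⟨g, rfl⟩ := AdjoinRoot.mk_surjective x
  obtain ⟨a, ha, hga⟩ := exists_poly_eq (q := q) (f := g %ₘ modulus q p)
    (by rw [← degree_modulus hp]; exact degree_modByMonic_lt _ (monic_modulus hp))
  refine ⟨a, ha, ?_⟩
  rw [toRing, hga]
  conv_rhs => rw [← modByMonic_add_div g (modulus q p)]
  simp

theorem toRing_shift {t : ℕ} (ht : t < 2 ^ q) :
    toRing q p (shift (2 ^ q) p t) = AdjoinRoot.root (modulus q p) * toRing q p t := by
  have h1 : 2 * t = (2 * t % 2 ^ q) ^^^ (2 * t / 2 ^ q * 2 ^ q) := by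
    have h := Nat.div_add_mod (2 * t) (2 ^ q)
    have hlt := Nat.mod_lt (2 * t) (show 2 ^ q > 0 by positivity)
    have := Nat.two_pow_add_eq_or_of_lt hlt (2 * t / 2 ^ q)
    apply Nat.eq_of_testBit_eq
    intro i
    conv_lhs => rw [← h]
    rw [this, Nat.testBit_or, Nat.testBit_xor, mul_comm (2 ^ q)]
    by_cases hi : i < q
    · have : (2 * t / 2 ^ q * 2 ^ q).testBit i = false := by
        rw [mul_comm, Nat.testBit_two_pow_mul]; simp; omega
      simp [this]
    · have : (2 * t % 2 ^ q).testBit i = false := by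
        rw [Nat.testBit_mod_two_pow]; simp [hi]
      simp [this]
  have h2 : 2 * t / 2 ^ q < 2 := by
    rw [Nat.div_lt_iff_lt_mul (by positivity)]; omega
  have hX : AdjoinRoot.mk (modulus q p) (X ^ q) = AdjoinRoot.mk (modulus q p) (poly p) := by
    rw [AdjoinRoot.mk_eq_mk]
    have : (X ^ q : (ZMod 2)[X]) - poly p = modulus q p := by
      rw [modulus, CharTwo.sub_eq_add]
    rw [this]
  have h3 : AdjoinRoot.mk (modulus q p) (poly (2 * t / 2 ^ q * 2 ^ q)) =
      AdjoinRoot.mk (modulus q p) (poly (2 * t / 2 ^ q * p)) := by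
    interval_cases 2 * t / 2 ^ q
    · simp
    · simpa [poly_two_pow] using hX
  have h4 : toRing q p (2 * t) = toRing q p (shift (2 ^ q) p t) := by
    conv_lhs => rw [h1]
    rw [shift, toRing_xor, toRing_xor]
    congr 1
  rw [← h4, toRing, poly_two_mul, map_mul, AdjoinRoot.mk_X, toRing]

theorem shift_lt (hp : p < 2 ^ q) {t : ℕ} (ht : t < 2 ^ q) : shift (2 ^ q) p t < 2 ^ q := by
  refine Nat.xor_lt_two_pow (Nat.mod_lt _ (by positivity)) ?_
  have h2 : 2 * t / 2 ^ q < 2 := by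
    rw [Nat.div_lt_iff_lt_mul (by positivity)]; omega
  interval_cases 2 * t / 2 ^ q <;> simp [hp]

theorem mul_lt (hp : p < 2 ^ q) {a : ℕ} (ha : a < 2 ^ q) (b : ℕ) : mul (2 ^ q) p a b < 2 ^ q := by
  induction b using Nat.strong_induction_on with
  | _ b ih =>
    rw [mul]
    split
    · positivity
    · refine Nat.xor_lt_two_pow (shift_lt hp (ih _ (by omega))) ?_
      have : b % 2 < 2 := Nat.mod_lt _ (by norm_num)
      interval_cases b % 2 <;> simp [ha]

theorem toRing_mul (hp : p < 2 ^ q) {a : ℕ} (ha : a < 2 ^ q) (b : ℕ) :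
    toRing q p (mul (2 ^ q) p a b) = toRing q p a * toRing q p b := by
  induction b using Nat.strong_induction_on with
  | _ b ih =>
    rw [mul]
    split
    · next h => subst h; simp [toRing]
    · rw [toRing_xor, toRing_shift (mul_lt hp ha _), ih _ (by omega)]
      have h1 : toRing q p b = AdjoinRoot.of _ (b : ZMod 2) +
          AdjoinRoot.root _ * toRing q p (b / 2) := by
        rw [toRing, poly_eq b, map_add, map_mul, AdjoinRoot.mk_X, AdjoinRoot.mk_C, toRing]
      have h2 : toRing q p (b % 2 * a) = AdjoinRoot.of _ (b : ZMod 2) * toRing q p a := by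
        have h3 : ((b : ℕ) : ZMod 2) = ((b % 2 : ℕ) : ZMod 2) := by simp
        have : b % 2 < 2 := Nat.mod_lt _ (by norm_num)
        rw [h3]
        interval_cases b % 2 <;> simp [toRing]
      rw [h1, h2]
      ring

/-- Every nonzero residue class has an inverse. -/
def HasInverses (Q p : ℕ) : Prop := ∀ a < Q, a ≠ 0 → ∃ b < Q, mul Q p a b = 1

/-- A field whose elements are represented by the numbers below `Q`. -/
structure Model (Q p : ℕ) (F : Type) [Field F] where
  toFun : ℕ → F
  map_xor : ∀ a b, toFun (a ^^^ b) = toFun a + toFun b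
  map_mul : ∀ a b, a < Q → toFun (mul Q p a b) = toFun a * toFun b
  map_zero : toFun 0 = 0
  map_one : toFun 1 = 1
  injOn : ∀ a b, a < Q → b < Q → toFun a = toFun b → a = b

theorem HasInverses.exists_model (hq : 0 < q) (hp : p < 2 ^ q) (h : HasInverses (2 ^ q) p) :
    ∃ (F : Type) (_ : Field F) (_ : Fintype F) (_ : CharP F 2), Fintype.card F = 2 ^ q ∧
      Nonempty (Model (2 ^ q) p F) := by
  have h01 : toRing q p 0 ≠ toRing q p 1 := fun h' =>
    absurd (toRing_injOn hp (by positivity) (Nat.one_lt_two_pow hq.ne') h') (by norm_num)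
  have e0 : toRing q p 0 = 0 := by simp [toRing]
  have e1 : toRing q p 1 = 1 := by simp [toRing, poly_one]
  have hF : IsField (AdjoinRoot (modulus q p)) := by
    refine ⟨⟨0, 1, by rwa [e0, e1] at h01⟩, mul_comm, ?_⟩
    intro x hx
    obtain ⟨a, ha, rfl⟩ := toRing_surjective hp x
    obtain ⟨b, hb, hab⟩ := h a ha (by rintro rfl; exact hx e0)
    refine ⟨toRing q p b, ?_⟩
    rw [← toRing_mul hp ha, hab, e1]
  have hb : Function.Bijective (fun a : Fin (2 ^ q) => toRing q p a) := by
    refine ⟨fun a b hab => Fin.ext (toRing_injOn hp a.2 b.2 hab), fun x => ?_⟩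
    obtain ⟨a, ha, rfl⟩ := toRing_surjective hp x
    exact ⟨⟨a, ha⟩, rfl⟩
  let _ : Field (AdjoinRoot (modulus q p)) := hF.toField
  let _ : Fintype (AdjoinRoot (modulus q p)) := Fintype.ofBijective _ hb
  refine ⟨AdjoinRoot (modulus q p), inferInstance, inferInstance, ?_, ?_, ⟨⟨toRing q p, toRing_xor,
    fun a b ha => toRing_mul hp ha b, e0, e1, fun a b ha hb' => toRing_injOn hp ha hb'⟩⟩⟩
  · refine CharTwo.of_one_ne_zero_of_two_eq_zero one_ne_zero ?_
    have := toRing_xor (q := q) (p := p) 1 1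
    rw [Nat.xor_self, e0, e1] at this
    exact one_add_one_eq_two.symm.trans this.symm
  · rw [← Fintype.card_of_bijective hb, Fintype.card_fin]

theorem exists_hasInverses (hq : 0 < q) : ∃ p < 2 ^ q, HasInverses (2 ^ q) p := by
  have : Fact (Nat.Prime 2) := ⟨Nat.prime_two⟩
  obtain ⟨α, hα⟩ := Field.exists_primitive_element (ZMod 2) (GaloisField 2 q)
  have hint : IsIntegral (ZMod 2) α := Algebra.IsIntegral.isIntegral α
  have hdeg : (minpoly (ZMod 2) α).natDegree = q := by
    exact ((Field.primitive_element_iff_minpoly_natDegree_eq _ α).1 hα).trans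
      (GaloisField.finrank 2 hq.ne')
  have hmon := minpoly.monic hint
  have hlt : (minpoly (ZMod 2) α - X ^ q).degree < (q : WithBot ℕ) := by
    have hd : (minpoly (ZMod 2) α).degree = q := by
      rw [degree_eq_natDegree hmon.ne_zero, hdeg]
    have := degree_sub_lt_left (p := minpoly (ZMod 2) α) (q := X ^ q) (by rw [hd, degree_X_pow])
      hmon.ne_zero (by rw [hmon.leadingCoeff, leadingCoeff_X_pow])
    rwa [hd] at this
  obtain ⟨p, hp, hpq⟩ := exists_poly_eq hlt
  have hf : modulus q p = minpoly (ZMod 2) α := by rw [modulus, hpq]; ring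
  refine ⟨p, hp, ?_⟩
  intro a ha h0
  have : Fact (Irreducible (modulus q p)) := ⟨by rw [hf]; exact minpoly.irreducible hint⟩
  have e0 : toRing q p 0 = 0 := by simp [toRing]
  have e1 : toRing q p 1 = 1 := by simp [toRing, poly_one]
  have hne : toRing q p a ≠ 0 := by
    rw [← e0]
    exact fun h' => h0 (toRing_injOn hp ha (by positivity) h')
  obtain ⟨b, hb, hab⟩ := toRing_surjective hp (toRing q p a)⁻¹
  refine ⟨b, hb, toRing_injOn hp (mul_lt hp ha b) (Nat.one_lt_two_pow hq.ne') ?_⟩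
  rw [toRing_mul hp ha, hab, e1, mul_inv_cancel₀ hne]

end

end BinaryField

/-! ### Random numbers from coin flips -/

namespace CoinRAM

open MeasureTheory Finset

instance : IsProbabilityMeasure fairCoins := by
  unfold fairCoins; infer_instance

theorem fairCoins_agree (T : ℕ) (β : Fin T → Bool) :
    fairCoins {c | ∀ i : Fin T, c i = β i} = (2⁻¹ : ENNReal) ^ T := by
  let b : ℕ → Bool := fun i => if h : i < T then β ⟨i, h⟩ else false
  have h1 : {c : ℕ → Bool | ∀ i : Fin T, c i = β i} =
      Set.pi (Finset.range T : Set ℕ) fun i => {b i} := by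
    ext c
    simp only [Set.mem_ofPred_eq, Set.mem_pi, coe_range, Set.mem_Iio, Set.mem_singleton_iff]
    constructor
    · intro h i hi
      simpa [b, hi] using h ⟨i, hi⟩
    · intro h i
      simpa [b] using h i i.2
  rw [h1, fairCoins, Measure.infinitePi_pi _ (fun i _ => measurableSet_singleton _)]
  have h2 (x : Bool) : (PMF.uniformOfFintype Bool).toMeasure {x} = 2⁻¹ := by
    rw [PMF.toMeasure_apply_singleton _ _ (measurableSet_singleton _)]
    simp
  simp [h2]

theorem fairCoins_real_le {T : ℕ} (B : Finset (Fin T → Bool)) {E : Set (ℕ → Bool)}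
    (h : ∀ c ∈ E, (fun i : Fin T => c i) ∈ B) : fairCoins.real E ≤ #B / 2 ^ T := by
  have h1 : E ⊆ ⋃ β ∈ B, {c | ∀ i : Fin T, c i = β i} := by
    intro c hc
    simp only [Set.mem_iUnion]
    exact ⟨_, h c hc, fun i => rfl⟩
  have h2 : fairCoins E ≤ #B * (2⁻¹ : ENNReal) ^ T := by
    refine (measure_mono h1).trans ((measure_biUnion_finset_le _ _).trans ?_)
    simp [fairCoins_agree]
  have h3 := ENNReal.toReal_mono (by
    exact ENNReal.mul_ne_top (by simp) (ENNReal.pow_ne_top (by simp))) h2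
  rw [ENNReal.toReal_mul, ENNReal.toReal_pow, ENNReal.toReal_inv] at h3
  simp only [ENNReal.toReal_natCast, ENNReal.toReal_ofNat] at h3
  rw [measureReal_def, div_eq_mul_inv, ← inv_pow]
  exact h3

/-- The number whose binary digits, from the leading one on, are the given bits. -/
def bitsValue (c : ℕ → Bool) : ℕ → ℕ
  | 0 => 0
  | j + 1 => bitsValue c j + bitsValue c j + (c j).toNat

theorem bitsValue_lt (c : ℕ → Bool) (j : ℕ) : bitsValue c j < 2 ^ j := by
  induction j with
  | zero => simp [bitsValue]
  | succ j ih =>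
    have := Bool.toNat_le (c j)
    rw [bitsValue, pow_succ]; omega

theorem eq_of_bitsValue_eq {c c' : ℕ → Bool} {j : ℕ} (h : bitsValue c j = bitsValue c' j) :
    ∀ i < j, c i = c' i := by
  induction j with
  | zero => intro i hi; omega
  | succ j ih =>
    have h1 := Bool.toNat_le (c j)
    have h2 := Bool.toNat_le (c' j)
    rw [bitsValue, bitsValue] at h
    intro i hi
    rcases Nat.lt_succ_iff_lt_or_eq.1 hi with hi | rfl
    · exact ih (by omega) i hi
    · have : (c i).toNat = (c' i).toNat := by omega
      revert this
      cases c i <;> cases c' i <;> simp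

/-- The `i`-th number with `q` binary digits that is read off from a sequence of coin flips. -/
def sample (q : ℕ) (c : ℕ → Bool) (i : ℕ) : ℕ := bitsValue (fun j => c (i * q + j)) q

theorem bitsValue_congr {c c' : ℕ → Bool} {j : ℕ} (h : ∀ i < j, c i = c' i) :
    bitsValue c j = bitsValue c' j := by
  induction j with
  | zero => rfl
  | succ j ih => rw [bitsValue, bitsValue, ih fun i hi => h i (by omega), h j (by omega)]

theorem sample_lt (q : ℕ) (c : ℕ → Bool) (i : ℕ) : sample q c i < 2 ^ q := bitsValue_lt _ _

open Classical in
theorem fairCoins_real_sample_le {K q N : ℕ} {F : Type} [Fintype F] (φ : ℕ → F)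
    (hφ : ∀ a b, a < 2 ^ q → b < 2 ^ q → φ a = φ b → a = b) (hF : Fintype.card F = 2 ^ q)
    (B : Finset (Fin K → F)) (hB : #B * Fintype.card F ≤ N * Fintype.card F ^ K) :
    fairCoins.real {c | (fun i : Fin K => φ (sample q c i)) ∈ B} ≤ N / 2 ^ q := by
  let ext : (Fin (K * q) → Bool) → ℕ → Bool := fun β i => if h : i < K * q then β ⟨i, h⟩ else false
  have hidx : ∀ i : Fin K, ∀ j < q, i * q + j < K * q := by
    intro i j hj
    have : (i + 1 : ℕ) * q ≤ K * q := Nat.mul_le_mul_right _ i.2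
    rw [add_mul, one_mul] at this
    omega
  let ψ : (Fin (K * q) → Bool) → Fin K → F := fun β i => φ (sample q (ext β) i)
  have hψ : Function.Injective ψ := by
    intro β β' h
    funext x
    have hq : 0 < q := by
      rcases Nat.eq_zero_or_pos q with h0 | h0
      · have := x.2; simp [h0] at this
      · exact h0
    have hi : x.val / q < K := by
      rw [Nat.div_lt_iff_lt_mul hq]; exact x.2
    have h1 := congrFun h ⟨x.val / q, hi⟩
    have h2 := eq_of_bitsValue_eq (hφ _ _ (sample_lt _ _ _) (sample_lt _ _ _) h1) (x.val % q)
      (Nat.mod_lt _ hq)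
    simp only [ext, Nat.div_add_mod'] at h2
    simpa using h2
  have h1 : fairCoins.real {c | (fun i : Fin K => φ (sample q c i)) ∈ B} ≤
      #(univ.filter fun β => ψ β ∈ B) / 2 ^ (K * q) := by
    refine fairCoins_real_le _ fun c hc => ?_
    simp only [mem_filter, mem_univ, true_and]
    have : ψ (fun i => c i) = fun i : Fin K => φ (sample q c i) := by
      funext i
      simp only [ψ]
      congr 1
      refine bitsValue_congr fun j hj => ?_
      simp only [ext, dif_pos (hidx i j hj)]
    rw [this]
    exact hc
  refine h1.trans ?_
  have h2 : #(univ.filter fun β => ψ β ∈ B) ≤ #B :=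
    Finset.card_le_card_of_injOn ψ (by intro β hβ; simpa using hβ) hψ.injOn
  rw [hF, ← pow_mul, mul_comm q K] at hB
  rw [div_le_div_iff₀ (by positivity) (by positivity)]
  have h3 : #(univ.filter fun β => ψ β ∈ B) * 2 ^ q ≤ N * 2 ^ (K * q) :=
    (Nat.mul_le_mul_right _ h2).trans hB
  exact_mod_cast h3

theorem one_sub_le_fairCoins_real {E E' : Set (ℕ → Bool)} {ε : ℝ} (h : fairCoins.real E' ≤ ε)
    (hE : ∀ c, c ∉ E' → c ∈ E) : 1 - ε ≤ fairCoins.real E := by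
  have h1 : fairCoins.real (E ∪ E') ≤ fairCoins.real E + fairCoins.real E' :=
    measureReal_union_le _ _
  have h2 : E ∪ E' = Set.univ := by
    ext c
    simp only [Set.mem_union, Set.mem_univ, iff_true]
    by_cases hc : c ∈ E'
    · exact .inr hc
    · exact .inl (hE c hc)
  rw [h2, probReal_univ] at h1
  linarith

end CoinRAM

namespace CoinRAM

infixl:65 " +ₑ " => Expr.op Op.add
infixl:65 " -ₑ " => Expr.op Op.sub
infixl:70 " *ₑ " => Expr.op Op.mul
infixl:70 " /ₑ " => Expr.op Op.div
infixl:70 " %ₑ " => Expr.op Op.mod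
infix:50 " <ₑ " => Expr.op Op.lt
infix:50 " =ₑ " => Expr.op Op.eq
infixr:40 " ;; " => Prog.seq

theorem arrays_setCell' (s : State) (a i v b : ℕ) :
    (s.setCell a i v).arrays b =
      if b = a then Function.update (s.arrays a) i v else s.arrays b := by
  funext j
  by_cases h : b = a
  · subst h; simp [Function.update_apply]
  · simp [h]

/-! ### The greedy listing of the vertices -/

/-- Adjacency of vertices that are given by numbers. -/
def AdjNat {n : ℕ} (G : SimpleGraph (Fin n)) (u v : ℕ) : Prop :=
  ∃ (hu : u < n) (hv : v < n), G.Adj ⟨u, hu⟩ ⟨v, hv⟩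

theorem AdjNat.symm {n : ℕ} {G : SimpleGraph (Fin n)} {u v : ℕ} (h : AdjNat G u v) :
    AdjNat G v u := by
  obtain ⟨hu, hv, h⟩ := h
  exact ⟨hv, hu, h.symm⟩

/-- `vert` lists distinct vertices, the marked ones, at the positions below `c`. -/
structure IsListing (n c : ℕ) (mark vert : ℕ → ℕ) : Prop where
  inj : ∀ i < c, ∀ j < c, vert i = vert j → i = j
  lt : ∀ i < c, vert i < n
  mark : ∀ v < n, mark v ≠ 0 ↔ ∃ i < c, vert i = v

theorem IsListing.le {n c : ℕ} {mark vert : ℕ → ℕ} (h : IsListing n c mark vert) : c ≤ n := by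
  have := Finset.card_le_card_of_injOn (s := Finset.range c) (t := Finset.range n) vert
    (by intro i hi; simpa using h.lt i (by simpa using hi))
    (by intro i hi j hj hij; exact h.inj i (by simpa using hi) j (by simpa using hj) hij)
  simpa using this

theorem IsListing.push {n c : ℕ} {mark vert : ℕ → ℕ} (h : IsListing n c mark vert) {v : ℕ}
    (hv : v < n) (hm : mark v = 0) :
    IsListing n (c + 1) (Function.update mark v 1) (Function.update vert c v) := by
  have hnew : ∀ i < c, vert i ≠ v := fun i hi hiv => (h.mark v hv).2 ⟨i, hi, hiv⟩ hm
  have hval : ∀ i < c, Function.update vert c v i = vert i := fun i hi =>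
    Function.update_of_ne (by omega) _ _
  refine ⟨fun i hi j hj hij => ?_, fun i hi => ?_, fun w hw => ?_⟩
  · rcases Nat.lt_succ_iff_lt_or_eq.1 hi with hi | rfl <;>
    rcases Nat.lt_succ_iff_lt_or_eq.1 hj with hj | rfl
    · rw [hval i hi, hval j hj] at hij; exact h.inj i hi j hj hij
    · rw [hval i hi, Function.update_self] at hij; exact absurd hij (hnew i hi)
    · rw [hval j hj, Function.update_self] at hij; exact absurd hij.symm (hnew j hj)
    · rfl
  · rcases Nat.lt_succ_iff_lt_or_eq.1 hi with hi | rfl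
    · rw [hval i hi]; exact h.lt i hi
    · simpa using hv
  · by_cases hwv : w = v
    · subst hwv
      simp only [Function.update_self, ne_eq, one_ne_zero, not_false_iff, true_iff]
      exact ⟨c, by omega, by simp⟩
    · rw [Function.update_of_ne hwv, h.mark w hw]
      constructor
      · rintro ⟨i, hi, rfl⟩
        exact ⟨i, by omega, hval i hi⟩
      · rintro ⟨i, hi, rfl⟩
        rcases Nat.lt_succ_iff_lt_or_eq.1 hi with hi | rfl
        · exact ⟨i, hi, (hval i hi).symm⟩
        · simp at hwv

/-- List and mark the vertices in the registers `12`, `13`, `14` if they are distinct, unmarked and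
not adjacent. Registers: `0` number of vertices, `2` a large number, `3` number of listed vertices.
Arrays: `0` adjacency matrix, `1` marks, `2` list. -/
def tripleStep : Prog :=
  .ite (.cell 1 (.reg 12) +ₑ .cell 1 (.reg 13) +ₑ .cell 1 (.reg 14) +ₑ
      (.reg 12 =ₑ .reg 13) +ₑ (.reg 12 =ₑ .reg 14) +ₑ (.reg 13 =ₑ .reg 14) +ₑ
      .cell 0 (.reg 12 *ₑ .reg 0 +ₑ .reg 13) +ₑ .cell 0 (.reg 12 *ₑ .reg 0 +ₑ .reg 14) +ₑ
      .cell 0 (.reg 13 *ₑ .reg 0 +ₑ .reg 14))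
    .skip
    (.store 2 (.reg 3) (.reg 12) ;; .store 1 (.reg 12) (.const 1) ;;
     .store 2 (.reg 3 +ₑ .const 1) (.reg 13) ;; .store 1 (.reg 13) (.const 1) ;;
     .store 2 (.reg 3 +ₑ .const 2) (.reg 14) ;; .store 1 (.reg 14) (.const 1) ;;
     .assign 3 ((.reg 3 +ₑ .const 3) %ₑ .reg 2))

/-- One round of the search for non-adjacent triples; register `11` holds the number of the
triple. -/
def tripleRound : Prog :=
  .assign 12 (.reg 11 /ₑ (.reg 0 *ₑ .reg 0)) ;;
  .assign 13 (.reg 11 /ₑ .reg 0 %ₑ .reg 0) ;;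
  .assign 14 (.reg 11 %ₑ .reg 0) ;;
  tripleStep

/-- Find non-adjacent triples of unmarked vertices, list and mark them. -/
def listTriples : Prog := .count 11 (.reg 0 *ₑ .reg 0 *ₑ .reg 0) tripleRound

/-- List and mark the vertices in the registers `12` and `13` if they are distinct, unmarked and
not adjacent; register `4` counts the listed vertices. -/
def pairStep : Prog :=
  .ite (.cell 1 (.reg 12) +ₑ .cell 1 (.reg 13) +ₑ (.reg 12 =ₑ .reg 13) +ₑ
      .cell 0 (.reg 12 *ₑ .reg 0 +ₑ .reg 13))
    .skip
    (.store 2 (.reg 4) (.reg 12) ;; .store 1 (.reg 12) (.const 1) ;;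
     .store 2 (.reg 4 +ₑ .const 1) (.reg 13) ;; .store 1 (.reg 13) (.const 1) ;;
     .assign 4 ((.reg 4 +ₑ .const 2) %ₑ .reg 2))

/-- One round of the search for non-adjacent pairs; register `11` holds the number of the pair. -/
def pairRound : Prog :=
  .assign 12 (.reg 11 /ₑ .reg 0) ;;
  .assign 13 (.reg 11 %ₑ .reg 0) ;;
  pairStep

/-- Find non-adjacent pairs of unmarked vertices, list and mark them. -/
def listPairs : Prog := .assign 4 (.reg 3) ;; .count 11 (.reg 0 *ₑ .reg 0) pairRound

/-- List the vertex in register `11` if it is unmarked; register `15` counts the listed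
vertices. -/
def restRound : Prog :=
  .ite (.cell 1 (.reg 11)) .skip
    (.store 2 (.reg 15) (.reg 11) ;; .store 1 (.reg 11) (.const 1) ;;
     .assign 15 ((.reg 15 +ₑ .const 1) %ₑ .reg 2))

/-- List all remaining vertices. -/
def listRest : Prog := .assign 15 (.reg 4) ;; .count 11 (.reg 0) restRound

/-- List the vertices greedily. -/
def listVertices : Prog := listTriples ;; listPairs ;; listRest

section

variable {n : ℕ} {G : SimpleGraph (Fin n)}

/-- What holds throughout the listing: the input is unchanged and `c` vertices are listed. -/
structure ListState (G : SimpleGraph (Fin n)) (W c : ℕ) (s : State) : Prop where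
  size : s.regs 0 = n
  big : s.regs 2 = W
  adj : ∀ u v, u < n → v < n → (s.arrays 0 (u * n + v) ≠ 0 ↔ AdjNat G u v)
  listing : IsListing n c (s.arrays 1) (s.arrays 2)

/-- The first `m` listed vertices form non-adjacent triples. -/
def TriplesListed (G : SimpleGraph (Fin n)) (m : ℕ) (vert : ℕ → ℕ) : Prop :=
  3 ∣ m ∧ ∀ i j, i < m → j < m → i / 3 = j / 3 → ¬ AdjNat G (vert i) (vert j)

theorem not_adjNat_self (u : ℕ) : ¬ AdjNat G u u := by
  rintro ⟨_, _, h⟩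
  exact h.ne rfl

/-- Of three distinct vertices that are not marked, two are adjacent. -/
def TripleTaken (G : SimpleGraph (Fin n)) (mark : ℕ → ℕ) (u v w : ℕ) : Prop :=
  mark u = 0 → mark v = 0 → mark w = 0 → u ≠ v → u ≠ w → v ≠ w →
    AdjNat G u v ∨ AdjNat G u w ∨ AdjNat G v w

theorem tripleStep_spec {W u v w : ℕ} (hW : n < W) {s : State} (hu : u < n) (hv : v < n)
    (hw : w < n) (h12 : s.regs 12 = u) (h13 : s.regs 13 = v) (h14 : s.regs 14 = w)
    (h : ListState G W (s.regs 3) s) (ht : TriplesListed G (s.regs 3) (s.arrays 2)) :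
    let s' := tripleStep.run s
    ListState G W (s'.regs 3) s' ∧ TriplesListed G (s'.regs 3) (s'.arrays 2) ∧
      (∀ x, s'.arrays 1 x = 0 → s.arrays 1 x = 0) ∧ TripleTaken G (s'.arrays 1) u v w := by
  have a1 := h.adj u v hu hv
  have a2 := h.adj u w hu hw
  have a3 := h.adj v w hv hw
  rw [tripleStep, run_ite]
  split_ifs with hc
  · refine ⟨h, ht, fun x hx => hx, ?_⟩
    intro mu mv mw huv huw hvw
    simp only [run_skip] at mu mv mw
    by_contra hcon
    push Not at hcon
    apply hc
    simp [h12, h13, h14, h.size, mu, mv, mw, huv, huw, hvw, not_not.1 (mt a1.1 hcon.1),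
      not_not.1 (mt a2.1 hcon.2.1), not_not.1 (mt a3.1 hcon.2.2)]
  · simp only [ne_eq, not_not, eval_add, eval_cell, eval_eq, eval_reg, eval_mul, h12, h13, h14,
      h.size, Nat.add_eq_zero_iff, ite_eq_right_iff, one_ne_zero, imp_false] at hc
    obtain ⟨⟨⟨⟨⟨⟨⟨⟨mu, mv⟩, mw⟩, huv⟩, huw⟩, hvw⟩, b1⟩, b2⟩, b3⟩ := hc
    have n1 : ¬ AdjNat G u v := fun hA => a1.2 hA b1
    have n2 : ¬ AdjNat G u w := fun hA => a2.2 hA b2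
    have n3 : ¬ AdjNat G v w := fun hA => a3.2 hA b3
    have l1 := h.listing.push hu mu
    have l2 := l1.push hv (by rw [Function.update_of_ne (Ne.symm huv)]; exact mv)
    have l3 := l2.push hw (by
      rw [Function.update_of_ne (Ne.symm hvw), Function.update_of_ne (Ne.symm huw)]; exact mw)
    have hlt : s.regs 3 + 3 < W := l3.le.trans_lt hW
    simp only [run_seq, run_store, run_assign, eval_reg, eval_add, eval_const, eval_mod,
      regs_setCell, regs_setReg, h.big, h12, h13, h14, Nat.mod_eq_of_lt hlt, arrays_setReg,
      arrays_setCell', reduceIte, OfNat.ofNat_ne_one, OfNat.one_ne_ofNat]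
    refine ⟨⟨by simp [h.size], by simp [h.big], by simpa [arrays_setCell'] using h.adj, ?_⟩,
      ⟨?_, ?_⟩, ?_, ?_⟩
    · simpa [arrays_setCell'] using l3
    · have := ht.1; omega
    · intro i j hi hj hij
      obtain ⟨d, hd⟩ := ht.1
      have hval : ∀ i < s.regs 3, Function.update (Function.update (Function.update (s.arrays 2)
          (s.regs 3) u) (s.regs 3 + 1) v) (s.regs 3 + 2) w i = s.arrays 2 i := by
        intro i hi
        rw [Function.update_of_ne (by omega), Function.update_of_ne (by omega),
          Function.update_of_ne (by omega)]
      by_cases hi' : i < s.regs 3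
      · have hj' : j < s.regs 3 := by omega
        rw [hval i hi', hval j hj']
        exact ht.2 i j hi' hj' hij
      · have hj' : ¬ j < s.regs 3 := by omega
        have hi'' : i = s.regs 3 ∨ i = s.regs 3 + 1 ∨ i = s.regs 3 + 2 := by omega
        have hj'' : j = s.regs 3 ∨ j = s.regs 3 + 1 ∨ j = s.regs 3 + 2 := by omega
        rcases hi'' with rfl | rfl | rfl <;> rcases hj'' with rfl | rfl | rfl <;>
          simp only [Function.update_apply, Nat.left_eq_add, Nat.add_left_cancel_iff, reduceIte,
            OfNat.ofNat_ne_zero, one_ne_zero, OfNat.one_ne_ofNat, OfNat.ofNat_ne_one,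
            Nat.add_eq_left] <;>
          first
            | exact not_adjNat_self _
            | assumption
            | exact fun hA => n1 hA.symm
            | exact fun hA => n2 hA.symm
            | exact fun hA => n3 hA.symm
    · intro x hx
      simp only [Function.update_apply] at hx
      split_ifs at hx; simp_all
    · intro hA
      exfalso
      simp only [Function.update_apply] at hA
      split_ifs at hA

theorem tripleRound_spec {W k : ℕ} (hW : n < W) {s : State} (hk : k < n * n * n)
    (h11 : s.regs 11 = k) (h : ListState G W (s.regs 3) s)
    (ht : TriplesListed G (s.regs 3) (s.arrays 2)) :
    let s' := tripleRound.run s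
    ListState G W (s'.regs 3) s' ∧ TriplesListed G (s'.regs 3) (s'.arrays 2) ∧
      (∀ x, s'.arrays 1 x = 0 → s.arrays 1 x = 0) ∧
      TripleTaken G (s'.arrays 1) (k / (n * n)) (k / n % n) (k % n) := by
  have hn : 0 < n := by
    rcases Nat.eq_zero_or_pos n with rfl | h
    · simp at hk
    · exact h
  have hu : k / (n * n) < n := by
    rw [Nat.div_lt_iff_lt_mul (by positivity)]; linarith
  refine tripleStep_spec hW hu (Nat.mod_lt _ hn) (Nat.mod_lt _ hn) ?_ ?_ ?_
    ⟨?_, ?_, ?_, ?_⟩ ?_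
  · simp [h11, h.size]
  · simp [h11, h.size]
  · simp [h11, h.size]
  · simp [h.size]
  · simp [h.big]
  · simpa using h.adj
  · simpa using h.listing
  · simpa using ht

theorem listTriples_spec {W : ℕ} (hW : n < W) {s : State} (h : ListState G W 0 s)
    (h3 : s.regs 3 = 0) :
    let s' := listTriples.run s
    ListState G W (s'.regs 3) s' ∧ TriplesListed G (s'.regs 3) (s'.arrays 2) ∧
      ∀ u v w, u < n → v < n → w < n → TripleTaken G (s'.arrays 1) u v w := by
  have key := Prog.run_count_induction (x := 11) (e := .reg 0 *ₑ .reg 0 *ₑ .reg 0)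
    (p := tripleRound) (s := s) (fun k s' =>
      ListState G W (s'.regs 3) s' ∧ TriplesListed G (s'.regs 3) (s'.arrays 2) ∧
      ∀ i < k, TripleTaken G (s'.arrays 1) (i / (n * n)) (i / n % n) (i % n))
  have hN : (Expr.reg 0 *ₑ .reg 0 *ₑ .reg 0).eval s = n * n * n := by simp [h.size]
  rw [hN] at key
  obtain ⟨c1, c2, c3⟩ := key
    ⟨⟨by simp [h.size], by simp [h.big], by simpa using h.adj, by simpa [h3] using h.listing⟩,
      ⟨by simp [h3], by simp [h3]⟩, by simp⟩
    (fun k s' hk h11 ⟨g1, g2, g3⟩ => by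
      obtain ⟨f1, f2, f3, f4⟩ := tripleRound_spec hW hk h11 g1 g2
      refine ⟨⟨by simp [f1.size], by simp [f1.big], by simpa using f1.adj,
        by simpa using f1.listing⟩, by simpa using f2, ?_⟩
      intro i hi
      rcases Nat.lt_succ_iff_lt_or_eq.1 hi with hi | rfl
      · intro m1 m2 m3
        exact g3 i hi (f3 _ m1) (f3 _ m2) (f3 _ m3)
      · exact f4)
  refine ⟨c1, c2, fun u v w hu hv hw => ?_⟩
  have hlt : (u * n + v) * n + w < n * n * n := by
    have h1 : u * n + v < n * n := by nlinarith
    nlinarith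
  have := c3 _ hlt
  have e1 : ((u * n + v) * n + w) / n = u * n + v := by
    rw [mul_comm, Nat.mul_add_div (by omega), Nat.div_eq_of_lt hw, add_zero]
  have e2 : ((u * n + v) * n + w) % n = w := by
    rw [mul_comm, Nat.mul_add_mod, Nat.mod_eq_of_lt hw]
  have e3 : (u * n + v) / n = u := by
    rw [mul_comm, Nat.mul_add_div (by omega), Nat.div_eq_of_lt hv, add_zero]
  have e4 : (u * n + v) % n = v := by
    rw [mul_comm, Nat.mul_add_mod, Nat.mod_eq_of_lt hv]
  rwa [← Nat.div_div_eq_div_mul, e1, e2, e3, e4] at this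

/-- The vertices listed at the positions from `m` up to `c` form non-adjacent pairs. -/
def PairsListed (G : SimpleGraph (Fin n)) (m c : ℕ) (vert : ℕ → ℕ) : Prop :=
  m ≤ c ∧ 2 ∣ c - m ∧ ∀ i j, m ≤ i → m ≤ j → i < c → j < c → (i - m) / 2 = (j - m) / 2 →
    ¬ AdjNat G (vert i) (vert j)

/-- Two distinct vertices that are not marked are adjacent. -/
def PairTaken (G : SimpleGraph (Fin n)) (mark : ℕ → ℕ) (u v : ℕ) : Prop :=
  mark u = 0 → mark v = 0 → u ≠ v → AdjNat G u v

theorem pairStep_spec {W m u v : ℕ} (hW : n < W) {s : State} (hu : u < n) (hv : v < n)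
    (h12 : s.regs 12 = u) (h13 : s.regs 13 = v)
    (h : ListState G W (s.regs 4) s) (ht : PairsListed G m (s.regs 4) (s.arrays 2)) :
    let s' := pairStep.run s
    ListState G W (s'.regs 4) s' ∧ PairsListed G m (s'.regs 4) (s'.arrays 2) ∧
      (∀ i < s.regs 4, s'.arrays 2 i = s.arrays 2 i) ∧ s.regs 4 ≤ s'.regs 4 ∧
      (∀ x, s'.arrays 1 x = 0 → s.arrays 1 x = 0) ∧ PairTaken G (s'.arrays 1) u v := by
  have a1 := h.adj u v hu hv
  rw [pairStep, run_ite]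
  split_ifs with hc
  · refine ⟨h, ht, fun _ _ => rfl, le_rfl, fun x hx => hx, ?_⟩
    intro mu mv huv
    simp only [run_skip] at mu mv
    by_contra hcon
    apply hc
    simp [h12, h13, h.size, mu, mv, huv, not_not.1 (mt a1.1 hcon)]
  · simp only [ne_eq, not_not, eval_add, eval_cell, eval_eq, eval_reg, eval_mul, h12, h13,
      h.size, Nat.add_eq_zero_iff, ite_eq_right_iff, one_ne_zero, imp_false] at hc
    obtain ⟨⟨⟨mu, mv⟩, huv⟩, b1⟩ := hc
    have n1 : ¬ AdjNat G u v := fun hA => a1.2 hA b1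
    have l1 := h.listing.push hu mu
    have l2 := l1.push hv (by rw [Function.update_of_ne (Ne.symm huv)]; exact mv)
    have hlt : s.regs 4 + 2 < W := l2.le.trans_lt hW
    simp only [run_seq, run_store, run_assign, eval_reg, eval_add, eval_const, eval_mod,
      regs_setCell, regs_setReg, h.big, h12, h13, Nat.mod_eq_of_lt hlt, arrays_setReg,
      arrays_setCell', reduceIte, OfNat.ofNat_ne_one, OfNat.one_ne_ofNat]
    have hval : ∀ i < s.regs 4, Function.update (Function.update (s.arrays 2)
        (s.regs 4) u) (s.regs 4 + 1) v i = s.arrays 2 i := by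
      intro i hi
      rw [Function.update_of_ne (by omega), Function.update_of_ne (by omega)]
    refine ⟨⟨by simp [h.size], by simp [h.big], by simpa [arrays_setCell'] using h.adj, ?_⟩,
      ⟨?_, ?_, ?_⟩, hval, by omega, ?_, ?_⟩
    · simpa [arrays_setCell'] using l2
    · have := ht.1; omega
    · have := ht.2.1; have := ht.1; omega
    · intro i j mi mj hi hj hij
      obtain ⟨d, hd⟩ := ht.2.1
      have := ht.1
      by_cases hi' : i < s.regs 4
      · have hj' : j < s.regs 4 := by omega
        rw [hval i hi', hval j hj']
        exact ht.2.2 i j mi mj hi' hj' hij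
      · have hj' : ¬ j < s.regs 4 := by omega
        have hi'' : i = s.regs 4 ∨ i = s.regs 4 + 1 := by omega
        have hj'' : j = s.regs 4 ∨ j = s.regs 4 + 1 := by omega
        rcases hi'' with rfl | rfl <;> rcases hj'' with rfl | rfl <;>
          simp only [Function.update_apply, Nat.left_eq_add, reduceIte, one_ne_zero] <;>
          first
            | exact not_adjNat_self _
            | assumption
            | exact fun hA => n1 hA.symm
    · intro x hx
      simp only [Function.update_apply] at hx
      split_ifs at hx; simp_all
    · intro hA
      exfalso
      simp only [Function.update_apply] at hA
      split_ifs at hA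

theorem pairRound_spec {W k m : ℕ} (hW : n < W) {s : State} (hk : k < n * n)
    (h11 : s.regs 11 = k) (h : ListState G W (s.regs 4) s)
    (ht : PairsListed G m (s.regs 4) (s.arrays 2)) :
    let s' := pairRound.run s
    ListState G W (s'.regs 4) s' ∧ PairsListed G m (s'.regs 4) (s'.arrays 2) ∧
      (∀ i < s.regs 4, s'.arrays 2 i = s.arrays 2 i) ∧ s.regs 4 ≤ s'.regs 4 ∧
      (∀ x, s'.arrays 1 x = 0 → s.arrays 1 x = 0) ∧
      PairTaken G (s'.arrays 1) (k / n) (k % n) := by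
  have hn : 0 < n := by
    rcases Nat.eq_zero_or_pos n with rfl | h
    · simp at hk
    · exact h
  have hu : k / n < n := by
    rw [Nat.div_lt_iff_lt_mul (by positivity)]; linarith
  refine pairStep_spec (s := (Prog.assign 13 (.reg 11 %ₑ .reg 0)).run
    ((Prog.assign 12 (.reg 11 /ₑ .reg 0)).run s)) hW hu (Nat.mod_lt _ hn) ?_ ?_
    ⟨?_, ?_, ?_, ?_⟩ ?_
  · simp [h11, h.size]
  · simp [h11, h.size]
  · simp [h.size]
  · simp [h.big]
  · simpa using h.adj
  · simpa using h.listing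
  · simpa using ht

theorem listPairs_spec {W m : ℕ} (hW : n < W) {s : State} (h : ListState G W m s)
    (h3 : s.regs 3 = m) :
    let s' := listPairs.run s
    ListState G W (s'.regs 4) s' ∧ PairsListed G m (s'.regs 4) (s'.arrays 2) ∧
      (∀ i < m, s'.arrays 2 i = s.arrays 2 i) ∧
      ∀ u v, u < n → v < n → PairTaken G (s'.arrays 1) u v := by
  have key := Prog.run_count_induction (x := 11) (e := .reg 0 *ₑ .reg 0)
    (p := pairRound) (s := s.setReg 4 m) (fun k s' =>
      ListState G W (s'.regs 4) s' ∧ PairsListed G m (s'.regs 4) (s'.arrays 2) ∧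
      (∀ i < m, s'.arrays 2 i = s.arrays 2 i) ∧ m ≤ s'.regs 4 ∧
      ∀ i < k, PairTaken G (s'.arrays 1) (i / n) (i % n))
  have hN : (Expr.reg 0 *ₑ .reg 0).eval (s.setReg 4 m) = n * n := by simp [h.size]
  rw [hN] at key
  obtain ⟨c1, c2, c3, -, c5⟩ := key
    ⟨⟨by simp [h.size], by simp [h.big], by simpa using h.adj, by simpa using h.listing⟩,
      ⟨by simp, by simp, by intro i j; simp; omega⟩, by simp, by simp, by simp⟩
    (fun k s' hk h11 ⟨g1, g2, g3, g4, g5⟩ => by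
      obtain ⟨f1, f2, f3, f4, f5, f6⟩ := pairRound_spec hW hk h11 g1 g2
      refine ⟨⟨by simp [f1.size], by simp [f1.big], by simpa using f1.adj,
        by simpa using f1.listing⟩, by simpa using f2, ?_, by simpa using g4.trans f4, ?_⟩
      · intro i hi
        simp only [arrays_setReg]
        rw [f3 i (by omega), g3 i hi]
      intro i hi
      rcases Nat.lt_succ_iff_lt_or_eq.1 hi with hi | rfl
      · intro m1 m2
        exact g5 i hi (f5 _ m1) (f5 _ m2)
      · exact f6)
  have hrun : listPairs.run s = (Prog.count 11 (.reg 0 *ₑ .reg 0) pairRound).run (s.setReg 4 m) := by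
    simp [listPairs, h3]
  rw [hrun]
  refine ⟨c1, c2, c3, fun u v hu hv => ?_⟩
  have hlt : u * n + v < n * n := by nlinarith
  have := c5 _ hlt
  have e3 : (u * n + v) / n = u := by
    rw [mul_comm, Nat.mul_add_div (by omega), Nat.div_eq_of_lt hv, add_zero]
  have e4 : (u * n + v) % n = v := by
    rw [mul_comm, Nat.mul_add_mod, Nat.mod_eq_of_lt hv]
  rwa [e3, e4] at this

theorem restRound_spec {W k : ℕ} (hW : n < W) {s : State} (hk : k < n)
    (h11 : s.regs 11 = k) (h : ListState G W (s.regs 15) s) :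
    let s' := restRound.run s
    ListState G W (s'.regs 15) s' ∧ (∀ i < s.regs 15, s'.arrays 2 i = s.arrays 2 i) ∧
      s.regs 15 ≤ s'.regs 15 ∧ (∀ x, s'.arrays 1 x = 0 → s.arrays 1 x = 0) ∧
      s'.arrays 1 k ≠ 0 := by
  rw [restRound, run_ite]
  split_ifs with hc
  · refine ⟨h, fun _ _ => rfl, le_rfl, fun x hx => hx, ?_⟩
    simpa [h11] using hc
  · simp only [ne_eq, not_not, eval_cell, eval_reg, h11] at hc
    have l1 := h.listing.push hk hc
    have hlt : s.regs 15 + 1 < W := l1.le.trans_lt hW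
    simp only [run_seq, run_store, run_assign, eval_reg, eval_add, eval_const, eval_mod,
      regs_setCell, regs_setReg, h.big, h11, Nat.mod_eq_of_lt hlt, arrays_setReg,
      arrays_setCell', reduceIte, OfNat.ofNat_ne_one, OfNat.one_ne_ofNat]
    refine ⟨⟨by simp [h.size], by simp [h.big], by simpa [arrays_setCell'] using h.adj, ?_⟩,
      ?_, by omega, ?_, by simp⟩
    · simpa [arrays_setCell'] using l1
    · intro i hi
      rw [Function.update_of_ne (by omega)]
    · intro x hx
      simp only [Function.update_apply] at hx
      split_ifs at hx; simp_all

theorem listRest_spec {W c : ℕ} (hW : n < W) {s : State} (h : ListState G W c s)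
    (h4 : s.regs 4 = c) :
    let s' := listRest.run s
    ListState G W n s' ∧ ∀ i < c, s'.arrays 2 i = s.arrays 2 i := by
  have key := Prog.run_count_induction (x := 11) (e := .reg 0)
    (p := restRound) (s := s.setReg 15 c) (fun k s' =>
      ListState G W (s'.regs 15) s' ∧ (∀ i < c, s'.arrays 2 i = s.arrays 2 i) ∧ c ≤ s'.regs 15 ∧
      ∀ i < k, s'.arrays 1 i ≠ 0)
  have hN : (Expr.reg 0).eval (s.setReg 15 c) = n := by simp [h.size]
  rw [hN] at key
  obtain ⟨c1, c2, -, c4⟩ := key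
    ⟨⟨by simp [h.size], by simp [h.big], by simpa using h.adj, by simpa using h.listing⟩,
      by simp, by simp, by simp⟩
    (fun k s' hk h11 ⟨g1, g2, g3, g4⟩ => by
      obtain ⟨f1, f2, f3, f4, f5⟩ := restRound_spec hW hk h11 g1
      refine ⟨⟨by simp [f1.size], by simp [f1.big], by simpa using f1.adj,
        by simpa using f1.listing⟩, ?_, by simpa using g3.trans f3, ?_⟩
      · intro i hi
        simp only [arrays_setReg]
        rw [f2 i (by omega), g2 i hi]
      intro i hi
      rcases Nat.lt_succ_iff_lt_or_eq.1 hi with hi | rfl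
      · exact fun m1 => g4 i hi (f4 _ m1)
      · exact f5)
  have hrun : listRest.run s = (Prog.count 11 (.reg 0) restRound).run (s.setReg 15 c) := by
    simp [listRest, h4]
  rw [hrun]
  set s' := (Prog.count 11 (.reg 0) restRound).run (s.setReg 15 c)
  have hle := c1.listing.le
  have hge : n ≤ s'.regs 15 := by
    have : Finset.range n ⊆ (Finset.range (s'.regs 15)).image (s'.arrays 2) := by
      intro v hv
      rw [Finset.mem_range] at hv
      obtain ⟨i, hi, hiv⟩ := (c1.listing.mark v hv).1 (c4 v hv)
      exact Finset.mem_image.2 ⟨i, Finset.mem_range.2 hi, hiv⟩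
    have := (Finset.card_le_card this).trans Finset.card_image_le
    simpa using this
  have heq : s'.regs 15 = n := le_antisymm hle hge
  rw [heq] at c1
  exact ⟨c1, c2⟩

/-- The listing that is computed is greedy. -/
theorem listVertices_spec {W : ℕ} (hW : n < W) {s : State} (h : ListState G W 0 s)
    (h3 : s.regs 3 = 0) :
    let s' := listVertices.run s
    ∃ σ : Equiv.Perm (Fin n), (∀ i : Fin n, s'.arrays 2 i = σ i) ∧
      (G.comap σ).IsGreedyListing (s'.regs 3) (s'.regs 4) := by
  intro s'
  obtain ⟨a1, a2, a3⟩ := listTriples_spec hW h h3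
  set s1 := listTriples.run s
  obtain ⟨b1, b2, b3, b4⟩ := listPairs_spec hW a1 rfl
  set s2 := listPairs.run s1
  obtain ⟨c1, c2⟩ := listRest_spec hW b1 rfl
  have hs' : s' = listRest.run s2 := rfl
  rw [← hs'] at c1 c2
  have e3 : s'.regs 3 = s1.regs 3 := by
    rw [hs', Prog.run_regs _ (by decide), Prog.run_regs _ (by decide)]
  have e4 : s'.regs 4 = s2.regs 4 := by rw [hs', Prog.run_regs _ (by decide)]
  have hlt : ∀ i : Fin n, s'.arrays 2 i < n := fun i => c1.listing.lt i i.2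
  have hinj : Function.Injective fun i : Fin n => (⟨s'.arrays 2 i, hlt i⟩ : Fin n) := by
    intro i j hij
    simp only [Fin.mk.injEq] at hij
    exact Fin.ext (c1.listing.inj i i.2 j j.2 hij)
  have hmc := b2.1
  have hadj : ∀ (i j : Fin n), AdjNat G (s'.arrays 2 i) (s'.arrays 2 j) →
      (G.comap fun i : Fin n => (⟨s'.arrays 2 i, hlt i⟩ : Fin n)).Adj i j := by
    rintro i j ⟨_, _, hA⟩
    exact hA
  have hadj' : ∀ (i j : Fin n),
      (G.comap fun i : Fin n => (⟨s'.arrays 2 i, hlt i⟩ : Fin n)).Adj i j →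
      AdjNat G (s'.arrays 2 i) (s'.arrays 2 j) := fun i j hA => ⟨_, _, hA⟩
  have v1 : ∀ i < s1.regs 3, s'.arrays 2 i = s1.arrays 2 i := fun i hi => by
    rw [c2 i (by omega), b3 i hi]
  have un2 : ∀ i : Fin n, s2.regs 4 ≤ i.val → s2.arrays 1 (s'.arrays 2 i) = 0 := by
    intro i hi
    by_contra hne
    obtain ⟨j, hj, hji⟩ := (b1.listing.mark _ (hlt i)).1 hne
    rw [← c2 j hj] at hji
    have := b1.listing.le
    have := c1.listing.inj j (by omega) i i.2 hji
    omega
  have un1 : ∀ i : Fin n, s1.regs 3 ≤ i.val → s1.arrays 1 (s'.arrays 2 i) = 0 := by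
    intro i hi
    by_contra hne
    obtain ⟨j, hj, hji⟩ := (a1.listing.mark _ (hlt i)).1 hne
    rw [← v1 j hj] at hji
    have := a1.listing.le
    have := c1.listing.inj j (by omega) i i.2 hji
    omega
  have hne : ∀ i j : Fin n, i ≠ j → s'.arrays 2 i ≠ s'.arrays 2 j := fun i j hij h' =>
    hij (Fin.ext (c1.listing.inj i i.2 j j.2 h'))
  refine ⟨Equiv.ofBijective _ (Finite.injective_iff_bijective.1 hinj), fun i => rfl, ?_⟩
  rw [e3, e4]
  refine ⟨hmc, b1.listing.le, a2.1, b2.2.1, ?_, ?_, ?_, ?_⟩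
  · intro i j hi hj hij hA
    have := hadj' i j hA
    rw [v1 i hi, v1 j hj] at this
    exact a2.2 i j hi hj hij this
  · intro i j hi hj hi' hj' hij hA
    have := hadj' i j hA
    rw [c2 i hi', c2 j hj'] at this
    exact b2.2.2 i j hi hj hi' hj' hij this
  · intro i j k hi hj hk hij hik hjk
    rcases a3 _ _ _ (hlt i) (hlt j) (hlt k) (un1 i hi) (un1 j hj) (un1 k hk) (hne i j hij)
      (hne i k hik) (hne j k hjk) with hA | hA | hA
    · exact .inl (hadj _ _ hA)
    · exact .inr (.inl (hadj _ _ hA))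
    · exact .inr (.inr (hadj _ _ hA))
  · intro i j hi hj hij
    exact hadj _ _ (b4 _ _ (hlt i) (hlt j) (un2 i hi) (un2 j hj) (hne i j hij))

end

end CoinRAM

namespace CoinRAM

open BinaryField

/-! ### Parameters -/

/-- Put `2 ^ (n + 1)` into register `2`. -/
def bigNumber : Prog :=
  .assign 2 (.const 1) ;; .count 11 (.reg 0 +ₑ .const 1) (.assign 2 (.reg 2 +ₑ .reg 2))

theorem bigNumber_spec (s : State) : (bigNumber.run s).regs 2 = 2 ^ (s.regs 0 + 1) := by
  have key := Prog.run_count_induction (x := 11) (e := .reg 0 +ₑ .const 1)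
    (p := .assign 2 (.reg 2 +ₑ .reg 2)) (s := s.setReg 2 1) (fun k s' => s'.regs 2 = 2 ^ k)
    (by simp) (fun k s' _ _ h => by simp [h, pow_succ]; ring)
  simpa [bigNumber] using key

/-- Put the powers of two below `2 ^ m` into array `4` and `2 ^ m` into register `5`, where
register `3` holds `m`. -/
def powers : Prog :=
  .assign 5 (.const 1) ;;
  .count 11 (.reg 3) (.store 4 (.reg 11) (.reg 5) ;; .assign 5 ((.reg 5 +ₑ .reg 5) %ₑ .reg 2))

theorem powers_spec {s : State} (h : 2 ^ s.regs 3 < s.regs 2) :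
    let s' := powers.run s
    s'.regs 5 = 2 ^ s.regs 3 ∧ ∀ i < s.regs 3, s'.arrays 4 i = 2 ^ i := by
  have key := Prog.run_count_induction (x := 11) (e := .reg 3)
    (p := .store 4 (.reg 11) (.reg 5) ;; .assign 5 ((.reg 5 +ₑ .reg 5) %ₑ .reg 2))
    (s := s.setReg 5 1)
    (fun k s' => s'.regs 2 = s.regs 2 ∧ s'.regs 5 = 2 ^ k ∧ ∀ i < k, s'.arrays 4 i = 2 ^ i)
    (by simp) (fun k s' hk h11 ⟨h2, h5, h4⟩ => by
      simp only [eval_reg, regs_setReg, Nat.reduceEqDiff, reduceIte] at hk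
      refine ⟨by simp [h2], ?_, ?_⟩
      · have : 2 ^ (k + 1) ≤ 2 ^ s.regs 3 := Nat.pow_le_pow_right (by norm_num) hk
        have e : 2 ^ k + 2 ^ k = 2 ^ (k + 1) := by ring
        simp only [run_seq, run_store, run_assign, eval_mod, eval_add, eval_reg, regs_setReg,
          regs_setCell, Nat.reduceEqDiff, reduceIte, h2, h5, e]
        exact Nat.mod_eq_of_lt (by omega)
      · intro i hi
        simp only [run_seq, run_store, run_assign, arrays_setReg, arrays_setCell, eval_reg, h11, h5,
          true_and]
        split_ifs with hik
        · rw [hik]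
        · exact h4 i (by omega))
  simp only [eval_reg, regs_setReg, Nat.reduceEqDiff, reduceIte] at key
  have hrun : powers.run s = (Prog.count 11 (.reg 3) (.store 4 (.reg 11) (.reg 5) ;;
    .assign 5 ((.reg 5 +ₑ .reg 5) %ₑ .reg 2))).run (s.setReg 5 1) := rfl
  rw [hrun]
  exact ⟨key.2.1, key.2.2⟩

/-- Put a power of two `Q = 2 ^ q` with `Q < T ≤ 2 * Q` into register `7` and its exponent `q` into
register `8`, where register `23` holds `T`. -/
def fieldSize : Prog :=
  .assign 7 (.const 1) ;; .assign 8 (.const 0) ;;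
  .count 11 (.reg 23) (.ite (.reg 7 +ₑ .reg 7 <ₑ .reg 23)
    (.assign 7 ((.reg 7 +ₑ .reg 7) %ₑ .reg 23) ;; .assign 8 ((.reg 8 +ₑ .const 1) %ₑ .reg 23))
    .skip)

theorem fieldSize_spec {s : State} (h : 1 < s.regs 23) :
    let s' := fieldSize.run s
    s'.regs 7 = 2 ^ s'.regs 8 ∧ s'.regs 7 < s.regs 23 ∧ s.regs 23 ≤ 2 * s'.regs 7 := by
  have key := Prog.run_count_induction (x := 11) (e := .reg 23)
    (p := .ite (.reg 7 +ₑ .reg 7 <ₑ .reg 23)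
      (.assign 7 ((.reg 7 +ₑ .reg 7) %ₑ .reg 23) ;; .assign 8 ((.reg 8 +ₑ .const 1) %ₑ .reg 23))
      .skip)
    (s := (s.setReg 7 1).setReg 8 0)
    (fun k s' => s'.regs 23 = s.regs 23 ∧ s'.regs 7 = 2 ^ s'.regs 8 ∧ s'.regs 7 < s.regs 23 ∧
      (s.regs 23 ≤ 2 * s'.regs 7 ∨ k < s'.regs 7))
    (by simp [h]) (fun k s' hk h11 ⟨h23, h7, hlt, hor⟩ => by
      rw [run_ite]
      simp only [eval_lt, eval_add, eval_reg, h23]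
      by_cases hc : s'.regs 7 + s'.regs 7 < s.regs 23
      · simp only [if_pos hc, run_seq, run_assign, eval_mod, eval_add, eval_reg, regs_setReg,
          Nat.reduceEqDiff, reduceIte, h23, eval_const, ne_eq, one_ne_zero, not_false_eq_true]
        have hq : s'.regs 8 < s'.regs 7 := by rw [h7]; exact Nat.lt_two_pow_self
        rw [Nat.mod_eq_of_lt hc, Nat.mod_eq_of_lt (by omega)]
        refine ⟨trivial, ?_, hc, ?_⟩
        · rw [pow_succ, ← h7]; ring
        · right; omega
      · simp only [if_neg hc, ne_eq, not_true_eq_false, reduceIte, run_skip, regs_setReg,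
          Nat.reduceEqDiff, h23]
        exact ⟨trivial, h7, hlt, .inl (by omega)⟩)
  have hrun : fieldSize.run s = (Prog.count 11 (.reg 23) (.ite (.reg 7 +ₑ .reg 7 <ₑ .reg 23)
      (.assign 7 ((.reg 7 +ₑ .reg 7) %ₑ .reg 23) ;; .assign 8 ((.reg 8 +ₑ .const 1) %ₑ .reg 23))
      .skip)).run ((s.setReg 7 1).setReg 8 0) := rfl
  simp only [eval_reg, regs_setReg, Nat.reduceEqDiff, reduceIte] at key
  rw [← hrun] at key
  obtain ⟨-, k2, k3, k4⟩ := key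
  exact ⟨k2, k3, by omega⟩

/-! ### Tables for the field -/

/-- The table of addition, in array `5`; register `7` holds the size `Q` of the field. -/
def addTable : Prog :=
  .count 11 (.reg 7 *ₑ .reg 7) (.store 5 (.reg 11)
    ((.const 2 *ₑ .cell 5 (.reg 11 /ₑ .reg 7 /ₑ .const 2 *ₑ .reg 7 +ₑ
      .reg 11 %ₑ .reg 7 /ₑ .const 2) *ₑ (.const 0 <ₑ .reg 11) +ₑ
      (.reg 11 /ₑ .reg 7 +ₑ .reg 11 %ₑ .reg 7) %ₑ .const 2) %ₑ .reg 7))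

theorem xor_eq (a b : ℕ) : a ^^^ b = 2 * (a / 2 ^^^ b / 2) + (a + b) % 2 := by
  have h := Nat.div_add_mod (a ^^^ b) 2
  rw [Nat.xor_div_two, Nat.xor_mod_two_eq] at h
  exact h.symm

theorem mul_add_div_of_lt {a b Q : ℕ} (h : b < Q) : (a * Q + b) / Q = a := by
  rw [mul_comm, Nat.mul_add_div (by omega), Nat.div_eq_of_lt h, add_zero]

theorem mul_add_mod_of_lt {a b Q : ℕ} (h : b < Q) : (a * Q + b) % Q = b := by
  rw [mul_comm, Nat.mul_add_mod, Nat.mod_eq_of_lt h]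

/-- Array `5` holds the table of addition. -/
def HasAddTable (Q : ℕ) (s : State) : Prop :=
  ∀ a b, a < Q → b < Q → s.arrays 5 (a * Q + b) = a ^^^ b

theorem addTable_spec {s : State} {q : ℕ} (h : s.regs 7 = 2 ^ q) :
    HasAddTable (2 ^ q) (addTable.run s) := by
  set Q := 2 ^ q with hQ
  have hpos : 0 < Q := by positivity
  have hrun := Prog.run_fill (x := 11) (a := 5) (e := .reg 7 *ₑ .reg 7) (s := s)
    (g := (.const 2 *ₑ .cell 5 (.reg 11 /ₑ .reg 7 /ₑ .const 2 *ₑ .reg 7 +ₑ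
      .reg 11 %ₑ .reg 7 /ₑ .const 2) *ₑ (.const 0 <ₑ .reg 11) +ₑ
      (.reg 11 /ₑ .reg 7 +ₑ .reg 11 %ₑ .reg 7) %ₑ .const 2) %ₑ .reg 7)
    (fun i => i / Q ^^^ i % Q) (fun k hk => by
      simp only [eval_mul, eval_reg, h] at hk
      have ha : k / Q < Q := by rwa [Nat.div_lt_iff_lt_mul hpos]
      have hb : k % Q < Q := Nat.mod_lt _ hpos
      have hx : k / Q ^^^ k % Q < Q := Nat.xor_lt_two_pow ha hb
      simp only [eval_mod, eval_add, eval_mul, eval_const, eval_cell, eval_div, eval_reg, eval_lt,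
        Function.update_apply, h, reduceIte, Nat.reduceEqDiff]
      by_cases hk0 : k = 0
      · subst hk0; simp
      · have hlt : k / Q / 2 * Q + k % Q / 2 < k := by
          have hdm := Nat.div_add_mod k Q
          by_cases h0 : k / Q = 0
          · rw [h0] at hdm ⊢; simp at hdm ⊢; omega
          · have : (k / Q / 2 + 1) * Q ≤ k / Q * Q := Nat.mul_le_mul_right _
              (Nat.div_lt_self (Nat.pos_of_ne_zero h0) one_lt_two)
            rw [mul_comm Q] at hdm
            rw [add_mul] at this
            omega
        have hb2 : k % Q / 2 < Q := by omega
        rw [if_pos hlt, if_pos (by omega : 0 < k), mul_add_div_of_lt hb2, mul_add_mod_of_lt hb2,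
          mul_one, ← xor_eq]
        exact Nat.mod_eq_of_lt hx)
  intro a b ha hb
  have : addTable.run s = _ := hrun
  rw [this]
  have hlt : a * Q + b < Q * Q := by nlinarith
  simp [h, hlt, mul_add_div_of_lt hb, Nat.mod_eq_of_lt hb]

/-- The table of multiplication modulo `X ^ q + poly p`, in array `6`; register `9` holds `p`. -/
def mulTable : Prog :=
  .count 11 (.reg 7 *ₑ .reg 7) (.store 6 (.reg 11)
    (.cell 5 (.cell 5 (
      .const 2 *ₑ (.cell 6 (.reg 11 /ₑ .reg 7 *ₑ .reg 7 +ₑ .reg 11 %ₑ .reg 7 /ₑ .const 2) *ₑ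
        (.const 0 <ₑ .reg 11 %ₑ .reg 7)) %ₑ .reg 7 *ₑ .reg 7 +ₑ
      .const 2 *ₑ (.cell 6 (.reg 11 /ₑ .reg 7 *ₑ .reg 7 +ₑ .reg 11 %ₑ .reg 7 /ₑ .const 2) *ₑ
        (.const 0 <ₑ .reg 11 %ₑ .reg 7)) /ₑ .reg 7 *ₑ .reg 9) *ₑ .reg 7 +ₑ
      .reg 11 %ₑ .reg 7 %ₑ .const 2 *ₑ (.reg 11 /ₑ .reg 7))))

/-- Array `6` holds the table of multiplication modulo `X ^ q + poly p`. -/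
def HasMulTable (Q p : ℕ) (s : State) : Prop :=
  ∀ a b, a < Q → b < Q → s.arrays 6 (a * Q + b) = mul Q p a b

theorem mulTable_spec {s : State} {q p : ℕ} (h : s.regs 7 = 2 ^ q) (hp : p < 2 ^ q)
    (h9 : s.regs 9 = p) (hadd : HasAddTable (2 ^ q) s) :
    HasMulTable (2 ^ q) p (mulTable.run s) := by
  set Q := 2 ^ q with hQ
  have hpos : 0 < Q := by positivity
  have hrun : mulTable.run s = _ := Prog.run_fill (x := 11) (a := 6) (e := .reg 7 *ₑ .reg 7)
    (s := s) (g := _)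
    (fun i => mul Q p (i / Q) (i % Q)) (fun k hk => by
      simp only [eval_mul, eval_reg, h] at hk
      have ha : k / Q < Q := by rwa [Nat.div_lt_iff_lt_mul hpos]
      have hb : k % Q < Q := Nat.mod_lt _ hpos
      have hb2 : k % Q / 2 < Q := by omega
      have ht : (if k / Q * Q + k % Q / 2 < k then
          mul Q p ((k / Q * Q + k % Q / 2) / Q) ((k / Q * Q + k % Q / 2) % Q)
          else s.arrays 6 (k / Q * Q + k % Q / 2)) * (if 0 < k % Q then 1 else 0) =
          mul Q p (k / Q) (k % Q / 2) := by
        have hdm := Nat.div_add_mod' k Q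
        by_cases h0 : 0 < k % Q
        · rw [if_pos h0, if_pos (by omega), mul_add_div_of_lt hb2, mul_add_mod_of_lt hb2, mul_one]
        · have : k % Q = 0 := by omega
          rw [if_neg h0, this, mul_zero, mul]; simp
      simp only [eval_mod, eval_add, eval_mul, eval_const, eval_cell, eval_div, eval_reg, eval_lt,
        Function.update_apply, h, h9, reduceIte, Nat.reduceEqDiff, ht]
      have hlt := mul_lt hp ha (k % Q / 2)
      rw [← hQ] at hlt
      set t := mul Q p (k / Q) (k % Q / 2)
      have h2 : 2 * t / Q < 2 := by
        rw [Nat.div_lt_iff_lt_mul hpos]; omega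
      have hx2 : 2 * t / Q * p < Q := by
        have := Nat.mul_le_mul_right p (Nat.lt_succ_iff.1 h2); omega
      have hm2 : k % Q % 2 * (k / Q) < Q := by
        have h3 : k % Q % 2 ≤ 1 := Nat.lt_succ_iff.1 (Nat.mod_lt _ two_pos)
        have := Nat.mul_le_mul_right (k / Q) h3
        omega
      rw [hadd _ _ (Nat.mod_lt _ hpos) hx2]
      have hs := shift_lt hp hlt
      rw [← hQ, shift] at hs
      rw [hadd _ _ hs hm2]
      conv_rhs => rw [mul]
      split_ifs with hz
      · have : t = 0 := by simp only [t, hz]; rw [mul]; simp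
        simp [this, hz]
      · rfl)
  intro a b ha hb
  rw [hrun]
  have hlt : a * Q + b < Q * Q := by nlinarith
  simp [h, hlt, mul_add_div_of_lt hb, Nat.mod_eq_of_lt hb]

/-- Put into array `7` at each place a factor with product one, if there is one. -/
def invTable : Prog :=
  .count 11 (.reg 7) (.store 7 (.reg 11) (.const 0)) ;;
  .count 11 (.reg 7 *ₑ .reg 7) (.ite (.cell 6 (.reg 11) =ₑ .const 1)
    (.store 7 (.reg 11 /ₑ .reg 7) (.reg 11 %ₑ .reg 7)) .skip)

theorem invTable_spec {s : State} {Q p : ℕ} (hpos : 0 < Q) (h : s.regs 7 = Q)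
    (hmul : HasMulTable Q p s) :
    let s' := invTable.run s
    (∀ a < Q, s'.arrays 7 a < Q) ∧
      ∀ a < Q, (∃ b < Q, mul Q p a b = 1) → mul Q p a (s'.arrays 7 a) = 1 := by
  have hfill : (Prog.count 11 (.reg 7) (.store 7 (.reg 11) (.const 0))).run s = _ :=
    Prog.run_fill (fun _ => 0) (fun k hk => by simp)
  set s1 := (Prog.count 11 (.reg 7) (.store 7 (.reg 11) (.const 0))).run s
  have h1 : s1.regs 7 = Q := by rw [hfill]; simp [h]
  have h2 : HasMulTable Q p s1 := by rw [hfill]; intro a b ha hb; simpa using hmul a b ha hb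
  have h3 : ∀ a < Q, s1.arrays 7 a = 0 := by rw [hfill]; intro a ha; simp [h, ha]
  have key := Prog.run_count_induction (x := 11) (e := .reg 7 *ₑ .reg 7)
    (p := .ite (.cell 6 (.reg 11) =ₑ .const 1)
      (.store 7 (.reg 11 /ₑ .reg 7) (.reg 11 %ₑ .reg 7)) .skip)
    (s := s1) (fun k s' => s'.regs 7 = Q ∧ HasMulTable Q p s' ∧ (∀ a < Q, s'.arrays 7 a < Q) ∧
      ∀ a b, b < Q → a * Q + b < k → mul Q p a b = 1 → mul Q p a (s'.arrays 7 a) = 1)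
    ⟨by simp [h1], by simpa [HasMulTable] using h2, by
      intro a ha; simpa [h3 a ha] using hpos, by simp⟩
    (fun k s' hk h11 ⟨g1, g2, g3, g4⟩ => by
      simp only [eval_mul, eval_reg, h1] at hk
      have ha : k / Q < Q := by rwa [Nat.div_lt_iff_lt_mul hpos]
      have hb : k % Q < Q := Nat.mod_lt _ hpos
      have hcell : s'.arrays 6 k = mul Q p (k / Q) (k % Q) := by
        conv_lhs => rw [← Nat.div_add_mod' k Q]
        exact g2 _ _ ha hb
      rw [run_ite]
      simp only [eval_eq, eval_cell, eval_reg, h11, hcell, eval_const]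
      by_cases hc : mul Q p (k / Q) (k % Q) = 1
      · simp only [if_pos hc, ne_eq, one_ne_zero, not_false_eq_true, reduceIte, run_store, eval_reg,
          eval_div, eval_mod, h11, g1]
        refine ⟨by simp [g1], by simpa [HasMulTable] using g2, ?_, ?_⟩
        · intro a ha
          simp only [arrays_setReg, arrays_setCell, true_and]
          split_ifs
          · exact hb
          · exact g3 a ha
        · intro a b hb hk hab
          simp only [arrays_setReg, arrays_setCell, true_and]
          split_ifs with hak
          · rw [hak]; exact hc
          · refine g4 a b hb ?_ hab
            rcases Nat.lt_succ_iff_lt_or_eq.1 hk with hk | hk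
            · exact hk
            · exfalso; apply hak; rw [← hk, mul_add_div_of_lt hb]
      · simp only [if_neg hc, ne_eq, not_true_eq_false, reduceIte, run_skip, regs_setReg,
          Nat.reduceEqDiff, arrays_setReg]
        refine ⟨g1, by simpa [HasMulTable] using g2, g3, ?_⟩
        intro a b hb hk hab
        refine g4 a b hb ?_ hab
        rcases Nat.lt_succ_iff_lt_or_eq.1 hk with hk | hk
        · exact hk
        · exfalso; apply hc; rw [← hk, mul_add_div_of_lt hb, mul_add_mod_of_lt hb]; exact hab)
  obtain ⟨-, -, k3, k4⟩ := key
  refine ⟨k3, fun a ha ⟨b, hb, hab⟩ => k4 a b hb ?_ hab⟩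
  simp only [eval_mul, eval_reg, h1]
  nlinarith

/-- Check whether all nonzero elements have inverses; the answer is put into register `10`. -/
def checkInverses : Prog :=
  .assign 10 (.const 1) ;;
  .count 11 (.reg 7) (.ite ((.const 0 <ₑ .reg 11) *ₑ
    (.const 1 -ₑ (.cell 6 (.reg 11 *ₑ .reg 7 +ₑ .cell 7 (.reg 11)) =ₑ .const 1)))
    (.assign 10 (.const 0)) .skip)

theorem checkInverses_spec {s : State} {Q p : ℕ} (h : s.regs 7 = Q) (hmul : HasMulTable Q p s)
    (hlt : ∀ a < Q, s.arrays 7 a < Q) :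
    ((checkInverses.run s).regs 10 ≠ 0 ↔ ∀ a < Q, a ≠ 0 → mul Q p a (s.arrays 7 a) = 1) := by
  have key := Prog.run_count_induction (x := 11) (e := .reg 7)
    (p := .ite ((.const 0 <ₑ .reg 11) *ₑ
      (.const 1 -ₑ (.cell 6 (.reg 11 *ₑ .reg 7 +ₑ .cell 7 (.reg 11)) =ₑ .const 1)))
      (.assign 10 (.const 0)) .skip)
    (s := s.setReg 10 1) (fun k s' => s'.regs 7 = Q ∧ s'.arrays = s.arrays ∧
      (s'.regs 10 ≠ 0 ↔ ∀ a < k, a ≠ 0 → mul Q p a (s.arrays 7 a) = 1))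
    ⟨by simp [h], by simp, by simp⟩
    (fun k s' hk h11 ⟨g1, g2, g3⟩ => by
      simp only [eval_reg, regs_setReg, h, Nat.reduceEqDiff, reduceIte] at hk
      have hcell : s'.arrays 6 (k * Q + s'.arrays 7 k) = mul Q p k (s.arrays 7 k) := by
        rw [g2]; exact hmul _ _ hk (hlt k hk)
      rw [run_ite]
      simp only [eval_eq, eval_cell, eval_reg, h11, hcell, eval_const, eval_mul, eval_sub, eval_add,
        eval_lt, g1]
      have hsplit : (∀ a < k + 1, a ≠ 0 → mul Q p a (s.arrays 7 a) = 1) ↔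
          (∀ a < k, a ≠ 0 → mul Q p a (s.arrays 7 a) = 1) ∧
            (k ≠ 0 → mul Q p k (s.arrays 7 k) = 1) := by
        constructor
        · intro h'; exact ⟨fun a ha => h' a (by omega), h' k (by omega)⟩
        · rintro ⟨h1, h2⟩ a ha
          rcases Nat.lt_succ_iff_lt_or_eq.1 ha with ha | rfl
          · exact h1 a ha
          · exact h2
      rw [hsplit]
      by_cases hk0 : k = 0
      · subst hk0; simp [g1, g2, g3]
      · by_cases hc : mul Q p k (s.arrays 7 k) = 1
        · simp [hc, g1, g2, g3]
        · simp [hc, Nat.pos_of_ne_zero hk0, hk0, g1, g2])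
  simp only [eval_reg, regs_setReg, h, Nat.reduceEqDiff, reduceIte] at key
  exact key.2.2

/-- Try the number in register `12` as a modulus. -/
def tryModulus : Prog :=
  .assign 9 (.reg 12) ;; mulTable ;; invTable ;; checkInverses

/-- Find a modulus for the field and make the tables of the field. -/
def fieldTables : Prog :=
  addTable ;; .assign 10 (.const 0) ;;
  .count 12 (.reg 7) (.ite (.reg 10) .skip tryModulus)

/-- The arrays `5`, `6`, `7` hold the tables of a field with `Q` elements. -/
structure HasFieldTables (Q p : ℕ) (s : State) : Prop where
  size : s.regs 7 = Q
  add : HasAddTable Q s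
  mul : HasMulTable Q p s
  inv_lt : ∀ a < Q, s.arrays 7 a < Q
  mul_inv : ∀ a < Q, a ≠ 0 → BinaryField.mul Q p a (s.arrays 7 a) = 1

theorem HasFieldTables.hasInverses {Q p : ℕ} {s : State} (h : HasFieldTables Q p s) :
    HasInverses Q p := fun a ha h0 => ⟨_, h.inv_lt a ha, h.mul_inv a ha h0⟩

theorem tryModulus_spec {s : State} {q p : ℕ} (h : s.regs 7 = 2 ^ q) (hp : p < 2 ^ q)
    (h12 : s.regs 12 = p) (hadd : HasAddTable (2 ^ q) s) :
    let s' := tryModulus.run s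
    s'.regs 7 = 2 ^ q ∧ HasAddTable (2 ^ q) s' ∧
      (s'.regs 10 ≠ 0 → HasFieldTables (2 ^ q) p s') ∧
      (HasInverses (2 ^ q) p → s'.regs 10 ≠ 0) := by
  intro s'
  set s1 := mulTable.run (s.setReg 9 p)
  set s2 := invTable.run s1
  have hs' : s' = checkInverses.run s2 := by simp [s', tryModulus, s2, s1, h12]
  have e1 : s1.regs 7 = 2 ^ q := by
    simp only [s1]; rw [Prog.run_regs _ (by decide)]; simpa using h
  have e2 : s2.regs 7 = 2 ^ q := by simp only [s2]; rw [Prog.run_regs _ (by decide), e1]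
  have m1 : HasMulTable (2 ^ q) p s1 :=
    mulTable_spec (by simpa using h) hp (by simp) (by simpa [HasAddTable] using hadd)
  have m2 : HasMulTable (2 ^ q) p s2 := by
    intro a b ha hb; simp only [s2]; rw [Prog.run_arrays _ (by decide)]; exact m1 a b ha hb
  obtain ⟨i1, i2⟩ := invTable_spec (by positivity) e1 m1
  have hc := checkInverses_spec e2 m2 i1
  have a7 : s'.arrays 7 = s2.arrays 7 := by rw [hs', Prog.run_arrays _ (by decide)]
  have hadd' : HasAddTable (2 ^ q) s' := by
    intro a b ha hb
    rw [hs', Prog.run_arrays _ (by decide), Prog.run_arrays _ (by decide),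
      Prog.run_arrays _ (by decide)]
    simpa using hadd a b ha hb
  have e' : s'.regs 7 = 2 ^ q := by rw [hs', Prog.run_regs _ (by decide), e2]
  rw [← hs'] at hc
  refine ⟨e', hadd', fun h10 => ⟨e', hadd', ?_, ?_, ?_⟩, fun hinv => hc.2 ?_⟩
  · intro a b ha hb; rw [hs', Prog.run_arrays _ (by decide)]; exact m2 a b ha hb
  · rw [a7]; exact i1
  · rw [a7]; exact hc.1 h10
  · intro a ha h0
    exact i2 a ha (hinv a ha h0)

theorem fieldTables_spec {s : State} {q : ℕ} (hq : 0 < q) (h : s.regs 7 = 2 ^ q) :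
    ∃ p < 2 ^ q, HasFieldTables (2 ^ q) p (fieldTables.run s) := by
  set s1 := (addTable.run s).setReg 10 0
  have key := Prog.run_count_induction (x := 12) (e := .reg 7)
    (p := .ite (.reg 10) .skip tryModulus) (s := s1)
    (fun k s' => s'.regs 7 = 2 ^ q ∧ HasAddTable (2 ^ q) s' ∧
      (s'.regs 10 ≠ 0 → ∃ p < 2 ^ q, HasFieldTables (2 ^ q) p s') ∧
      ((∃ p < k, HasInverses (2 ^ q) p) → s'.regs 10 ≠ 0))
  have e1 : s1.regs 7 = 2 ^ q := by
    simp only [s1, regs_setReg, Nat.reduceEqDiff, reduceIte]; rw [Prog.run_regs _ (by decide), h]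
  have ha := addTable_spec h
  obtain ⟨-, -, k3, k4⟩ := key
    ⟨by simp [e1], by simpa [HasAddTable, s1] using ha, by simp [s1], by simp⟩
    (fun k s' hk h12 ⟨g1, g2, g3, g4⟩ => by
      simp only [eval_reg, e1] at hk
      rw [run_ite]
      split_ifs with hc
      · simp only [eval_reg, ne_eq] at hc
        obtain ⟨p, hp, t⟩ := g3 hc
        refine ⟨by simp [g1], by simpa [HasAddTable] using g2, fun _ => ⟨p, hp, ?_⟩, ?_⟩
        · exact ⟨by simpa using t.size, by simpa [HasAddTable] using t.add,
            by simpa [HasMulTable] using t.mul, by simpa using t.inv_lt, by simpa using t.mul_inv⟩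
        · simp [hc]
      · simp only [eval_reg, ne_eq, not_not] at hc
        obtain ⟨f1, f2, f3, f4⟩ := tryModulus_spec g1 hk h12 g2
        refine ⟨by simp [f1], by simpa [HasAddTable] using f2, ?_, ?_⟩
        · intro h10
          have t := f3 (by simpa using h10)
          exact ⟨k, hk, by simpa using t.size, by simpa [HasAddTable] using t.add,
            by simpa [HasMulTable] using t.mul, by simpa using t.inv_lt, by simpa using t.mul_inv⟩
        · rintro ⟨p, hp, hinv⟩
          rcases Nat.lt_succ_iff_lt_or_eq.1 hp with hp | rfl
          · exact absurd hc (g4 ⟨p, hp, hinv⟩)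
          · simpa using f4 hinv)
  have hrun : fieldTables.run s = (Prog.count 12 (.reg 7) (.ite (.reg 10) .skip tryModulus)).run s1 :=
    rfl
  rw [hrun]
  refine k3 (k4 ?_)
  obtain ⟨p, hp, hinv⟩ := exists_hasInverses hq
  exact ⟨p, by simpa [e1] using hp, hinv⟩

end CoinRAM

namespace CoinRAM

open BinaryField

/-- The invariant rule for counting loops, together with what the loop does not write. -/
theorem Prog.run_count_frame {x : ℕ} {e : Expr} {p : Prog} {s : State} (I : ℕ → State → Prop)
    (h0 : I 0 (s.setReg x 0))
    (hs : ∀ k s', k < e.eval s → s'.regs x = k →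
      (∀ y, (count x e p).writesReg y = false → s'.regs y = s.regs y) →
      (∀ a, p.writesArray a = false → s'.arrays a = s.arrays a) →
      I k s' → I (k + 1) ((p.run s').setReg x (k + 1))) :
    I (e.eval s) ((count x e p).run s) := by
  have key := run_count_induction (x := x) (e := e) (p := p) (s := s)
    (fun k s' => (∀ y, (count x e p).writesReg y = false → s'.regs y = s.regs y) ∧
      (∀ a, p.writesArray a = false → s'.arrays a = s.arrays a) ∧ I k s')
    ⟨fun y hy => by
      simp only [writesReg, Bool.or_eq_false_iff, beq_eq_false_iff_ne] at hy
      simp [Ne.symm hy.1], fun a _ => rfl, h0⟩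
    (fun k s' hk hx ⟨hr, ha, hI⟩ => ⟨fun y hy => by
      have hy' := hy
      simp only [writesReg, Bool.or_eq_false_iff, beq_eq_false_iff_ne] at hy'
      simp [Ne.symm hy'.1, run_regs p hy'.2, hr y hy],
      fun a ha' => by simp [run_arrays p ha', ha a ha'], hs k s' hk hx hr ha hI⟩)
  exact key.2.2

/-! ### Random field elements -/

/-- Put a number with `q` random bits into register `17`. -/
def sampleBits : Prog :=
  .assign 17 (.const 0) ;;
  .count 12 (.reg 8) (.flip 13 ;; .assign 17 ((.reg 17 +ₑ .reg 17 +ₑ .reg 13) %ₑ .reg 7))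

theorem sampleBits_spec {s : State} {q : ℕ} (h7 : s.regs 7 = 2 ^ q) (h8 : s.regs 8 = q) :
    (sampleBits.run s).regs 17 = bitsValue s.coins q ∧
      (sampleBits.run s).coins = fun i => s.coins (q + i) := by
  have key := Prog.run_count_frame (x := 12) (e := .reg 8)
    (p := .flip 13 ;; .assign 17 ((.reg 17 +ₑ .reg 17 +ₑ .reg 13) %ₑ .reg 7))
    (s := s.setReg 17 0)
    (fun k s' => s'.regs 17 = bitsValue s.coins k ∧ s'.coins = fun i => s.coins (k + i))
    (by simp [bitsValue]) (fun k s' hk h12 hr ha ⟨g1, g2⟩ => by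
      have r7 : s'.regs 7 = 2 ^ q := by rw [hr 7 (by decide)]; simpa using h7
      simp only [eval_reg, regs_setReg, Nat.reduceEqDiff, reduceIte, h8] at hk
      have hlt := bitsValue_lt s.coins (k + 1)
      have : 2 ^ (k + 1) ≤ 2 ^ q := Nat.pow_le_pow_right (by norm_num) hk
      rw [bitsValue] at hlt
      constructor
      · simp only [run_seq, run_flip, run_assign, regs_setReg, Nat.reduceEqDiff, reduceIte,
          eval_mod, eval_add, eval_reg, regs_flipCoin, g1, g2, r7, add_zero]
        rw [Nat.mod_eq_of_lt (by omega), bitsValue]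
      · funext i
        simp [g2, add_assoc, add_comm 1 i])
  have hrun : sampleBits.run s = (Prog.count 12 (.reg 8) (.flip 13 ;;
    .assign 17 ((.reg 17 +ₑ .reg 17 +ₑ .reg 13) %ₑ .reg 7))).run (s.setReg 17 0) := rfl
  simp only [eval_reg, regs_setReg, Nat.reduceEqDiff, reduceIte, h8] at key
  rw [hrun]
  exact key

/-- Fill array `8` with random field elements. -/
def randomTable : Prog :=
  .count 11 (.reg 6 *ₑ .reg 6 *ₑ .reg 5) (sampleBits ;; .store 8 (.reg 11) (.reg 17))

theorem randomTable_spec {s : State} {q : ℕ} (h7 : s.regs 7 = 2 ^ q) (h8 : s.regs 8 = q) :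
    ∀ i < s.regs 6 * s.regs 6 * s.regs 5, (randomTable.run s).arrays 8 i = sample q s.coins i := by
  have key := Prog.run_count_frame (x := 11) (e := .reg 6 *ₑ .reg 6 *ₑ .reg 5)
    (p := sampleBits ;; .store 8 (.reg 11) (.reg 17)) (s := s)
    (fun k s' => (s'.coins = fun i => s.coins (k * q + i)) ∧
      ∀ i < k, s'.arrays 8 i = sample q s.coins i)
    (by simp) (fun k s' hk h11 hr ha ⟨g1, g2⟩ => by
      obtain ⟨b1, b2⟩ := sampleBits_spec (s := s') (by rw [hr 7 (by decide), h7])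
        (by rw [hr 8 (by decide), h8])
      have r11 : (sampleBits.run s').regs 11 = k := by rw [Prog.run_regs _ (by decide), h11]
      have a8 : (sampleBits.run s').arrays 8 = s'.arrays 8 := Prog.run_arrays _ (by decide) _
      constructor
      · simp only [run_seq, run_store, coins_setReg, coins_setCell, b2, g1]
        funext i
        congr 1
        ring
      · intro i hi
        simp only [run_seq, run_store, arrays_setReg, arrays_setCell, true_and, eval_reg, r11, b1,
          a8, g1]
        split_ifs with hik
        · rw [hik]; rfl
        · exact g2 i (by omega))
  exact key.2

/-! ### Sets as bit masks -/

/-- The set of the positions below `m` at which the binary digit of `X` is one. -/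
def maskSet (m X : ℕ) : Finset (Fin m) := Finset.univ.filter fun i => X.testBit i

theorem mem_maskSet {m X : ℕ} {i : Fin m} : i ∈ maskSet m X ↔ X.testBit i := by simp [maskSet]

theorem maskSet_mod (m X : ℕ) : maskSet m (X % 2 ^ m) = maskSet m X := by
  ext i
  simp [mem_maskSet, Nat.testBit_mod_two_pow]

theorem maskSet_bijective (m : ℕ) :
    Function.Bijective fun X : Fin (2 ^ m) => maskSet m X := by
  rw [Fintype.bijective_iff_injective_and_card]
  refine ⟨fun X Y h => Fin.ext (Nat.eq_of_testBit_eq fun i => ?_), by simp⟩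
  by_cases hi : i < m
  · have := congrArg (fun S => (⟨i, hi⟩ : Fin m) ∈ S) h
    simpa [mem_maskSet] using this
  · have h2 : 2 ^ m ≤ 2 ^ i := Nat.pow_le_pow_right (by norm_num) (by omega)
    rw [Nat.testBit_lt_two_pow (X.2.trans_le h2), Nat.testBit_lt_two_pow (Y.2.trans_le h2)]

/-- The number whose binary digits describe a set. -/
noncomputable def maskCode {m : ℕ} (X : Finset (Fin m)) : ℕ :=
  ((Equiv.ofBijective _ (maskSet_bijective m)).symm X).val

theorem maskCode_lt {m : ℕ} (X : Finset (Fin m)) : maskCode X < 2 ^ m := Fin.is_lt _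

theorem maskSet_maskCode {m : ℕ} (X : Finset (Fin m)) : maskSet m (maskCode X) = X :=
  (Equiv.ofBijective _ (maskSet_bijective m)).apply_symm_apply X

theorem maskCode_maskSet {m X : ℕ} (h : X < 2 ^ m) : maskCode (maskSet m X) = X :=
  congrArg Fin.val ((Equiv.ofBijective _ (maskSet_bijective m)).symm_apply_apply ⟨X, h⟩)

theorem div_two_pow_mod_two (X i : ℕ) : X / 2 ^ i % 2 = if X.testBit i then 1 else 0 := by
  rw [Nat.testBit_eq_decide_div_mod_eq]
  have := Nat.mod_two_eq_zero_or_one (X / 2 ^ i)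
  rcases this with h | h <;> simp [h]

/-! ### The admissible labels -/

/-- Whether the position in the expression `i` belongs to the label set in register `14`, together
with the two vertices in the registers `15` and `16`. -/
def inLabel (i : Expr) : Expr :=
  .reg 14 /ₑ .cell 4 i %ₑ .const 2 *ₑ (i <ₑ .reg 3) +ₑ (i =ₑ .reg 3 +ₑ .reg 15) +ₑ
    (i =ₑ .reg 3 +ₑ .reg 16)

/-- Put into register `17` whether the label set is independent. -/
def checkLabel : Prog :=
  .assign 17 (.const 1) ;;
  .count 12 (.reg 0 *ₑ .reg 0) (.ite
    (inLabel (.reg 12 /ₑ .reg 0) *ₑ inLabel (.reg 12 %ₑ .reg 0) *ₑ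
      .cell 0 (.cell 2 (.reg 12 /ₑ .reg 0) *ₑ .reg 0 +ₑ .cell 2 (.reg 12 %ₑ .reg 0)))
    (.assign 17 (.const 0)) .skip)

/-- The input of the sieve: a graph whose vertices are listed. -/
structure SieveInput {n : ℕ} (G : SimpleGraph (Fin n)) (m : ℕ) (s : State) : Prop where
  size : s.regs 0 = n
  labels : s.regs 3 = m
  pow : ∀ i < m, s.arrays 4 i = 2 ^ i
  adj : ∀ i j : Fin n, s.arrays 0 (s.arrays 2 i * n + s.arrays 2 j) ≠ 0 ↔ G.Adj i j

theorem SieveInput.congr {n m : ℕ} {G : SimpleGraph (Fin n)} {s s' : State}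
    (h : SieveInput G m s) (h0 : s'.regs 0 = s.regs 0) (h3 : s'.regs 3 = s.regs 3)
    (a0 : s'.arrays 0 = s.arrays 0) (a2 : s'.arrays 2 = s.arrays 2)
    (a4 : s'.arrays 4 = s.arrays 4) : SieveInput G m s' :=
  ⟨by rw [h0, h.size], by rw [h3, h.labels], by rw [a4]; exact h.pow,
    by rw [a0, a2]; exact h.adj⟩

/-- Membership in a label set together with two vertices. -/
def InLabel (m a b X i : ℕ) : Prop := (i < m ∧ X.testBit i) ∨ i = m + a ∨ i = m + b

theorem inLabel_eval {n m : ℕ} {G : SimpleGraph (Fin n)} {s : State} (h : SieveInput G m s)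
    (e : Expr) : (inLabel e).eval s ≠ 0 ↔
      InLabel m (s.regs 15) (s.regs 16) (s.regs 14) (e.eval s) := by
  simp only [inLabel, eval_add, eval_mul, eval_mod, eval_div, eval_reg, eval_cell, eval_lt, eval_eq,
    eval_const, h.labels, InLabel]
  by_cases hi : e.eval s < m
  · have h1 : e.eval s ≠ m + s.regs 15 := by omega
    have h2 : e.eval s ≠ m + s.regs 16 := by omega
    simp [hi, h1, h2, h.pow _ hi, div_two_pow_mod_two]
  · simp only [hi, reduceIte, mul_zero, zero_add, false_and, false_or]
    by_cases h1 : e.eval s = m + s.regs 15 <;> by_cases h2 : e.eval s = m + s.regs 16 <;>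
      simp [h1, h2]

theorem checkLabel_spec {n m : ℕ} {G : SimpleGraph (Fin n)} {s : State} (h : SieveInput G m s) :
    (checkLabel.run s).regs 17 ≠ 0 ↔ ∀ i j : Fin n,
      InLabel m (s.regs 15) (s.regs 16) (s.regs 14) i →
      InLabel m (s.regs 15) (s.regs 16) (s.regs 14) j → ¬ G.Adj i j := by
  have key := Prog.run_count_frame (x := 12) (e := .reg 0 *ₑ .reg 0) (s := s.setReg 17 1)
    (p := .ite (inLabel (.reg 12 /ₑ .reg 0) *ₑ inLabel (.reg 12 %ₑ .reg 0) *ₑ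
      .cell 0 (.cell 2 (.reg 12 /ₑ .reg 0) *ₑ .reg 0 +ₑ .cell 2 (.reg 12 %ₑ .reg 0)))
      (.assign 17 (.const 0)) .skip)
    (fun k s' => s'.regs 17 ≠ 0 ↔ ∀ i j : Fin n, i.val * n + j.val < k →
      InLabel m (s.regs 15) (s.regs 16) (s.regs 14) i →
      InLabel m (s.regs 15) (s.regs 16) (s.regs 14) j → ¬ G.Adj i j)
    (by simp) (fun k s' hk h12 hr ha g => by
      simp only [eval_mul, eval_reg, regs_setReg, Nat.reduceEqDiff, reduceIte, h.size] at hk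
      have hn : 0 < n := Nat.pos_of_ne_zero (by rintro rfl; simp at hk)
      have hs : SieveInput G m s' := h.congr (by rw [hr 0 (by decide)]; simp)
        (by rw [hr 3 (by decide)]; simp) (by rw [ha 0 (by decide)]; simp)
        (by rw [ha 2 (by decide)]; simp) (by rw [ha 4 (by decide)]; simp)
      have r14 : s'.regs 14 = s.regs 14 := by rw [hr 14 (by decide)]; simp
      have r15 : s'.regs 15 = s.regs 15 := by rw [hr 15 (by decide)]; simp
      have r16 : s'.regs 16 = s.regs 16 := by rw [hr 16 (by decide)]; simp
      let u : Fin n := ⟨k / n, by rwa [Nat.div_lt_iff_lt_mul hn]⟩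
      let v : Fin n := ⟨k % n, Nat.mod_lt _ hn⟩
      have huv : u.val * n + v.val = k := Nat.div_add_mod' k n
      have hsplit : (∀ i j : Fin n, i.val * n + j.val < k + 1 →
          InLabel m (s.regs 15) (s.regs 16) (s.regs 14) i →
          InLabel m (s.regs 15) (s.regs 16) (s.regs 14) j → ¬ G.Adj i j) ↔
          (∀ i j : Fin n, i.val * n + j.val < k →
          InLabel m (s.regs 15) (s.regs 16) (s.regs 14) i →
          InLabel m (s.regs 15) (s.regs 16) (s.regs 14) j → ¬ G.Adj i j) ∧
          (InLabel m (s.regs 15) (s.regs 16) (s.regs 14) u →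
          InLabel m (s.regs 15) (s.regs 16) (s.regs 14) v → ¬ G.Adj u v) := by
        constructor
        · intro h'; exact ⟨fun i j hij => h' i j (by omega), h' u v (by omega)⟩
        · rintro ⟨h1, h2⟩ i j hij
          rcases Nat.lt_succ_iff_lt_or_eq.1 hij with hij | hij
          · exact h1 i j hij
          · have hi : i = u := Fin.ext (by simp only [u]; rw [← hij, mul_add_div_of_lt j.2])
            have hj : j = v := Fin.ext (by simp only [v]; rw [← hij, mul_add_mod_of_lt j.2])
            rw [hi, hj]; exact h2
      have hcond : (inLabel (.reg 12 /ₑ .reg 0) *ₑ inLabel (.reg 12 %ₑ .reg 0) *ₑ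
          .cell 0 (.cell 2 (.reg 12 /ₑ .reg 0) *ₑ .reg 0 +ₑ .cell 2 (.reg 12 %ₑ .reg 0))).eval s' ≠ 0
          ↔ (InLabel m (s.regs 15) (s.regs 16) (s.regs 14) u ∧
          InLabel m (s.regs 15) (s.regs 16) (s.regs 14) v) ∧ G.Adj u v := by
        rw [eval_mul, eval_mul, mul_ne_zero_iff, mul_ne_zero_iff, inLabel_eval hs, inLabel_eval hs]
        simp only [eval_div, eval_mod, eval_reg, eval_cell, eval_add, eval_mul, h12, hs.size, r14,
          r15, r16]
        rw [← hs.adj]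
      rw [hsplit, run_ite]
      simp only [hcond, regs_setReg, Nat.reduceEqDiff, reduceIte]
      split_ifs with hc
      · simp only [run_assign, regs_setReg, reduceIte, eval_const, ne_eq, not_true_eq_false,
          false_iff]
        tauto
      · rw [run_skip, g]
        tauto)
  have hrun : checkLabel.run s = (Prog.count 12 (.reg 0 *ₑ .reg 0) (.ite
    (inLabel (.reg 12 /ₑ .reg 0) *ₑ inLabel (.reg 12 %ₑ .reg 0) *ₑ
      .cell 0 (.cell 2 (.reg 12 /ₑ .reg 0) *ₑ .reg 0 +ₑ .cell 2 (.reg 12 %ₑ .reg 0)))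
    (.assign 17 (.const 0)) .skip)).run (s.setReg 17 1) := rfl
  rw [← hrun] at key
  rw [key]
  refine forall_congr' fun i => forall_congr' fun j => ?_
  have : i.val * n + j.val < n * n := by nlinarith [i.2, j.2]
  simp [h.size, this]

/-- Put into array `9` the random elements of the admissible labels. -/
def labelTable : Prog :=
  .count 11 (.reg 6 *ₑ .reg 6 *ₑ .reg 5) (
    .assign 14 (.reg 11 %ₑ .reg 5) ;;
    .assign 15 (.reg 11 /ₑ .reg 5 /ₑ .reg 6) ;;
    .assign 16 (.reg 11 /ₑ .reg 5 %ₑ .reg 6) ;;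
    checkLabel ;;
    .ite (.reg 17 *ₑ (.reg 15 <ₑ .reg 16)) (.store 9 (.reg 11) (.cell 8 (.reg 11)))
      (.store 9 (.reg 11) (.const 0)))

open Classical in
theorem labelTable_spec {n m N : ℕ} {G : SimpleGraph (Fin n)} {s : State} (h : SieveInput G m s)
    (h5 : s.regs 5 = 2 ^ m) (h6 : s.regs 6 = N) (a b : Fin N) (X : ℕ) (hX : X < 2 ^ m) :
    (labelTable.run s).arrays 9 ((a * N + b) * 2 ^ m + X) =
      if a < b ∧ G.IsIndepLabel m a b (maskSet m X) then
        s.arrays 8 ((a * N + b) * 2 ^ m + X) else 0 := by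
  have key := Prog.run_count_frame (x := 11) (e := .reg 6 *ₑ .reg 6 *ₑ .reg 5) (s := s)
    (p := .assign 14 (.reg 11 %ₑ .reg 5) ;;
      .assign 15 (.reg 11 /ₑ .reg 5 /ₑ .reg 6) ;;
      .assign 16 (.reg 11 /ₑ .reg 5 %ₑ .reg 6) ;;
      checkLabel ;;
      .ite (.reg 17 *ₑ (.reg 15 <ₑ .reg 16)) (.store 9 (.reg 11) (.cell 8 (.reg 11)))
        (.store 9 (.reg 11) (.const 0)))
    (fun k s' => ∀ (a b : Fin N) (X : ℕ), X < 2 ^ m → (a * N + b) * 2 ^ m + X < k →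
      s'.arrays 9 ((a * N + b) * 2 ^ m + X) =
      if a < b ∧ G.IsIndepLabel m a b (maskSet m X) then
        s.arrays 8 ((a * N + b) * 2 ^ m + X) else 0)
    (by simp) (fun k s' hk h11 hr ha g a b X hX hlt => by
      set s1 := ((s'.setReg 14 (k % 2 ^ m)).setReg 15 (k / 2 ^ m / N)).setReg 16 (k / 2 ^ m % N)
        with hs1
      have e5 : s'.regs 5 = 2 ^ m := by rw [hr 5 (by decide), h5]
      have e6 : s'.regs 6 = N := by rw [hr 6 (by decide), h6]
      have i1 : SieveInput G m s1 := h.congr (by simp [hs1]; rw [hr 0 (by decide)])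
        (by simp [hs1]; rw [hr 3 (by decide)]) (by simp [hs1]; rw [ha 0 (by decide)])
        (by simp [hs1]; rw [ha 2 (by decide)]) (by simp [hs1]; rw [ha 4 (by decide)])
      have hc := checkLabel_spec i1
      set s2 := checkLabel.run s1 with hs2
      have b11 : s2.regs 11 = k := by rw [hs2, Prog.run_regs _ (by decide)]; simp [hs1, h11]
      have b15 : s2.regs 15 = k / 2 ^ m / N := by
        rw [hs2, Prog.run_regs _ (by decide)]; simp [hs1]
      have b16 : s2.regs 16 = k / 2 ^ m % N := by
        rw [hs2, Prog.run_regs _ (by decide)]; simp [hs1]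
      have b8 : s2.arrays 8 = s.arrays 8 := by
        rw [hs2, Prog.run_arrays _ (by decide)]; simp [hs1, ha 8 (by decide)]
      have b9 : s2.arrays 9 = s'.arrays 9 := by
        rw [hs2, Prog.run_arrays _ (by decide)]; simp [hs1]
      have hrun : (Prog.assign 14 (.reg 11 %ₑ .reg 5) ;;
          .assign 15 (.reg 11 /ₑ .reg 5 /ₑ .reg 6) ;;
          .assign 16 (.reg 11 /ₑ .reg 5 %ₑ .reg 6) ;;
          checkLabel ;;
          .ite (.reg 17 *ₑ (.reg 15 <ₑ .reg 16)) (.store 9 (.reg 11) (.cell 8 (.reg 11)))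
            (.store 9 (.reg 11) (.const 0))).run s' =
          s2.setCell 9 k (if s2.regs 17 ≠ 0 ∧ k / 2 ^ m / N < k / 2 ^ m % N then s.arrays 8 k
            else 0) := by
        have t1 : ∀ s0 : State, s0.regs 11 = k → s0.regs 5 = 2 ^ m → s0.regs 6 = N →
            (Prog.assign 14 (.reg 11 %ₑ .reg 5) ;;
              .assign 15 (.reg 11 /ₑ .reg 5 /ₑ .reg 6) ;;
              .assign 16 (.reg 11 /ₑ .reg 5 %ₑ .reg 6)).run s0 =
              ((s0.setReg 14 (k % 2 ^ m)).setReg 15 (k / 2 ^ m / N)).setReg 16 (k / 2 ^ m % N) := by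
          intro s0 q1 q2 q3
          simp [q1, q2, q3]
        have t2 := t1 s' h11 e5 e6
        simp only [run_seq] at t2 ⊢
        rw [t2, ← hs1, ← hs2, run_ite]
        simp only [eval_mul, eval_reg, eval_lt, b15, b16, mul_ne_zero_iff, ite_ne_right_iff]
        by_cases c1 : s2.regs 17 ≠ 0 <;> by_cases c2 : k / 2 ^ m / N < k / 2 ^ m % N <;>
          simp [c1, c2, b11, b8]
      rw [hrun]
      simp only [arrays_setReg, arrays_setCell, true_and, b9]
      by_cases hik : (a.val * N + b.val) * 2 ^ m + X = k
      · rw [if_pos hik, hik]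
        have d1 : k / 2 ^ m = a * N + b := by rw [← hik, mul_add_div_of_lt hX]
        have d2 : k % 2 ^ m = X := by rw [← hik, mul_add_mod_of_lt hX]
        have d3 : k / 2 ^ m / N = a := by rw [d1, mul_add_div_of_lt b.2]
        have d4 : k / 2 ^ m % N = b := by rw [d1, mul_add_mod_of_lt b.2]
        refine if_congr ?_ rfl rfl
        rw [hc, d3, d4, and_comm, Fin.lt_def]
        refine and_congr_right fun _ => ?_
        simp only [hs1, regs_setReg, Nat.reduceEqDiff, reduceIte, d2, d3, d4]
        simp only [InLabel, SimpleGraph.IsIndepLabel, mem_maskSet, exists_prop]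
      · rw [if_neg hik]
        exact g a b X hX (by omega))
  refine key a b X hX ?_
  simp only [eval_mul, eval_reg, h5, h6]
  have h1 : a.val * N + b < N * N := by nlinarith [a.2, b.2]
  nlinarith

end CoinRAM

namespace CoinRAM

open BinaryField

/-! ### Sums over subsets -/

/-- The sum over the subsets of `Y` that contain all its elements from `k` on. -/
def partialSum {m : ℕ} {F : Type*} [AddCommMonoid F] (k : ℕ) (g : Finset (Fin m) → F)
    (Y : Finset (Fin m)) : F :=
  ∑ X ∈ Y.powerset with ∀ i ∈ Y, k ≤ i.val → i ∈ X, g X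

section

variable {m : ℕ} {F : Type*} [AddCommMonoid F] (g : Finset (Fin m) → F) (Y : Finset (Fin m))

theorem partialSum_zero : partialSum 0 g Y = g Y := by
  have : (Y.powerset.filter fun X => ∀ i ∈ Y, 0 ≤ i.val → i ∈ X) = {Y} := by
    ext X
    simp only [Finset.mem_filter, Finset.mem_powerset, Finset.mem_singleton, Nat.zero_le,
      forall_const]
    exact ⟨fun h => h.1.antisymm h.2, by rintro rfl; simp⟩
  rw [partialSum, this, Finset.sum_singleton]

theorem partialSum_self : partialSum m g Y = ∑ X ∈ Y.powerset, g X := by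
  rw [partialSum, Finset.filter_true_of_mem]
  intro X _ i _ hi
  exact absurd i.2 (by omega)

theorem partialSum_succ {k : ℕ} (hk : k < m) : partialSum (k + 1) g Y =
    partialSum k g Y + if ⟨k, hk⟩ ∈ Y then partialSum k g (Y.erase ⟨k, hk⟩) else 0 := by
  have hle : ∀ i : Fin m, k ≤ i.val ↔ i = ⟨k, hk⟩ ∨ k + 1 ≤ i.val := by
    intro i; rw [Fin.ext_iff]; simp only; omega
  split_ifs with hY
  · rw [partialSum, ← Finset.sum_filter_add_sum_filter_not _ (fun X => (⟨k, hk⟩ : Fin m) ∈ X),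
      Finset.filter_filter, Finset.filter_filter, partialSum, partialSum]
    congr 1
    · refine Finset.sum_congr (Finset.filter_congr fun X hX => ?_) fun _ _ => rfl
      constructor
      · rintro ⟨h1, h2⟩ i hi hki
        rcases (hle i).1 hki with rfl | h
        · exact h2
        · exact h1 i hi h
      · exact fun h => ⟨fun i hi hki => h i hi (by omega), h _ hY le_rfl⟩
    · refine Finset.sum_congr ?_ fun _ _ => rfl
      ext X
      simp only [Finset.mem_filter, Finset.mem_powerset, Finset.subset_erase, Finset.mem_erase]
      constructor
      · rintro ⟨h1, h2, h3⟩
        refine ⟨⟨h1, h3⟩, fun i hi hki => ?_⟩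
        rcases (hle i).1 hki with h | h
        · exact absurd h hi.1
        · exact h2 i hi.2 h
      · rintro ⟨⟨h1, h3⟩, h2⟩
        refine ⟨h1, fun i hi hki => h2 i ⟨?_, hi⟩ (by omega), h3⟩
        rintro rfl
        simp at hki
  · rw [add_zero, partialSum, partialSum]
    refine Finset.sum_congr (Finset.filter_congr fun X hX => ?_) fun _ _ => rfl
    refine forall_congr' fun i => forall_congr' fun hi => ?_
    rw [hle]
    have : i ≠ ⟨k, hk⟩ := by rintro rfl; exact hY hi
    simp [this]

end

/-- One round of the computation of the sums over subsets in array `9`. -/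
def zetaRound : Prog :=
  .count 11 (.reg 6 *ₑ .reg 6 *ₑ .reg 5) (.store 9 (.reg 11)
    (.cell 5 (.cell 9 (.reg 11) *ₑ .reg 7 +ₑ .cell 9 (.reg 11 -ₑ .cell 4 (.reg 12)) *ₑ
      (.reg 11 /ₑ .cell 4 (.reg 12) %ₑ .const 2))))

/-- Replace the entries of array `9` by sums over subsets. -/
def zetaTable : Prog := .count 12 (.reg 3) zetaRound

theorem testBit_sub_two_pow_self {x i : ℕ} (h : x.testBit i) : (x - 2 ^ i).testBit i = false := by
  have h1 := div_two_pow_mod_two x i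
  have h2 := div_two_pow_mod_two (x - 2 ^ i) i
  have h3 := Nat.sub_mul_div x (2 ^ i) 1
  rw [mul_one] at h3
  rw [h3] at h2
  rw [if_pos h] at h1
  by_contra hc
  rw [if_pos (by simpa using hc)] at h2
  omega

theorem two_pow_le_of_testBit {x i : ℕ} (h : x.testBit i) : 2 ^ i ≤ x := by
  by_contra hc
  rw [Nat.testBit_lt_two_pow (by omega)] at h
  simp at h

theorem zetaRound_spec {s : State} {m N q k : ℕ} (h5 : s.regs 5 = 2 ^ m) (h6 : s.regs 6 = N)
    (h7 : s.regs 7 = 2 ^ q) (hadd : HasAddTable (2 ^ q) s) (h12 : s.regs 12 = k)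
    (h4 : s.arrays 4 k = 2 ^ k) (hlt : ∀ i < N * N * 2 ^ m, s.arrays 9 i < 2 ^ q) :
    ∀ i < N * N * 2 ^ m, (zetaRound.run s).arrays 9 i =
      s.arrays 9 i ^^^ (if i.testBit k then s.arrays 9 (i - 2 ^ k) else 0) := by
  have hrun : zetaRound.run s = _ := Prog.run_fill (x := 11) (a := 9)
    (e := .reg 6 *ₑ .reg 6 *ₑ .reg 5) (s := s) (g := _)
    (fun i => s.arrays 9 i ^^^ (if i.testBit k then s.arrays 9 (i - 2 ^ k) else 0))
    (fun i hi => by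
      simp only [eval_mul, eval_reg, h5, h6] at hi
      simp only [eval_mod, eval_add, eval_mul, eval_const, eval_cell, eval_div, eval_reg, eval_sub,
        Function.update_apply, reduceIte, Nat.reduceEqDiff, h7, h12, h4, div_two_pow_mod_two,
        lt_irrefl]
      by_cases hb : i.testBit k
      · have h1 := two_pow_le_of_testBit hb
        have h2 : 0 < 2 ^ k := by positivity
        have h3 : i - 2 ^ k < i := by omega
        rw [if_pos hb, if_pos hb, if_pos h3, testBit_sub_two_pow_self hb, mul_one]
        simp only [Bool.false_eq_true, reduceIte, Nat.xor_zero]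
        exact hadd _ _ (hlt _ hi) (hlt _ (h3.trans hi))
      · rw [if_neg hb, if_neg hb, mul_zero]
        exact hadd _ _ (hlt _ hi) (by positivity))
  intro i hi
  rw [hrun]
  simp [h5, h6, hi]

theorem sub_two_pow_div {m x k : ℕ} (hk : k < m) (h : x.testBit k) :
    (x - 2 ^ k) / 2 ^ m = x / 2 ^ m := by
  have h1 := two_pow_le_of_testBit h
  have h2 : (x % 2 ^ m).testBit k := by simp [Nat.testBit_mod_two_pow, hk, h]
  have h3 := two_pow_le_of_testBit h2
  have h4 := Nat.div_add_mod x (2 ^ m)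
  have h5 := Nat.mod_lt x (show 0 < 2 ^ m by positivity)
  have : x - 2 ^ k = 2 ^ m * (x / 2 ^ m) + (x % 2 ^ m - 2 ^ k) := by
    rw [← Nat.add_sub_assoc h3, h4]
  rw [this, Nat.mul_add_div (by positivity),
    Nat.div_eq_of_lt ((Nat.sub_le _ _).trans_lt h5), add_zero]

theorem maskSet_sub_two_pow {m x k : ℕ} (hk : k < m) (h : x.testBit k) :
    maskSet m (x - 2 ^ k) = (maskSet m x).erase ⟨k, hk⟩ := by
  have h1 := two_pow_le_of_testBit h
  ext i
  simp only [mem_maskSet, Finset.mem_erase, ne_eq, Fin.ext_iff]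
  by_cases hik : i.val = k
  · simp [hik, testBit_sub_two_pow_self h]
  · simp only [hik, not_false_eq_true, true_and]
    rcases Nat.lt_or_gt_of_ne hik with hlt | hgt
    · have h2 := Nat.testBit_two_pow_add_gt hlt (x - 2 ^ k)
      rw [Nat.add_sub_cancel' h1] at h2
      rw [h2]
    · rw [Nat.testBit_eq_decide_div_mod_eq, Nat.testBit_eq_decide_div_mod_eq,
        sub_two_pow_div hgt h]

theorem zetaTable_spec {s : State} {m N q p : ℕ} {F : Type} [Field F] (φ : Model (2 ^ q) p F)
    (h3 : s.regs 3 = m) (h5 : s.regs 5 = 2 ^ m) (h6 : s.regs 6 = N)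
    (h7 : s.regs 7 = 2 ^ q) (hadd : HasAddTable (2 ^ q) s)
    (h4 : ∀ i < m, s.arrays 4 i = 2 ^ i) (hlt : ∀ i < N * N * 2 ^ m, s.arrays 9 i < 2 ^ q)
    (g : ℕ → Finset (Fin m) → F)
    (hg : ∀ i < N * N * 2 ^ m, φ.toFun (s.arrays 9 i) = g (i / 2 ^ m) (maskSet m i)) :
    ∀ i < N * N * 2 ^ m, (zetaTable.run s).arrays 9 i < 2 ^ q ∧
      φ.toFun ((zetaTable.run s).arrays 9 i) =
        ∑ X ∈ (maskSet m i).powerset, g (i / 2 ^ m) X := by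
  have key := Prog.run_count_frame (x := 12) (e := .reg 3) (p := zetaRound) (s := s)
    (fun k s' => ∀ i < N * N * 2 ^ m, s'.arrays 9 i < 2 ^ q ∧
      φ.toFun (s'.arrays 9 i) = partialSum k (g (i / 2 ^ m)) (maskSet m i))
    (fun i hi => ⟨by simpa using hlt i hi, by simpa [partialSum_zero] using hg i hi⟩)
    (fun k s' hk h12 hr ha h => by
      simp only [eval_reg, h3] at hk
      have hz := zetaRound_spec (s := s') (m := m) (N := N) (q := q) (k := k)
        (by rw [hr 5 (by decide), h5]) (by rw [hr 6 (by decide), h6])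
        (by rw [hr 7 (by decide), h7])
        (by intro a b ha' hb; rw [ha 5 (by decide)]; exact hadd a b ha' hb) h12
        (by rw [ha 4 (by decide), h4 k hk]) (fun i hi => (h i hi).1)
      intro i hi
      have hi' : i - 2 ^ k < N * N * 2 ^ m := (Nat.sub_le _ _).trans_lt hi
      simp only [arrays_setReg]
      rw [hz i hi, partialSum_succ _ _ hk]
      simp only [mem_maskSet]
      by_cases hb : i.testBit k
      · rw [if_pos hb, if_pos hb, φ.map_xor, (h i hi).2, (h _ hi').2, sub_two_pow_div hk hb,
          maskSet_sub_two_pow hk hb]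
        exact ⟨Nat.xor_lt_two_pow (h i hi).1 (h _ hi').1, rfl⟩
      · rw [if_neg hb, if_neg hb, Nat.xor_zero, add_zero]
        exact h i hi)
  simp only [eval_reg, h3, partialSum_self] at key
  exact key

end CoinRAM

namespace CoinRAM

open BinaryField

/-! ### Determinants -/

/-- Add a multiple of a row of the matrix in array `10` to a row; the registers `20`, `21`, `22` hold
the factor, the row that is changed and the row that is added. -/
def rowAdd : Prog :=
  .count 13 (.reg 6) (.store 10 (.reg 21 *ₑ .reg 6 +ₑ .reg 13)
    (.cell 5 (.cell 10 (.reg 21 *ₑ .reg 6 +ₑ .reg 13) *ₑ .reg 7 +ₑ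
      .cell 6 (.reg 20 *ₑ .reg 7 +ₑ .cell 10 (.reg 22 *ₑ .reg 6 +ₑ .reg 13)))))

section

variable {N q p : ℕ} {F : Type} [Field F]

/-- The parameters of the elimination: the tables of the field and the size of the matrix. -/
structure ElimParams (N q p : ℕ) (s : State) : Prop where
  tables : HasFieldTables (2 ^ q) p s
  dim : s.regs 6 = N

theorem HasFieldTables.congr {Q : ℕ} {s s' : State} (h : HasFieldTables Q p s)
    (h7 : s'.regs 7 = s.regs 7) (a5 : s'.arrays 5 = s.arrays 5) (a6 : s'.arrays 6 = s.arrays 6)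
    (a7 : s'.arrays 7 = s.arrays 7) : HasFieldTables Q p s' :=
  ⟨by rw [h7, h.size], by intro a b; rw [a5]; exact h.add a b,
    by intro a b; rw [a6]; exact h.mul a b, by rw [a7]; exact h.inv_lt, by rw [a7]; exact h.mul_inv⟩

theorem ElimParams.congr {s s' : State} (h : ElimParams N q p s)
    (h6 : s'.regs 6 = s.regs 6) (h7 : s'.regs 7 = s.regs 7) (a5 : s'.arrays 5 = s.arrays 5)
    (a6 : s'.arrays 6 = s.arrays 6) (a7 : s'.arrays 7 = s.arrays 7) : ElimParams N q p s' :=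
  ⟨h.tables.congr h7 a5 a6 a7, by rw [h6, h.dim]⟩

/-- Array `10` holds the matrix `A`. -/
def HoldsMatrix (φ : Model (2 ^ q) p F) (s : State) (A : Matrix (Fin N) (Fin N) F) : Prop :=
  ∀ a b : Fin N, s.arrays 10 (a * N + b) < 2 ^ q ∧ φ.toFun (s.arrays 10 (a * N + b)) = A a b

theorem HoldsMatrix.congr {φ : Model (2 ^ q) p F} {s s' : State} {A : Matrix (Fin N) (Fin N) F}
    (h : HoldsMatrix φ s A) (h' : s'.arrays 10 = s.arrays 10) : HoldsMatrix φ s' A := by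
  intro a b; rw [h']; exact h a b

theorem mul_add_inj {a a' b b' : ℕ} (hb : b < N) (hb' : b' < N) :
    a * N + b = a' * N + b' ↔ a = a' ∧ b = b' := by
  constructor
  · intro h
    have h1 := mul_add_div_of_lt (a := a) hb
    have h2 := mul_add_mod_of_lt (a := a) hb
    rw [h] at h1 h2
    rw [mul_add_div_of_lt hb'] at h1
    rw [mul_add_mod_of_lt hb'] at h2
    exact ⟨h1.symm, h2.symm⟩
  · rintro ⟨rfl, rfl⟩; rfl

theorem rowAdd_spec (hp : p < 2 ^ q) (φ : Model (2 ^ q) p F) {s : State} (h : ElimParams N q p s)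
    {A : Matrix (Fin N) (Fin N) F} (hA : HoldsMatrix φ s A) {d r : Fin N} {f : ℕ} (hf : f < 2 ^ q)
    (h20 : s.regs 20 = f) (h21 : s.regs 21 = d) (h22 : s.regs 22 = r) :
    HoldsMatrix φ (rowAdd.run s) (A.updateRow d (A d + φ.toFun f • A r)) := by
  have key := Prog.run_count_frame (x := 13) (e := .reg 6) (s := s)
    (p := .store 10 (.reg 21 *ₑ .reg 6 +ₑ .reg 13)
      (.cell 5 (.cell 10 (.reg 21 *ₑ .reg 6 +ₑ .reg 13) *ₑ .reg 7 +ₑ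
        .cell 6 (.reg 20 *ₑ .reg 7 +ₑ .cell 10 (.reg 22 *ₑ .reg 6 +ₑ .reg 13)))))
    (fun k s' => HoldsMatrix φ s' fun a b =>
      if a = d ∧ b.val < k then A a b + φ.toFun f * A r b else A a b)
    (by intro a b; simpa using hA a b) (fun k s' hk h13 hr ha g => by
      simp only [eval_reg, h.dim] at hk
      have h' : ElimParams N q p s' := h.congr (hr 6 (by decide)) (hr 7 (by decide))
        (ha 5 (by decide)) (ha 6 (by decide)) (ha 7 (by decide))
      have r20 : s'.regs 20 = f := by rw [hr 20 (by decide), h20]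
      have r21 : s'.regs 21 = d := by rw [hr 21 (by decide), h21]
      have r22 : s'.regs 22 = r := by rw [hr 22 (by decide), h22]
      have gd := g d ⟨k, hk⟩
      have gr := g r ⟨k, hk⟩
      simp only [lt_irrefl, and_false, reduceIte] at gd gr
      have hmul := mul_lt hp hf (s'.arrays 10 (r * N + k))
      intro a b
      simp only [run_store, eval_add, eval_mul, eval_reg, eval_cell, arrays_setReg, arrays_setCell,
        true_and, h13, r20, r21, r22, h'.dim, h'.tables.size]
      rw [h'.tables.mul _ _ hf gr.1, h'.tables.add _ _ gd.1 hmul]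
      simp only [mul_add_inj b.2 hk, ← Fin.ext_iff]
      by_cases hc : a = d ∧ b.val = k
      · obtain ⟨rfl, hb⟩ := hc
        have hb' : b = ⟨k, hk⟩ := Fin.ext hb
        subst hb'
        simp only [true_and, reduceIte, lt_add_iff_pos_right, zero_lt_one]
        exact ⟨Nat.xor_lt_two_pow gd.1 hmul, by rw [φ.map_xor, φ.map_mul _ _ hf, gd.2, gr.2]⟩
      · rw [if_neg hc]
        have : (a = d ∧ b.val < k + 1) ↔ (a = d ∧ b.val < k) := by
          constructor
          · rintro ⟨h1, h2⟩
            exact ⟨h1, by_contra fun h3 => hc ⟨h1, by omega⟩⟩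
          · rintro ⟨h1, h2⟩; exact ⟨h1, by omega⟩
        simp only [this]
        exact g a b)
  simp only [eval_reg, h.dim] at key
  intro a b
  have := key a b
  simp only [b.2, and_true] at this
  rw [Matrix.updateRow_apply]
  by_cases had : a = d
  · subst had
    simpa [rowAdd] using this
  · simpa [rowAdd, had] using this

/-- If the pivot in the row given by register `14` vanishes, try to repair it by adding rows. -/
def makePivot : Prog :=
  .count 15 (.reg 6) (
    .assign 20 (.const 0 <ₑ (.reg 14 <ₑ .reg 15) *ₑ
      (.cell 10 (.reg 14 *ₑ .reg 6 +ₑ .reg 14) =ₑ .const 0)) ;;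
    .assign 21 (.reg 14) ;; .assign 22 (.reg 15) ;; rowAdd)

/-- The matrix has the determinant `D`, and its columns before `k` vanish below the diagonal. -/
structure IsReduced (k : ℕ) (D : F) (A : Matrix (Fin N) (Fin N) F) : Prop where
  det : A.det = D
  zero : ∀ a b : Fin N, b.val < k → b < a → A a b = 0

theorem IsReduced.rowAdd {k : ℕ} {D : F} {A : Matrix (Fin N) (Fin N) F} (h : IsReduced k D A)
    {d r : Fin N} (hd : k ≤ d.val) (hr : k ≤ r.val) (c : F) (hc : d = r → c = 0) :
    IsReduced k D (A.updateRow d (A d + c • A r)) := by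
  constructor
  · by_cases hdr : d = r
    · rw [hc hdr, zero_smul, add_zero, Matrix.updateRow_eq_self, h.det]
    · rw [Matrix.det_updateRow_add_smul_self _ hdr, h.det]
  · intro a b hb hba
    rw [Matrix.updateRow_apply]
    split_ifs with had
    · subst had
      have hbr : b < r := by rw [Fin.lt_def]; omega
      simp [h.zero a b hb hba, h.zero r b hb hbr]
    · exact h.zero a b hb hba

theorem toFun_eq_zero_iff (φ : Model (2 ^ q) p F) {a : ℕ} (ha : a < 2 ^ q) :
    φ.toFun a = 0 ↔ a = 0 := by
  constructor
  · intro h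
    exact φ.injOn a 0 ha (by positivity) (by rw [h, φ.map_zero])
  · rintro rfl; exact φ.map_zero

theorem makePivot_spec (hp : p < 2 ^ q) (hq : 0 < q) (φ : Model (2 ^ q) p F) {s : State}
    (h : ElimParams N q p s) {A : Matrix (Fin N) (Fin N) F} (hA : HoldsMatrix φ s A) {k : Fin N}
    {D : F} (hD : IsReduced k D A) (h14 : s.regs 14 = k) :
    ∃ A' : Matrix (Fin N) (Fin N) F, HoldsMatrix φ (makePivot.run s) A' ∧ IsReduced k D A' ∧
      (∀ a < k, A' a = A a) ∧ (A' k k = 0 → ∀ a > k, A' a k = 0) := by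
  classical
  have key := Prog.run_count_frame (x := 15) (e := .reg 6) (s := s)
    (p := .assign 20 (.const 0 <ₑ (.reg 14 <ₑ .reg 15) *ₑ
      (.cell 10 (.reg 14 *ₑ .reg 6 +ₑ .reg 14) =ₑ .const 0)) ;;
      .assign 21 (.reg 14) ;; .assign 22 (.reg 15) ;; rowAdd)
    (fun j s' => ∃ A' : Matrix (Fin N) (Fin N) F, HoldsMatrix φ s' A' ∧ IsReduced k D A' ∧
      (∀ a < k, A' a = A a) ∧ (A' k k = 0 → ∀ a > k, a.val < j → A' a k = 0))
    ⟨A, hA.congr rfl, hD, fun _ _ => rfl, fun _ a _ ha => absurd ha (by omega)⟩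
    (fun j s' hj h15 hr ha ⟨A', g1, g2, g3, g4⟩ => by
      simp only [eval_reg, h.dim] at hj
      have r14 : s'.regs 14 = k := by rw [hr 14 (by decide), h14]
      have r6 : s'.regs 6 = N := by rw [hr 6 (by decide), h.dim]
      set f := if k.val < j ∧ A' k k = 0 then 1 else 0 with hf
      have hflt : f < 2 ^ q := by
        have : 1 < 2 ^ q := Nat.one_lt_two_pow hq.ne'
        rw [hf]; split_ifs <;> omega
      set s1 := ((s'.setReg 20 f).setReg 21 k).setReg 22 j with hs1
      have hrun : (Prog.assign 20 (.const 0 <ₑ (.reg 14 <ₑ .reg 15) *ₑ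
          (.cell 10 (.reg 14 *ₑ .reg 6 +ₑ .reg 14) =ₑ .const 0)) ;;
          .assign 21 (.reg 14) ;; .assign 22 (.reg 15) ;; rowAdd).run s' = rowAdd.run s1 := by
        have hz := toFun_eq_zero_iff φ (g1 k k).1
        rw [(g1 k k).2] at hz
        have hf' : (Expr.const 0 <ₑ (.reg 14 <ₑ .reg 15) *ₑ
          (.cell 10 (.reg 14 *ₑ .reg 6 +ₑ .reg 14) =ₑ .const 0)).eval s' = f := by
          simp only [eval_lt, eval_mul, eval_reg, eval_cell, eval_add, eval_eq, eval_const, r14,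
            r6, h15, ← hz, hf]
          by_cases c1 : k.val < j <;> by_cases c2 : A' k k = 0 <;> simp [c1, c2]
        simp only [run_seq, run_assign, hf', hs1]
        simp [r14, h15]
      have e1 : ElimParams N q p s1 := h.congr (by simp [hs1, hr 6 (by decide)])
        (by simp [hs1, hr 7 (by decide)]) (by simp [hs1, ha 5 (by decide)])
        (by simp [hs1, ha 6 (by decide)]) (by simp [hs1, ha 7 (by decide)])
      have hnew := rowAdd_spec hp φ e1 (A := A') (g1.congr rfl) (d := k) (r := ⟨j, hj⟩) hflt
        (by simp [hs1]) (by simp [hs1]) (by simp [hs1])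
      rw [hrun]
      by_cases hc : k.val < j ∧ A' k k = 0
      · have f1 : φ.toFun f = 1 := by rw [hf, if_pos hc, φ.map_one]
        rw [f1, one_smul] at hnew
        refine ⟨_, hnew.congr rfl, ?_, ?_, ?_⟩
        · have := g2.rowAdd (d := k) (r := ⟨j, hj⟩) le_rfl hc.1.le 1 (fun h' => by
            rw [Fin.ext_iff] at h'; simp only at h'; omega)
          rwa [one_smul] at this
        · intro a hak
          rw [Matrix.updateRow_ne hak.ne, g3 a hak]
        · intro hzero a hak haj
          rw [Matrix.updateRow_self, Pi.add_apply, hc.2, zero_add] at hzero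
          rw [Matrix.updateRow_ne hak.ne']
          rcases Nat.lt_succ_iff_lt_or_eq.1 haj with haj | haj
          · exact g4 hc.2 a hak haj
          · have : a = ⟨j, hj⟩ := Fin.ext haj
            rw [this, hzero]
      · have f0 : φ.toFun f = 0 := by rw [hf, if_neg hc, φ.map_zero]
        rw [f0, zero_smul, add_zero, Matrix.updateRow_eq_self] at hnew
        refine ⟨A', hnew.congr rfl, g2, g3, fun hzero a hak haj => ?_⟩
        refine g4 hzero a hak ?_
        by_contra hcon
        exact hc ⟨by rw [gt_iff_lt, Fin.lt_def] at hak; omega, hzero⟩)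
  simp only [eval_reg, h.dim] at key
  obtain ⟨A', k1, k2, k3, k4⟩ := key
  exact ⟨A', k1, k2, k3, fun hz a hak => k4 hz a hak a.2⟩

/-- Clear the column below the pivot in the row given by register `14`; register `16` holds the
inverse of the pivot. -/
def clearColumn : Prog :=
  .count 15 (.reg 6) (
    .assign 20 (.cell 6 (.cell 10 (.reg 15 *ₑ .reg 6 +ₑ .reg 14) *ₑ (.reg 14 <ₑ .reg 15) *ₑ
      .reg 7 +ₑ .reg 16)) ;;
    .assign 21 (.reg 15) ;; .assign 22 (.reg 14) ;; rowAdd)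

theorem clearColumn_spec [CharP F 2] (hp : p < 2 ^ q) (φ : Model (2 ^ q) p F) {s : State}
    (h : ElimParams N q p s) {A : Matrix (Fin N) (Fin N) F} (hA : HoldsMatrix φ s A) {k : Fin N}
    {D : F} (hD : IsReduced k D A) (h14 : s.regs 14 = k) (h16 : s.regs 16 < 2 ^ q)
    (hinv : A k k ≠ 0 → φ.toFun (s.regs 16) * A k k = 1)
    (hz : A k k = 0 → ∀ a > k, A a k = 0) :
    ∃ A' : Matrix (Fin N) (Fin N) F, HoldsMatrix φ (clearColumn.run s) A' ∧
      IsReduced (k + 1) D A' ∧ ∀ a ≤ k, A' a = A a := by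
  have key := Prog.run_count_frame (x := 15) (e := .reg 6) (s := s)
    (p := .assign 20 (.cell 6 (.cell 10 (.reg 15 *ₑ .reg 6 +ₑ .reg 14) *ₑ
      (.reg 14 <ₑ .reg 15) *ₑ .reg 7 +ₑ .reg 16)) ;;
      .assign 21 (.reg 15) ;; .assign 22 (.reg 14) ;; rowAdd)
    (fun j s' => ∃ A' : Matrix (Fin N) (Fin N) F, HoldsMatrix φ s' A' ∧ IsReduced k D A' ∧
      (∀ a, a ≤ k ∨ j ≤ a.val → A' a = A a) ∧ ∀ a > k, a.val < j → A' a k = 0)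
    ⟨A, hA.congr rfl, hD, fun _ _ => rfl, fun a _ ha => absurd ha (by omega)⟩
    (fun j s' hj h15 hr ha ⟨A', g1, g2, g3, g4⟩ => by
      simp only [eval_reg, h.dim] at hj
      have e' : ElimParams N q p s' := h.congr (hr 6 (by decide)) (hr 7 (by decide))
        (ha 5 (by decide)) (ha 6 (by decide)) (ha 7 (by decide))
      have r14 : s'.regs 14 = k := by rw [hr 14 (by decide), h14]
      have r16 : s'.regs 16 = s.regs 16 := hr 16 (by decide)
      set x := s'.arrays 10 (j * N + k) * (if k.val < j then 1 else 0) with hx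
      have hxlt : x < 2 ^ q := by
        rw [hx]; split_ifs
        · rw [mul_one]; exact (g1 ⟨j, hj⟩ k).1
        · rw [mul_zero]; positivity
      have hxφ : φ.toFun x = if k.val < j then A ⟨j, hj⟩ k else 0 := by
        rw [hx]; split_ifs
        · rw [mul_one, (g1 ⟨j, hj⟩ k).2, g3 ⟨j, hj⟩ (.inr le_rfl)]
        · rw [mul_zero, φ.map_zero]
      set f := mul (2 ^ q) p x (s.regs 16) with hf
      have hflt : f < 2 ^ q := mul_lt hp hxlt _
      have hfφ : φ.toFun f = (if k.val < j then A ⟨j, hj⟩ k else 0) * φ.toFun (s.regs 16) := by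
        rw [hf, φ.map_mul _ _ hxlt, hxφ]
      set s1 := ((s'.setReg 20 f).setReg 21 j).setReg 22 k with hs1
      have hrun : (Prog.assign 20 (.cell 6 (.cell 10 (.reg 15 *ₑ .reg 6 +ₑ .reg 14) *ₑ
          (.reg 14 <ₑ .reg 15) *ₑ .reg 7 +ₑ .reg 16)) ;;
          .assign 21 (.reg 15) ;; .assign 22 (.reg 14) ;; rowAdd).run s' = rowAdd.run s1 := by
        have hf' : (Expr.cell 6 (.cell 10 (.reg 15 *ₑ .reg 6 +ₑ .reg 14) *ₑ
          (.reg 14 <ₑ .reg 15) *ₑ .reg 7 +ₑ .reg 16)).eval s' = f := by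
          simp only [eval_lt, eval_mul, eval_reg, eval_cell, eval_add, r14, r16, e'.dim,
            e'.tables.size, h15, ← hx]
          exact e'.tables.mul _ _ hxlt h16
        simp only [run_seq, run_assign, hf', hs1]
        simp [r14, h15]
      have e1 : ElimParams N q p s1 := e'.congr (by simp [hs1]) (by simp [hs1]) (by simp [hs1])
        (by simp [hs1]) (by simp [hs1])
      have hnew := rowAdd_spec hp φ e1 (A := A') (g1.congr rfl) (d := ⟨j, hj⟩) (r := k) hflt
        (by simp [hs1]) (by simp [hs1]) (by simp [hs1])
      rw [hrun]
      by_cases hc : k.val < j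
      · rw [if_pos hc] at hfφ
        refine ⟨_, hnew.congr rfl, ?_, ?_, ?_⟩
        · exact g2.rowAdd hc.le le_rfl _ (fun h' => by
            rw [Fin.ext_iff] at h'; simp only at h'; omega)
        · intro a ha
          have : a ≠ ⟨j, hj⟩ := by
            rintro rfl
            simp only [Fin.le_def] at ha
            omega
          rw [Matrix.updateRow_ne this]
          exact g3 a (ha.imp_right fun h' => by omega)
        · intro a hak haj
          rw [Matrix.updateRow_apply]
          split_ifs with had
          · rw [Pi.add_apply, Pi.smul_apply, smul_eq_mul, hfφ, g3 _ (.inr le_rfl),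
              g3 k (.inl le_rfl)]
            by_cases hkk : A k k = 0
            · rw [hz hkk _ (by rw [← had]; exact hak)]; ring
            · rw [mul_assoc, hinv hkk, mul_one, CharTwo.add_self_eq_zero]
          · refine g4 a hak ?_
            by_contra hcon
            exact had (Fin.ext (by simp only; omega))
      · rw [hfφ, if_neg hc, zero_mul, zero_smul, add_zero, Matrix.updateRow_eq_self] at hnew
        refine ⟨A', hnew.congr rfl, g2, ?_, ?_⟩
        · intro a ha
          exact g3 a (ha.imp_right fun h' => by omega)
        · intro a hak haj
          rw [gt_iff_lt, Fin.lt_def] at hak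
          omega)
  simp only [eval_reg, h.dim] at key
  obtain ⟨A', k1, k2, k3, k4⟩ := key
  refine ⟨A', k1, ⟨k2.det, fun a b hb hba => ?_⟩, fun a ha => k3 a (.inl ha)⟩
  rcases Nat.lt_succ_iff_lt_or_eq.1 hb with hb | hb
  · exact k2.zero a b hb hba
  · have : b = k := Fin.ext hb
    rw [this] at hba ⊢
    exact k4 a hba a.2

/-- Put the determinant of the matrix in array `10` into register `17`. -/
def determinant : Prog :=
  .assign 17 (.const 1) ;;
  .count 14 (.reg 6) (
    makePivot ;;
    .assign 16 (.cell 7 (.cell 10 (.reg 14 *ₑ .reg 6 +ₑ .reg 14))) ;;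
    clearColumn ;;
    .assign 17 (.cell 6 (.reg 17 *ₑ .reg 7 +ₑ .cell 10 (.reg 14 *ₑ .reg 6 +ₑ .reg 14))))

theorem determinant_spec [CharP F 2] (hp : p < 2 ^ q) (hq : 0 < q) (φ : Model (2 ^ q) p F)
    {s : State} (h : ElimParams N q p s) {A : Matrix (Fin N) (Fin N) F}
    (hA : HoldsMatrix φ s A) :
    (determinant.run s).regs 17 < 2 ^ q ∧ φ.toFun ((determinant.run s).regs 17) = A.det := by
  have key := Prog.run_count_frame (x := 14) (e := .reg 6) (s := s.setReg 17 1)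
    (p := makePivot ;;
      .assign 16 (.cell 7 (.cell 10 (.reg 14 *ₑ .reg 6 +ₑ .reg 14))) ;;
      clearColumn ;;
      .assign 17 (.cell 6 (.reg 17 *ₑ .reg 7 +ₑ .cell 10 (.reg 14 *ₑ .reg 6 +ₑ .reg 14))))
    (fun k s' => ∃ A' : Matrix (Fin N) (Fin N) F, HoldsMatrix φ s' A' ∧ IsReduced k A.det A' ∧
      s'.regs 17 < 2 ^ q ∧ φ.toFun (s'.regs 17) = ∏ a : Fin N with a.val < k, A' a a)
    ⟨A, hA.congr rfl, ⟨rfl, fun a b hb => absurd hb (by omega)⟩, by simpa using hq.ne',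
      by simp [φ.map_one]⟩
    (fun k s' hk h14 hr ha ⟨A0, g1, g2, g3, g4⟩ => by
      simp only [eval_reg, regs_setReg, Nat.reduceEqDiff, reduceIte, h.dim] at hk
      have e' : ElimParams N q p s' := h.congr (by simp [hr 6 (by decide)])
        (by simp [hr 7 (by decide)]) (by simp [ha 5 (by decide)]) (by simp [ha 6 (by decide)])
        (by simp [ha 7 (by decide)])
      let u : Fin N := ⟨k, hk⟩
      obtain ⟨A1, b1, b2, b3, b4⟩ := makePivot_spec hp hq φ e' g1 (k := u) g2 h14
      set s1 := makePivot.run s' with hs1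
      have e1 : ElimParams N q p s1 := e'.congr (Prog.run_regs _ (by decide) _)
        (Prog.run_regs _ (by decide) _) (Prog.run_arrays _ (by decide) _)
        (Prog.run_arrays _ (by decide) _) (Prog.run_arrays _ (by decide) _)
      have r14 : s1.regs 14 = k := by rw [hs1, Prog.run_regs _ (by decide), h14]
      have r17 : s1.regs 17 = s'.regs 17 := by rw [hs1, Prog.run_regs _ (by decide)]
      set v := s1.arrays 10 (k * N + k) with hv
      set s2 := s1.setReg 16 (s1.arrays 7 v) with hs2
      have e2 : ElimParams N q p s2 := e1.congr (by simp [hs2]) (by simp [hs2]) rfl rfl rfl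
      obtain ⟨v1, v2⟩ : v < 2 ^ q ∧ φ.toFun v = A1 u u := b1 u u
      obtain ⟨A2, c1, c2, c3⟩ := clearColumn_spec hp φ e2 (b1.congr rfl) b2 (by simp [hs2, r14, u])
        (by simpa [hs2] using e1.tables.inv_lt v v1) (fun hne => by
          have hv0 : v ≠ 0 := by rintro h0; rw [← v2, h0, φ.map_zero] at hne; exact hne rfl
          simp only [hs2, regs_setReg, reduceIte]
          rw [← v2, mul_comm, ← φ.map_mul _ _ v1, e1.tables.mul_inv v v1 hv0, φ.map_one]) b4
      set s3 := clearColumn.run s2 with hs3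
      have e3 : ElimParams N q p s3 := e2.congr (Prog.run_regs _ (by decide) _)
        (Prog.run_regs _ (by decide) _) (Prog.run_arrays _ (by decide) _)
        (Prog.run_arrays _ (by decide) _) (Prog.run_arrays _ (by decide) _)
      have t14 : s3.regs 14 = k := by rw [hs3, Prog.run_regs _ (by decide)]; simp [hs2, r14]
      have t17 : s3.regs 17 = s'.regs 17 := by
        rw [hs3, Prog.run_regs _ (by decide)]; simp [hs2, r17]
      have hrun : (makePivot ;;
          .assign 16 (.cell 7 (.cell 10 (.reg 14 *ₑ .reg 6 +ₑ .reg 14))) ;;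
          clearColumn ;;
          .assign 17 (.cell 6 (.reg 17 *ₑ .reg 7 +ₑ
            .cell 10 (.reg 14 *ₑ .reg 6 +ₑ .reg 14)))).run s' =
          s3.setReg 17 (mul (2 ^ q) p (s'.regs 17) (s3.arrays 10 (k * N + k))) := by
        simp only [run_seq, run_assign, ← hs1, eval_cell, eval_add, eval_mul, eval_reg, r14, e1.dim,
          ← hv, ← hs2, ← hs3, t14, t17, e3.dim, e3.tables.size]
        rw [e3.tables.mul _ _ g3 (c1 u u).1]
      rw [hrun]
      refine ⟨A2, c1.congr rfl, c2, by simpa using mul_lt hp g3 _, ?_⟩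
      simp only [regs_setReg, Nat.reduceEqDiff, reduceIte]
      rw [φ.map_mul _ _ g3, g4, (c1 u u).2]
      have hset : (Finset.univ.filter fun a : Fin N => a.val < k + 1) =
          insert u (Finset.univ.filter fun a : Fin N => a.val < k) := by
        ext a
        simp only [Finset.mem_filter, Finset.mem_univ, true_and, Finset.mem_insert, u, Fin.ext_iff]
        omega
      rw [hset, Finset.prod_insert (by simp [u]), mul_comm]
      congr 1
      refine Finset.prod_congr rfl fun a ha => ?_
      have hau : a < u := by simpa [Fin.lt_def, u] using ha
      rw [c3 a hau.le, b3 a hau])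
  simp only [eval_reg, regs_setReg, Nat.reduceEqDiff, reduceIte, h.dim] at key
  have hrun : determinant.run s = (Prog.count 14 (.reg 6) (makePivot ;;
      .assign 16 (.cell 7 (.cell 10 (.reg 14 *ₑ .reg 6 +ₑ .reg 14))) ;;
      clearColumn ;;
      .assign 17 (.cell 6 (.reg 17 *ₑ .reg 7 +ₑ .cell 10 (.reg 14 *ₑ .reg 6 +ₑ .reg 14))))).run
      (s.setReg 17 1) := rfl
  rw [← hrun] at key
  obtain ⟨A', -, k2, k3, k4⟩ := key
  refine ⟨k3, ?_⟩
  rw [k4, ← k2.det, Matrix.det_of_isUpperTriangular (fun a b hab => k2.zero a b b.2 hab)]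
  simp

end

end CoinRAM

namespace CoinRAM

open BinaryField

/-! ### The sum of determinants -/

/-- Put into array `10` the symmetric matrix for the set with the mask in register `18`. -/
def loadMatrix : Prog :=
  .count 13 (.reg 6 *ₑ .reg 6) (.store 10 (.reg 13)
    ((.cell 9 (.reg 13 *ₑ .reg 5 +ₑ .reg 18) *ₑ (.reg 13 /ₑ .reg 6 <ₑ .reg 13 %ₑ .reg 6) +ₑ
      .cell 9 ((.reg 13 %ₑ .reg 6 *ₑ .reg 6 +ₑ .reg 13 /ₑ .reg 6) *ₑ .reg 5 +ₑ .reg 18) *ₑ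
        (.reg 13 %ₑ .reg 6 <ₑ .reg 13 /ₑ .reg 6)) %ₑ .reg 7))

/-- Put into register `19` the sum of the determinants of the matrices in array `9`. -/
def sieveSum : Prog :=
  .assign 19 (.const 0) ;;
  .count 18 (.reg 5) (loadMatrix ;; determinant ;;
    .assign 19 (.cell 5 (.reg 19 *ₑ .reg 7 +ₑ .reg 17)))

section

variable {N q p m : ℕ} {F : Type} [Field F]

/-- Array `9` holds the entries `w Y a b`. -/
def HoldsWeights (φ : Model (2 ^ q) p F) (m : ℕ) (s : State) (w : ℕ → Fin N → Fin N → F) : Prop :=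
  ∀ (a b : Fin N) (Y : ℕ), Y < 2 ^ m → s.arrays 9 ((a * N + b) * 2 ^ m + Y) < 2 ^ q ∧
    φ.toFun (s.arrays 9 ((a * N + b) * 2 ^ m + Y)) = w Y a b

theorem loadMatrix_spec (φ : Model (2 ^ q) p F) {s : State} (h : ElimParams N q p s)
    (h5 : s.regs 5 = 2 ^ m) {w : ℕ → Fin N → Fin N → F} (hw : HoldsWeights φ m s w) {Y : ℕ}
    (hY : Y < 2 ^ m) (h18 : s.regs 18 = Y) :
    HoldsMatrix φ (loadMatrix.run s) (symmMatrix (w Y)) := by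
  have hrun : loadMatrix.run s = _ := Prog.run_fill (x := 13) (a := 10)
    (e := .reg 6 *ₑ .reg 6) (s := s) (g := _)
    (fun i => (s.arrays 9 (i * 2 ^ m + Y) * (if i / N < i % N then 1 else 0) +
      s.arrays 9 ((i % N * N + i / N) * 2 ^ m + Y) * (if i % N < i / N then 1 else 0)) % 2 ^ q)
    (fun i hi => by
      simp [h.dim, h5, h18, h.tables.size])
  intro a b
  have hlt : a.val * N + b.val < N * N := by nlinarith [a.2, b.2]
  have hval : (loadMatrix.run s).arrays 10 (a * N + b) =
      (s.arrays 9 ((a * N + b) * 2 ^ m + Y) * (if a < b then 1 else 0) +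
      s.arrays 9 ((b * N + a) * 2 ^ m + Y) * (if b < a then 1 else 0)) % 2 ^ q := by
    rw [hrun]
    simp [h.dim, hlt, mul_add_div_of_lt b.2, Nat.mod_eq_of_lt b.2]
  rw [hval, symmMatrix]
  obtain ⟨a1, a2⟩ := hw a b Y hY
  obtain ⟨b1, b2⟩ := hw b a Y hY
  rcases lt_trichotomy a b with hab | hab | hab
  · rw [if_pos hab, if_neg (not_lt_of_gt hab), mul_one, mul_zero, add_zero, Nat.mod_eq_of_lt a1,
      if_pos hab]
    exact ⟨a1, a2⟩
  · simp [hab, φ.map_zero]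
  · rw [if_pos hab, if_neg (not_lt_of_gt hab), mul_one, mul_zero, zero_add, Nat.mod_eq_of_lt b1,
      if_neg (not_lt_of_gt hab), if_pos hab]
    exact ⟨b1, b2⟩

theorem sieveSum_spec [CharP F 2] (hp : p < 2 ^ q) (hq : 0 < q) (φ : Model (2 ^ q) p F)
    {s : State} (h : ElimParams N q p s) (h5 : s.regs 5 = 2 ^ m)
    {w : ℕ → Fin N → Fin N → F} (hw : HoldsWeights φ m s w) :
    (sieveSum.run s).regs 19 < 2 ^ q ∧
      φ.toFun ((sieveSum.run s).regs 19) = ∑ Y ∈ Finset.range (2 ^ m), (symmMatrix (w Y)).det := by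
  have key := Prog.run_count_frame (x := 18) (e := .reg 5) (s := s.setReg 19 0)
    (p := loadMatrix ;; determinant ;; .assign 19 (.cell 5 (.reg 19 *ₑ .reg 7 +ₑ .reg 17)))
    (fun k s' => s'.regs 19 < 2 ^ q ∧
      φ.toFun (s'.regs 19) = ∑ Y ∈ Finset.range k, (symmMatrix (w Y)).det)
    (by simp [φ.map_zero]) (fun k s' hk h18 hr ha ⟨g1, g2⟩ => by
      simp only [eval_reg, regs_setReg, Nat.reduceEqDiff, reduceIte, h5] at hk
      have e' : ElimParams N q p s' := h.congr (by simp [hr 6 (by decide)])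
        (by simp [hr 7 (by decide)]) (by simp [ha 5 (by decide)]) (by simp [ha 6 (by decide)])
        (by simp [ha 7 (by decide)])
      have hw' : HoldsWeights φ m s' w := by
        intro a b Y hY; rw [ha 9 (by decide)]; exact hw a b Y hY
      have b1 := loadMatrix_spec φ e' (by rw [hr 5 (by decide)]; simpa using h5) hw' hk h18
      set s1 := loadMatrix.run s' with hs1
      have e1 : ElimParams N q p s1 := e'.congr (Prog.run_regs _ (by decide) _)
        (Prog.run_regs _ (by decide) _) (Prog.run_arrays _ (by decide) _)
        (Prog.run_arrays _ (by decide) _) (Prog.run_arrays _ (by decide) _)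
      obtain ⟨c1, c2⟩ := determinant_spec hp hq φ e1 b1
      set s2 := determinant.run s1 with hs2
      have e2 : ElimParams N q p s2 := e1.congr (Prog.run_regs _ (by decide) _)
        (Prog.run_regs _ (by decide) _) (Prog.run_arrays _ (by decide) _)
        (Prog.run_arrays _ (by decide) _) (Prog.run_arrays _ (by decide) _)
      have r19 : s2.regs 19 = s'.regs 19 := by
        rw [hs2, Prog.run_regs _ (by decide), hs1, Prog.run_regs _ (by decide)]
      simp only [run_seq, run_assign, ← hs1, ← hs2, eval_cell, eval_add, eval_mul, eval_reg, r19,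
        e2.tables.size, regs_setReg, Nat.reduceEqDiff, reduceIte]
      rw [e2.tables.add _ _ g1 c1, φ.map_xor, g2, c2, Finset.sum_range_succ]
      exact ⟨Nat.xor_lt_two_pow g1 c1, rfl⟩)
  have hrun : sieveSum.run s = (Prog.count 18 (.reg 5) (loadMatrix ;; determinant ;;
    .assign 19 (.cell 5 (.reg 19 *ₑ .reg 7 +ₑ .reg 17)))).run (s.setReg 19 0) := rfl
  simp only [eval_reg, regs_setReg, Nat.reduceEqDiff, reduceIte, h5] at key
  rw [hrun]
  exact key

/-- Make the tables of the sieve and put the sum of the determinants into register `19`. -/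
def sieveTables : Prog := randomTable ;; labelTable ;; zetaTable ;; sieveSum

/-- The sieve for pairs of color classes with random field elements; the answer is put into
register `0`. -/
def sieve : Prog := sieveTables ;; .assign 0 (.reg 19)

/-- The place of a label in the tables. -/
noncomputable def labelCode (a b : Fin N) (X : Finset (Fin m)) : ℕ :=
  (a * N + b) * 2 ^ m + maskCode X

theorem labelCode_lt (a b : Fin N) (X : Finset (Fin m)) : labelCode a b X < N * N * 2 ^ m := by
  have h1 : a.val * N + b < N * N := by nlinarith [a.2, b.2]
  have h2 := maskCode_lt X
  rw [labelCode]
  nlinarith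

theorem labelCode_inj {a b a' b' : Fin N} {X X' : Finset (Fin m)}
    (h : labelCode a b X = labelCode a' b' X') : a = a' ∧ b = b' ∧ X = X' := by
  obtain ⟨h1, h2⟩ := (mul_add_inj (maskCode_lt X) (maskCode_lt X')).1 h
  obtain ⟨h3, h4⟩ := (mul_add_inj b.2 b'.2).1 h1
  refine ⟨Fin.ext h3, Fin.ext h4, ?_⟩
  rw [← maskSet_maskCode X, h2, maskSet_maskCode]

open Classical in
theorem sieve_spec [CharP F 2] (hp : p < 2 ^ q) (hq : 0 < q) (φ : Model (2 ^ q) p F) {n : ℕ}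
    {G : SimpleGraph (Fin n)} {s : State} (h : ElimParams N q p s) (hG : SieveInput G m s)
    (h5 : s.regs 5 = 2 ^ m) (h8 : s.regs 8 = q) :
    (sieve.run s).regs 0 ≠ 0 ↔ ∑ Y : Finset (Fin m), (symmMatrix fun a b : Fin N =>
      ∑ X ∈ Y.powerset, if G.IsIndepLabel m a b X then
        φ.toFun (sample q s.coins (labelCode a b X)) else 0).det ≠ 0 := by
  have b1 := randomTable_spec h.tables.size h8
  rw [h.dim, h5] at b1
  set s1 := randomTable.run s with hs1
  have e1 : ElimParams N q p s1 := h.congr (Prog.run_regs _ (by decide) _)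
    (Prog.run_regs _ (by decide) _) (Prog.run_arrays _ (by decide) _)
    (Prog.run_arrays _ (by decide) _) (Prog.run_arrays _ (by decide) _)
  have i1 : SieveInput G m s1 := hG.congr (Prog.run_regs _ (by decide) _)
    (Prog.run_regs _ (by decide) _) (Prog.run_arrays _ (by decide) _)
    (Prog.run_arrays _ (by decide) _) (Prog.run_arrays _ (by decide) _)
  have r5 : s1.regs 5 = 2 ^ m := by rw [hs1, Prog.run_regs _ (by decide), h5]
  have b2 := fun a b X hX => labelTable_spec (N := N) i1 r5 e1.dim a b X hX
  set s2 := labelTable.run s1 with hs2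
  have e2 : ElimParams N q p s2 := e1.congr (Prog.run_regs _ (by decide) _)
    (Prog.run_regs _ (by decide) _) (Prog.run_arrays _ (by decide) _)
    (Prog.run_arrays _ (by decide) _) (Prog.run_arrays _ (by decide) _)
  have i2 : SieveInput G m s2 := i1.congr (Prog.run_regs _ (by decide) _)
    (Prog.run_regs _ (by decide) _) (Prog.run_arrays _ (by decide) _)
    (Prog.run_arrays _ (by decide) _) (Prog.run_arrays _ (by decide) _)
  have t5 : s2.regs 5 = 2 ^ m := by rw [hs2, Prog.run_regs _ (by decide), r5]
  have hlabel : ∀ (a b : Fin N) (X : Finset (Fin m)), s2.arrays 9 (labelCode a b X) =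
      if a < b ∧ G.IsIndepLabel m a b X then sample q s.coins (labelCode a b X) else 0 := by
    intro a b X
    rw [labelCode, b2 a b _ (maskCode_lt X), maskSet_maskCode]
    refine if_congr Iff.rfl (b1 _ (labelCode_lt a b X)) rfl
  have hdecode : ∀ i < N * N * 2 ^ m, ∃ (a b : Fin N) (X : Finset (Fin m)), labelCode a b X = i := by
    intro i hi
    have h1 : i / 2 ^ m < N * N := by rwa [Nat.div_lt_iff_lt_mul (by positivity)]
    have hN : 0 < N := Nat.pos_of_ne_zero (by rintro rfl; simp at h1)
    refine ⟨⟨i / 2 ^ m / N, by rwa [Nat.div_lt_iff_lt_mul hN]⟩, ⟨i / 2 ^ m % N, Nat.mod_lt _ hN⟩,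
      maskSet m (i % 2 ^ m), ?_⟩
    rw [labelCode, maskCode_maskSet (Nat.mod_lt _ (by positivity))]
    simp only
    rw [Nat.div_add_mod', Nat.div_add_mod']
  have b3 := zetaTable_spec (N := N) φ i2.labels t5 e2.dim e2.tables.size e2.tables.add i2.pow
    (fun i hi => by
      obtain ⟨a, b, X, rfl⟩ := hdecode i hi
      rw [hlabel]
      split_ifs
      · exact sample_lt _ _ _
      · positivity)
    (fun A X => φ.toFun (s2.arrays 9 (A * 2 ^ m + maskCode X)))
    (fun i hi => by
      rw [← maskSet_mod, maskCode_maskSet (Nat.mod_lt _ (by positivity)), Nat.div_add_mod'])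
  set s3 := zetaTable.run s2 with hs3
  have e3 : ElimParams N q p s3 := e2.congr (Prog.run_regs _ (by decide) _)
    (Prog.run_regs _ (by decide) _) (Prog.run_arrays _ (by decide) _)
    (Prog.run_arrays _ (by decide) _) (Prog.run_arrays _ (by decide) _)
  have u5 : s3.regs 5 = 2 ^ m := by rw [hs3, Prog.run_regs _ (by decide), t5]
  have hw : HoldsWeights φ m s3 fun Y (a b : Fin N) => ∑ X ∈ (maskSet m Y).powerset,
      φ.toFun (s2.arrays 9 (labelCode a b X)) := by
    intro a b Y hY
    have h1 : a.val * N + b < N * N := by nlinarith [a.2, b.2]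
    have h2 : (a * N + b) * 2 ^ m + Y < N * N * 2 ^ m := by nlinarith
    obtain ⟨c1, c2⟩ := b3 _ h2
    refine ⟨c1, c2.trans ?_⟩
    rw [mul_add_div_of_lt hY, ← maskSet_mod, mul_add_mod_of_lt hY]
    rfl
  obtain ⟨d1, d2⟩ := sieveSum_spec hp hq φ e3 u5 hw
  have hfin : (sieve.run s).regs 0 = (sieveSum.run s3).regs 19 := by
    simp [sieve, sieveTables, hs3, hs2, hs1]
  rw [hfin, ne_eq, ← toFun_eq_zero_iff φ d1, d2]
  have hsum : ∑ Y ∈ Finset.range (2 ^ m), (symmMatrix fun a b : Fin N =>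
      ∑ X ∈ (maskSet m Y).powerset, φ.toFun (s2.arrays 9 (labelCode a b X))).det =
      ∑ Y : Finset (Fin m), (symmMatrix fun a b : Fin N =>
      ∑ X ∈ Y.powerset, φ.toFun (s2.arrays 9 (labelCode a b X))).det := by
    rw [Finset.sum_range]
    exact (Equiv.ofBijective _ (maskSet_bijective m)).sum_comp fun Y =>
      (symmMatrix fun a b : Fin N =>
        ∑ X ∈ Y.powerset, φ.toFun (s2.arrays 9 (labelCode a b X))).det
  rw [hsum]
  refine not_congr (Eq.congr_left (Finset.sum_congr rfl fun Y _ => congrArg Matrix.det ?_))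
  have hval : ∀ a b : Fin N, a < b → ∑ X ∈ Y.powerset, φ.toFun (s2.arrays 9 (labelCode a b X)) =
      ∑ X ∈ Y.powerset, if G.IsIndepLabel m a b X then
        φ.toFun (sample q s.coins (labelCode a b X)) else 0 := by
    intro a b hab
    refine Finset.sum_congr rfl fun X _ => ?_
    rw [hlabel]
    by_cases hok : G.IsIndepLabel m a b X <;> simp [hab, hok, φ.map_zero]
  funext a b
  simp only [symmMatrix]
  split_ifs with h1 h2
  · exact hval a b h1
  · exact hval b a h2
  · rfl

end

end CoinRAM

namespace CoinRAM

open BinaryField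

/-! ### The whole program -/

theorem Prog.run_withCoins (p : Prog) (h : p.flips = false) (s : State) (c : ℕ → Bool) :
    p.run { s with coins := c } = { p.run s with coins := c } := by
  have heval : ∀ (e : Expr) (s : State), e.eval { s with coins := c } = e.eval s := by
    intro e s
    induction e with
    | const | reg => rfl
    | cell a i ih => simp [ih]
    | op o e f ihe ihf => simp [Expr.eval, ihe, ihf]
  induction p generalizing s with
  | skip => rfl
  | assign x e => simp [heval, State.setReg]
  | store a i e => simp [heval, State.setCell]
  | flip x => simp [flips] at h
  | seq p q ihp ihq => simp only [flips, Bool.or_eq_false_iff] at h; simp [ihp h.1, ihq h.2]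
  | ite e p q ihp ihq =>
    simp only [flips, Bool.or_eq_false_iff] at h
    simp only [run_ite, heval, ihp h.1, ihq h.2]
    split <;> rfl
  | count x e p ih =>
    simp only [flips] at h
    have key : ∀ k, rounds p.run x { s with coins := c } k =
        { rounds p.run x s k with coins := c } := by
      intro k
      induction k with
      | zero => rfl
      | succ k ihk => simp only [rounds, ihk, ih h]; rfl
    simp only [run, heval, key]

/-- The number `4 * (n + 1) ^ d`. -/
def sizeExpr : ℕ → Expr
  | 0 => .const 4
  | d + 1 => sizeExpr d *ₑ (.reg 0 +ₑ .const 1)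

theorem sizeExpr_eval (d : ℕ) (s : State) : (sizeExpr d).eval s = 4 * (s.regs 0 + 1) ^ d := by
  induction d with
  | zero => rfl
  | succ d ih => simp only [sizeExpr, eval_mul, ih, eval_add, eval_reg, eval_const]; ring

theorem sizeExpr_isPoly (d : ℕ) : (sizeExpr d).isPoly [0, 1] = true := by
  induction d with
  | zero => rfl
  | succ d ih => simp only [sizeExpr, Expr.isPoly, ih]; decide

/-- Compute the size of the matrices and the bound for the size of the field. -/
def setSizes (d : ℕ) : Prog :=
  .assign 6 (.const 2 *ₑ .reg 1) ;; .assign 23 (sizeExpr (d + 1))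

theorem setSizes_isTame (d : ℕ) : (setSizes d).isTame [0, 1] [] = true := by
  have h := sizeExpr_isPoly (d + 1)
  simp only [sizeExpr] at h
  simp only [setSizes, Prog.isTame, sizeExpr, Expr.isSafe, h]
  decide

/-- Prepare the sieve. -/
def prepare (d : ℕ) : Prog := setSizes d ;; powers ;; fieldSize ;; fieldTables

/-- Whether the number of colors is smaller than the number of parts of the greedy listing. -/
def fewColors : Expr :=
  .reg 1 <ₑ .reg 3 /ₑ .const 3 +ₑ (.reg 4 -ₑ .reg 3) /ₑ .const 2 +ₑ (.reg 0 -ₑ .reg 4)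

/-- Whether more than twice as many vertices as colors are listed after the triples. -/
def manyVertices : Expr := .const 2 *ₑ .reg 1 <ₑ .reg 0 -ₑ .reg 3

/-- The first part of the program: list the vertices. -/
def listing : Prog := bigNumber ;; listVertices

/-- The program for coloring with error probability at most `1 / (n + 1) ^ d`. -/
def coloringProg (d : ℕ) : Prog :=
  listing ;; .ite fewColors
    (.ite manyVertices (.assign 0 (.const 0)) (prepare d ;; sieve)) (.assign 0 (.const 1))

/-- What holds after the listing. -/
structure Listed {n : ℕ} (G : SimpleGraph (Fin n)) (l : ℕ) (σ : Equiv.Perm (Fin n)) (m c : ℕ)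
    (s : State) : Prop where
  size : s.regs 0 = n
  colors : s.regs 1 = l
  big : s.regs 2 = 2 ^ (n + 1)
  triples : s.regs 3 = m
  pairs : s.regs 4 = c
  adj : ∀ i j : Fin n, s.arrays 0 (i * n + j) ≠ 0 ↔ G.Adj i j
  vert : ∀ i : Fin n, s.arrays 2 i = σ i
  greedy : (G.comap σ).IsGreedyListing m c

theorem coloringInput_adj {n : ℕ} (G : SimpleGraph (Fin n)) (l : ℕ) (coins : ℕ → Bool)
    (u v : Fin n) : (coloringInput G l coins).arrays 0 (u * n + v) ≠ 0 ↔ G.Adj u v := by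
  have : (∃ u' v' : Fin n, u.val * n + v.val = u'.val * n + v'.val ∧ G.Adj u' v') ↔ G.Adj u v := by
    constructor
    · rintro ⟨u', v', h, hA⟩
      obtain ⟨h1, h2⟩ := (mul_add_inj v.2 v'.2).1 h
      rwa [Fin.ext h1, Fin.ext h2]
    · exact fun h => ⟨u, v, rfl, h⟩
  rw [← this]
  simp [coloringInput]

theorem listing_spec {n : ℕ} (G : SimpleGraph (Fin n)) (l : ℕ) (coins : ℕ → Bool) :
    ∃ σ m c, Listed G l σ m c (listing.run (coloringInput G l coins)) := by
  set s0 := coloringInput G l coins with hs0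
  set s1 := bigNumber.run s0 with hs1
  have h0 : s0.regs 0 = n := by simp [hs0, coloringInput]
  have b2 : s1.regs 2 = 2 ^ (n + 1) := by rw [hs1, bigNumber_spec, h0]
  have b0 : s1.regs 0 = n := by rw [hs1, Prog.run_regs _ (by decide), h0]
  have b3 : s1.regs 3 = 0 := by
    rw [hs1, Prog.run_regs _ (by decide)]; simp [hs0, coloringInput]
  have ba : s1.arrays = s0.arrays := by
    funext a
    rw [hs1]
    exact Prog.run_arrays _ (by simp [bigNumber, Prog.writesArray]) _
  have hW : n < 2 ^ (n + 1) := (Nat.lt_succ_self n).trans Nat.lt_two_pow_self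
  have hl : ListState G (2 ^ (n + 1)) 0 s1 := by
    refine ⟨b0, b2, fun u v hu hv => ?_, ?_⟩
    · rw [ba, coloringInput_adj G l coins ⟨u, hu⟩ ⟨v, hv⟩]
      exact ⟨fun h => ⟨hu, hv, h⟩, fun ⟨_, _, h⟩ => h⟩
    · rw [ba]
      exact ⟨by simp, by simp, by simp [hs0, coloringInput]⟩
  obtain ⟨σ, c1, c2⟩ := listVertices_spec hW hl b3
  refine ⟨σ, _, _, ⟨?_, ?_, ?_, rfl, rfl, ?_, c1, c2⟩⟩
  · simp only [listing, run_seq]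
    rw [Prog.run_regs _ (by decide), ← hs1, b0]
  · simp only [listing, run_seq]
    rw [Prog.run_regs _ (by decide), Prog.run_regs _ (by decide)]
    simp [hs0, coloringInput]
  · simp only [listing, run_seq]
    rw [Prog.run_regs _ (by decide), ← hs1, b2]
  · intro i j
    simp only [listing, run_seq]
    rw [Prog.run_arrays _ (by decide), ← hs1, ba]
    exact coloringInput_adj G l coins i j

/-- What holds before the sieve starts. -/
structure Prepared {n : ℕ} (G : SimpleGraph (Fin n)) (d l m q p : ℕ) (s : State) : Prop where
  params : ElimParams (2 * l) q p s
  input : SieveInput G m s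
  pow : s.regs 5 = 2 ^ m
  bits : s.regs 8 = q
  lt : 2 ^ q < 4 * (n + 1) ^ (d + 1)
  le : 4 * (n + 1) ^ (d + 1) ≤ 2 * 2 ^ q
  modulus : p < 2 ^ q

theorem Prepared.pos {n : ℕ} {G : SimpleGraph (Fin n)} {d l m q p : ℕ} {s : State}
    (h : Prepared G d l m q p s) : 0 < q := by
  have h1 := h.le
  have h2 : 0 < (n + 1) ^ (d + 1) := by positivity
  by_contra hq
  obtain rfl : q = 0 := by omega
  rw [pow_zero] at h1
  omega

theorem prepare_spec {n l m c d : ℕ} {G : SimpleGraph (Fin n)} {σ : Equiv.Perm (Fin n)}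
    {s : State} (h : Listed G l σ m c s) :
    ∃ q p, Prepared (G.comap σ) d l m q p ((prepare d).run s) := by
  have hmn : m ≤ n := h.greedy.le₁.trans h.greedy.le₂
  set s1 := (setSizes d).run s with hs1
  have r3 : s1.regs 3 = m := by simp [hs1, setSizes, h.triples]
  have r6 : s1.regs 6 = 2 * l := by simp [hs1, setSizes, h.colors]
  have r23 : s1.regs 23 = 4 * (n + 1) ^ (d + 1) := by
    simp [hs1, setSizes, sizeExpr_eval, h.size]
  have r0 : s1.regs 0 = n := by simp [hs1, setSizes, h.size]
  have r2 : s1.regs 2 = 2 ^ (n + 1) := by simp [hs1, setSizes, h.big]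
  have ra : s1.arrays = s.arrays := by simp [hs1, setSizes]
  obtain ⟨b5, b4⟩ := powers_spec (s := s1) (by
    rw [r3, r2]; exact Nat.pow_lt_pow_right (by norm_num) (by omega))
  set s2 := powers.run s1 with hs2
  have hpos : 0 < (n + 1) ^ (d + 1) := by positivity
  have t23 : s2.regs 23 = 4 * (n + 1) ^ (d + 1) := by rw [hs2, Prog.run_regs _ (by decide), r23]
  obtain ⟨c7, clt, cle⟩ := fieldSize_spec (s := s2) (by rw [t23]; omega)
  set s3 := fieldSize.run s2 with hs3
  set q := s3.regs 8 with hq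
  rw [c7, t23] at clt cle
  have hq0 : 0 < q := by
    by_contra hq0
    have : q = 0 := by omega
    rw [this, pow_zero] at cle
    omega
  obtain ⟨p, hp, htab⟩ := fieldTables_spec hq0 c7
  set s4 := fieldTables.run s3 with hs4
  have hrun : (prepare d).run s = s4 := rfl
  refine ⟨q, p, ?_⟩
  rw [hrun]
  refine ⟨⟨htab, ?_⟩, ⟨?_, ?_, ?_, ?_⟩, ?_, ?_, clt, cle, hp⟩
  · rw [hs4, Prog.run_regs _ (by decide), hs3, Prog.run_regs _ (by decide), hs2,
      Prog.run_regs _ (by decide), r6]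
  · rw [hs4, Prog.run_regs _ (by decide), hs3, Prog.run_regs _ (by decide), hs2,
      Prog.run_regs _ (by decide), r0]
  · rw [hs4, Prog.run_regs _ (by decide), hs3, Prog.run_regs _ (by decide), hs2,
      Prog.run_regs _ (by decide), r3]
  · intro i hi
    rw [hs4, Prog.run_arrays _ (by decide), hs3, Prog.run_arrays _ (by decide)]
    exact b4 i (by rw [r3]; exact hi)
  · intro i j
    have a0 : s4.arrays 0 = s.arrays 0 := by
      rw [hs4, Prog.run_arrays _ (by decide), hs3, Prog.run_arrays _ (by decide), hs2,
        Prog.run_arrays _ (by decide), ra]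
    have a2 : s4.arrays 2 = s.arrays 2 := by
      rw [hs4, Prog.run_arrays _ (by decide), hs3, Prog.run_arrays _ (by decide), hs2,
        Prog.run_arrays _ (by decide), ra]
    rw [a0, a2, h.vert i, h.vert j, h.adj]
    rfl
  · rw [hs4, Prog.run_regs _ (by decide), hs3, Prog.run_regs _ (by decide), b5, r3]
  · rw [hs4, Prog.run_regs _ (by decide)]

theorem Prepared.withCoins {n : ℕ} {G : SimpleGraph (Fin n)} {d l m q p : ℕ} {s : State}
    (h : Prepared G d l m q p s) (coins : ℕ → Bool) :
    Prepared G d l m q p { s with coins := coins } :=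
  ⟨h.params.congr rfl rfl rfl rfl rfl, h.input.congr rfl rfl rfl rfl rfl, h.pow, h.bits, h.lt,
    h.le, h.modulus⟩

/-! ### The probability of error -/

theorem sieve_error {n d l m q p : ℕ} {G : SimpleGraph (Fin n)} {s : State} (hmn : m ≤ n)
    (hln : l ≤ n) (h : Prepared G d l m q p s)
    (htri : ∀ i j k : Fin n, m ≤ i.val → m ≤ j.val → m ≤ k.val → i ≠ j → i ≠ k → j ≠ k →
      G.Adj i j ∨ G.Adj i k ∨ G.Adj j k) (hm : n - m ≤ 2 * l) :
    1 - 1 / ((n : ℝ) + 1) ^ d ≤ fairCoins.real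
      {coins | (sieve.run { s with coins := coins }).regs 0 ≠ 0 ↔ G.Colorable l} := by
  classical
  obtain ⟨F, _, _, _, hcard, ⟨φ⟩⟩ := h.params.tables.hasInverses.exists_model h.pos h.modulus
  have hspec := fun coins => sieve_spec (N := 2 * l) h.modulus h.pos φ (h.withCoins coins).params
    (h.withCoins coins).input (h.withCoins coins).pow (h.withCoins coins).bits
  by_cases hc : G.Colorable l
  · obtain ⟨τ, f, hτ⟩ := SimpleGraph.exists_isAdmissibleCover hmn htri hc
    set K := 2 * l * (2 * l) * 2 ^ m with hK
    let enc : Fin (2 * l) → Fin (2 * l) → Finset (Fin m) → Fin K := fun a b X =>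
      ⟨labelCode a b X, labelCode_lt a b X⟩
    have hB := card_sum_det_eq_zero_mul_le (F := F) (enc := enc) (ok := G.IsIndepLabel m)
      (fun a b X a' b' X' h => labelCode_inj (congrArg Fin.val h)) hτ
    have hle := fairCoins_real_sample_le φ.toFun φ.injOn hcard _ hB
    refine one_sub_le_fairCoins_real (hle.trans ?_) ?_
    · have h1 : 2 * (n + 1) ^ (d + 1) ≤ 2 ^ q := by have := h.le; omega
      have h2 : (2 : ℝ) * ((n : ℝ) + 1) ^ (d + 1) ≤ 2 ^ q := by exact_mod_cast h1
      have h3 : (l : ℝ) ≤ n + 1 := by exact_mod_cast hln.trans (Nat.le_succ n)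
      rw [div_le_div_iff₀ (by positivity) (by positivity)]
      push_cast
      calc 2 * (l : ℝ) * ((n : ℝ) + 1) ^ d ≤ 2 * ((n : ℝ) + 1) * ((n : ℝ) + 1) ^ d := by gcongr
        _ = 2 * ((n : ℝ) + 1) ^ (d + 1) := by ring
        _ ≤ 1 * 2 ^ q := by linarith
    · intro coins hnot
      simp only [Set.mem_ofPred_eq, hc, iff_true]
      rw [hspec coins]
      intro hzero
      apply hnot
      simp only [Set.mem_ofPred_eq, Finset.mem_filter, Finset.mem_univ, true_and]
      exact hzero
  · have hall : {coins | (sieve.run { s with coins := coins }).regs 0 ≠ 0 ↔ G.Colorable l} =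
        Set.univ := by
      ext coins
      simp only [Set.mem_ofPred_eq, Set.mem_univ, iff_true, hc, iff_false]
      rw [hspec coins, not_not]
      exact sum_det_eq_zero_of_forall_not _
        (fun τ f hτ => hc (SimpleGraph.colorable_of_isAdmissibleCover hm hτ)) _
    rw [hall, MeasureTheory.probReal_univ]
    have : 0 ≤ 1 / ((n : ℝ) + 1) ^ d := by positivity
    linarith

end CoinRAM

namespace CoinRAM

/-! ### The cost of the program -/

/-- Started in `s`, the program costs at most `T`. -/
def Prog.RunsIn (p : Prog) (s : State) (T : ℕ) : Prop :=
  ∃ t, Exec p.toCmd s (p.run s) t ∧ t ≤ T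

theorem Prog.RunsIn.seq {p q : Prog} {s : State} {T T' : ℕ} (hp : p.RunsIn s T)
    (hq : q.RunsIn (p.run s) T') : (p ;; q).RunsIn s (T + T') := by
  obtain ⟨t, e, h⟩ := hp
  obtain ⟨t', e', h'⟩ := hq
  exact ⟨_, .seq e e', Nat.add_le_add h h'⟩

theorem Prog.RunsIn.ite {p q : Prog} {s : State} {e : Expr} {T T' : ℕ}
    (he : 1 + e.cost s ≤ T) (hp : e.eval s ≠ 0 → p.RunsIn s T') (hq : e.eval s = 0 → q.RunsIn s T') :
    (Prog.ite e p q).RunsIn s (T + T') := by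
  by_cases h : e.eval s = 0
  · obtain ⟨t, e', h'⟩ := hq h
    have : (Prog.ite e p q).run s = q.run s := by simp [h]
    rw [RunsIn, this]
    exact ⟨_, .ite_false h e', Nat.add_le_add he h'⟩
  · obtain ⟨t, e', h'⟩ := hp h
    have : (Prog.ite e p q).run s = p.run s := by simp [h]
    rw [RunsIn, this]
    exact ⟨_, .ite_true h e', Nat.add_le_add he h'⟩

theorem Prog.RunsIn.mono {p : Prog} {s : State} {T T' : ℕ} (h : p.RunsIn s T) (hT : T ≤ T') :
    p.RunsIn s T' := by
  obtain ⟨t, e, h'⟩ := h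
  exact ⟨t, e, h'.trans hT⟩

theorem Prog.runsIn_of_isTame {R Z : List ℕ} {mr M L B D E : ℕ} (hL : 2 ≤ L) (hM : 1 ≤ M)
    (hML : M ≤ 2 ^ L) {p : Prog} (hp : p.isTame R Z) (hB : L * p.need mr ≤ B) {s : State}
    (hs : s.Bounded B) (hR : ParamBound R mr M L s) (hZ : ∀ r ∈ Z, 0 < s.regs r)
    (hD : p.degL ≤ D) (hE : M ^ p.degM mr ≤ E) :
    (p.run s).Bounded B ∧ p.RunsIn s ((B + 2) * (E * L ^ D)) := by
  obtain ⟨h1, t, h2, h3⟩ := exec_of_isTame hL hM hML p hp hB s hs hR hZ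
  exact ⟨h1, t, h2, h3.trans (Nat.mul_le_mul_left _
    (Nat.mul_le_mul hE (Nat.pow_le_pow_right (by omega) hD)))⟩

theorem bigNumber_runsIn {s : State} {n B : ℕ} (hs : s.Bounded B) (h0 : s.regs 0 = n)
    (hB : n + 1 < B) :
    (bigNumber.run s).Bounded B ∧ bigNumber.RunsIn s ((B + 2) * ((n + 2) * 100)) := by
  set body : Prog := .assign 2 (.reg 2 +ₑ .reg 2) with hbody
  set e : Expr := .reg 0 +ₑ .const 1 with he
  set s1 := s.setReg 2 1 with hs1
  have hlt : ∀ k ≤ n + 1, 2 ^ k < 2 ^ B := fun k hk => Nat.pow_lt_pow_right (by norm_num) (by omega)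
  have hb : ∀ s, body.run s = s.setReg 2 (s.regs 2 + s.regs 2) := fun _ => rfl
  have inv : ∀ k ≤ n + 1, (Prog.rounds body.run 11 s1 k).Bounded B ∧
      (Prog.rounds body.run 11 s1 k).regs 0 = n ∧
      (Prog.rounds body.run 11 s1 k).regs 2 = 2 ^ k := by
    intro k
    induction k with
    | zero =>
      intro _
      exact ⟨(hs.setReg (hlt 0 (by omega))).setReg (by positivity), by simp [Prog.rounds, hs1, h0],
        by simp [Prog.rounds, hs1]⟩
    | succ k ih =>
      intro hk
      obtain ⟨i1, i2, i3⟩ := ih (by omega)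
      refine ⟨?_, by simp [Prog.rounds, hb, i2], by simp [Prog.rounds, hb, i3]; ring⟩
      refine State.Bounded.setReg (i1.setReg ?_) ?_
      · simp only [eval_add, eval_reg, i3]
        have := hlt (k + 1) hk
        rw [pow_succ] at this; omega
      · exact (show k + 1 < 2 ^ (k + 1) from Nat.lt_two_pow_self).trans (hlt _ hk)
  have hN : e.eval s1 = n + 1 := by simp [he, hs1, h0]
  have hbodyB : ∀ k < n + 1, (body.run (Prog.rounds body.run 11 s1 k)).Bounded B := by
    intro k hk
    obtain ⟨i1, -, i3⟩ := inv k hk.le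
    refine i1.setReg ?_
    simp only [eval_add, eval_reg, i3]
    have := hlt (k + 1) hk
    rw [pow_succ] at this; omega
  have hcount := Prog.exec_count (x := 11) (e := e) (p := body) (s := s1) (T := 10 * (B + 2))
    (c := 36 * (B + 2))
    (fun k hk => by
      rw [hN] at hk ⊢
      simp [he, (inv k hk).2.1])
    (by decide)
    (fun k hk => by
      rw [hN] at hk
      exact cost_le (inv k hk).1 _)
    (fun k hk => by
      rw [hN] at hk
      refine (cost_le (hbodyB k hk) _).trans (Nat.mul_le_mul_right _ (by decide)))
    (fun k hk => by
      rw [hN] at hk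
      refine ⟨_, .assign _ _ _, ?_⟩
      have := cost_le (inv k hk.le).1 (.reg 2 +ₑ .reg 2)
      simp only [Expr.len] at this
      omega)
  obtain ⟨t, ht, hle⟩ := hcount
  rw [hN] at hle
  have hrun : bigNumber.run s = (Prog.count 11 e body).run s1 := rfl
  refine ⟨?_, ?_⟩
  · rw [hrun]
    have := (inv (n + 1) le_rfl).1
    rw [← hN] at this
    exact this
  · refine ⟨_, .seq (.assign s 2 (.const 1)) ht, ?_⟩
    simp only [Expr.cost, Nat.size_one]
    nlinarith

/-- A bound for the degree of the cost of the program. -/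
def costDegree (d : ℕ) : ℕ :=
  8 + listVertices.degL + (setSizes d).degL + (powers ;; fieldSize).degL + fieldTables.degL +
    sieveTables.degL + (fewColors.len * fewColors.len + 1) + (manyVertices.len * manyVertices.len + 1)

/-- A bound for the number of binary digits of the values, in units of `4 * (n + 1) ^ (d + 1)`. -/
def valueFactor (d : ℕ) : ℕ :=
  4 + listVertices.need 5 + (setSizes d).need 5 + (powers ;; fieldSize).need 5 +
    fieldTables.need 5 + sieveTables.need 5

theorem one_add_cost_le {L B D E : ℕ} (hL : 2 ≤ L) (hE : 1 ≤ E) {s : State} (hs : s.Bounded B)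
    {e : Expr} (hD : e.len * e.len + 1 ≤ D) : 1 + e.cost s ≤ (B + 2) * (E * L ^ D) := by
  have h1 := cost_le hs e
  have h2 := (le_pow_self' hL _).trans (Nat.pow_le_pow_right (by omega : 0 < L) hD)
  have h3 : L ^ D ≤ E * L ^ D := Nat.le_mul_of_pos_left _ hE
  have h4 := Nat.mul_le_mul_left (B + 2) (h2.trans h3)
  nlinarith

theorem coloringProg_runsIn {n l k d : ℕ} {G : SimpleGraph (Fin n)}
    (hk : l + k = G.cliqueNum + matchingNumber Gᶜ) (coins : ℕ → Bool) :
    (coloringProg d).RunsIn (coloringInput G l coins)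
      (9 * ((4 * (n + 1) ^ (d + 1) * valueFactor d + 2) *
        (2 ^ (6 * k) * (4 * (n + 1) ^ (d + 1)) ^ costDegree d))) := by
  set L := 4 * (n + 1) ^ (d + 1) with hLdef
  set B := L * valueFactor d with hBdef
  set E := 2 ^ (6 * k) with hEdef
  set D := costDegree d with hDdef
  have hpow : n + 1 ≤ (n + 1) ^ (d + 1) := Nat.le_self_pow (by omega) _
  have hLn : 4 * (n + 1) ≤ L := Nat.mul_le_mul_left _ hpow
  have hL : 2 ≤ L := by omega
  have hE : 1 ≤ E := Nat.one_le_two_pow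
  have hBL : L * 4 ≤ B := Nat.mul_le_mul_left _ (by rw [valueFactor]; omega)
  have hl : l ≤ 2 * n := by
    have h1 := G.cliqueNum_le_card
    have h2 := Gᶜ.matchingNumber_le_card
    rw [Fintype.card_fin] at h1 h2
    omega
  have hLB : 2 ^ L ≤ 2 ^ B := Nat.pow_le_pow_right (by norm_num) (by omega)
  have hLlt : L < 2 ^ L := Nat.lt_two_pow_self
  set s0 := coloringInput G l coins with hs0
  have hb0 : s0.Bounded B := by
    constructor
    · intro x
      simp only [hs0, coloringInput]
      split_ifs <;> omega
    · intro a i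
      simp only [hs0, coloringInput]
      split_ifs <;> omega
  have h00 : s0.regs 0 = n := by simp [hs0, coloringInput]
  obtain ⟨hb1, t1⟩ := bigNumber_runsIn hb0 h00 (by omega)
  have t1' : bigNumber.RunsIn s0 ((B + 2) * (E * L ^ D)) := by
    refine t1.mono (Nat.mul_le_mul_left _ ?_)
    have h1 : (n + 2) * 100 ≤ L ^ 8 := by
      have h2 : 2 ^ 7 ≤ L ^ 7 := Nat.pow_le_pow_left hL 7
      rw [pow_succ, mul_comm]
      exact Nat.mul_le_mul (by omega) (by omega)
    have h2 : L ^ 8 ≤ L ^ D := Nat.pow_le_pow_right (by omega) (by rw [hDdef, costDegree]; omega)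
    exact (h1.trans h2).trans (Nat.le_mul_of_pos_left _ hE)
  set s1 := bigNumber.run s0 with hs1
  have r0 : s1.regs 0 = n := by rw [hs1, Prog.run_regs _ (by decide), h00]
  have r2 : s1.regs 2 = 2 ^ (n + 1) := by rw [hs1, bigNumber_spec, h00]
  have hone : ∀ i, 1 ^ i ≤ E := fun i => by rw [one_pow]; exact hE
  obtain ⟨hb2, t2⟩ := Prog.runsIn_of_isTame (R := [0]) (Z := [2]) (mr := 5) (M := 1) (B := B) (D := D)
    (E := E) hL le_rfl Nat.one_le_two_pow (p := listVertices) (by decide)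
    (Nat.mul_le_mul_left _ (by rw [valueFactor]; omega)) hb1
    (by intro r hr; simp only [List.mem_singleton] at hr; subst hr; simp; omega)
    (by intro r hr; simp only [List.mem_singleton] at hr; subst hr; rw [r2]; positivity)
    (by rw [hDdef, costDegree]; omega) (hone _)
  have tl : listing.RunsIn s0 _ := t1'.seq t2
  obtain ⟨σ, m, c, hlist⟩ := listing_spec G l coins
  have hs2 : listVertices.run s1 = listing.run s0 := rfl
  rw [hs2] at hb2
  set s2 := listing.run s0
  have hmn : m ≤ n := hlist.greedy.le₁.trans hlist.greedy.le₂
  have few : fewColors.eval s2 ≠ 0 ↔ l < m / 3 + (c - m) / 2 + (n - c) := by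
    simp [fewColors, hlist.colors, hlist.triples, hlist.pairs, hlist.size]
  have tassign : ∀ v ≤ 1, (Prog.assign 0 (.const v)).RunsIn s2
      ((B + 2) * (E * L ^ D)) := by
    intro v hv
    refine ⟨_, .assign _ _ _, one_add_cost_le hL hE hb2 ?_⟩
    have h4 : (Expr.const v).len ≤ 2 := by simp only [Expr.len]; omega
    have h5 := Nat.mul_le_mul h4 h4
    rw [hDdef, costDegree]
    omega
  have thard : fewColors.eval s2 ≠ 0 → (prepare d ;; sieve).RunsIn s2
      (5 * ((B + 2) * (E * L ^ D))) := by
    intro hfew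
    rw [few] at hfew
    have hln : l ≤ n := by
      have := hlist.greedy.le₁
      have := hlist.greedy.le₂
      omega
    have hm6 : 2 ^ m ≤ E := by
      refine Nat.pow_le_pow_right (by norm_num) (hlist.greedy.le_six_mul hfew ?_)
      have h1 := G.cliqueNum_comap_le σ.toEmbedding
      have h2 := G.matchingNumber_compl_comap_le σ.toEmbedding
      simp only [Equiv.coe_toEmbedding] at h1 h2
      omega
    obtain ⟨hb3, t3⟩ := Prog.runsIn_of_isTame (R := [0, 1]) (Z := []) (mr := 5) (M := 1) (B := B) (D := D)
      (E := E) hL le_rfl Nat.one_le_two_pow (p := setSizes d) (setSizes_isTame d)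
      (Nat.mul_le_mul_left _ (by rw [valueFactor]; omega)) hb2
      (by
        intro r hr
        simp only [List.mem_cons, List.not_mem_nil, or_false] at hr
        rcases hr with rfl | rfl
        · simp [hlist.size]; omega
        · simp [hlist.colors]; omega)
      (by simp)
      (by rw [hDdef, costDegree]; omega) (hone _)
    set s3 := (setSizes d).run s2 with hs3
    have u3 : s3.regs 3 = m := by simp [hs3, setSizes, hlist.triples]
    have u23 : s3.regs 23 = L := by simp [hs3, setSizes, sizeExpr_eval, hlist.size, hLdef]
    have u2 : s3.regs 2 = 2 ^ (n + 1) := by simp [hs3, setSizes, hlist.big]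
    obtain ⟨hb4, t4⟩ := Prog.runsIn_of_isTame (R := [3, 23]) (Z := [2, 23]) (mr := 5) (M := 1) (B := B)
      (D := D) (E := E) hL le_rfl Nat.one_le_two_pow (p := powers ;; fieldSize) (by decide)
      (Nat.mul_le_mul_left _ (by rw [valueFactor]; omega)) hb3
      (by
        intro r hr
        simp only [List.mem_cons, List.not_mem_nil, or_false] at hr
        rcases hr with rfl | rfl
        · simp [u3]; omega
        · simp [u23])
      (by
        intro r hr
        simp only [List.mem_cons, List.not_mem_nil, or_false] at hr
        rcases hr with rfl | rfl
        · rw [u2]; positivity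
        · omega)
      (by rw [hDdef, costDegree]; omega) (hone _)
    set s4 := (powers ;; fieldSize).run s3 with hs4
    obtain ⟨q, p, hprep⟩ := prepare_spec (d := d) hlist
    have hs5 : (prepare d).run s2 = fieldTables.run s4 := rfl
    have v7 : s4.regs 7 = 2 ^ q := by
      rw [← hprep.params.tables.size, hs5]
      exact (Prog.run_regs fieldTables (by decide) s4).symm
    have hq := hprep.lt
    rw [← hLdef] at hq
    obtain ⟨hb5, t5⟩ := Prog.runsIn_of_isTame (R := [7]) (Z := [7]) (mr := 5) (M := 1) (B := B)
      (D := D) (E := E) hL le_rfl Nat.one_le_two_pow (p := fieldTables) (by decide)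
      (Nat.mul_le_mul_left _ (by rw [valueFactor]; omega)) hb4
      (by intro r hr; simp only [List.mem_singleton] at hr; subst hr; simp [v7]; omega)
      (by intro r hr; simp only [List.mem_singleton] at hr; subst hr; rw [v7]; positivity)
      (by rw [hDdef, costDegree]; omega) (hone _)
    rw [← hs5] at hb5
    set s5 := (prepare d).run s2
    have hqlt : q < 2 ^ q := Nat.lt_two_pow_self
    obtain ⟨hb6, t6⟩ := Prog.runsIn_of_isTame (R := [0, 3, 5, 6, 7, 8]) (Z := [7]) (mr := 5)
      (M := 2 ^ m) (B := B) (D := D) (E := E) hL Nat.one_le_two_pow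
      (Nat.pow_le_pow_right (by norm_num) (by omega)) (p := sieveTables) (by decide)
      (Nat.mul_le_mul_left _ (by rw [valueFactor]; omega)) hb5
      (by
        intro r hr
        simp only [List.mem_cons, List.not_mem_nil, or_false] at hr
        rcases hr with rfl | rfl | rfl | rfl | rfl | rfl
        · simp [hprep.input.size]; omega
        · simp [hprep.input.labels]; omega
        · simp [hprep.pow]
        · simp [hprep.params.dim]; omega
        · simp [hprep.params.tables.size]; omega
        · simp [hprep.bits]; omega)
      (by
        intro r hr; simp only [List.mem_singleton] at hr; subst hr
        rw [hprep.params.tables.size]; positivity)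
      (by rw [hDdef, costDegree]; omega)
      (by
        have : sieveTables.degM 5 = 1 := by decide
        rw [this, pow_one]; exact hm6)
    have tprep : (prepare d).RunsIn s2 (3 * ((B + 2) * (E * L ^ D))) := by
      obtain ⟨ta, ea, la⟩ := t3
      obtain ⟨tb, eb, lb⟩ := t4
      obtain ⟨tc, ec, lc⟩ := t5
      cases eb with
      | seq e1 e2 => exact ⟨_, .seq ea (.seq e1 (.seq e2 ec)), by omega⟩
    have t7 : (Prog.assign 0 (.reg 19)).RunsIn (sieveTables.run s5) ((B + 2) * (E * L ^ D)) :=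
      ⟨_, .assign _ _ _, one_add_cost_le hL hE hb6 (by
        simp only [Expr.len]; rw [hDdef, costDegree]; omega)⟩
    exact (tprep.seq (t6.seq t7)).mono (by omega)
  have tite : (Prog.ite fewColors (.ite manyVertices (.assign 0 (.const 0)) (prepare d ;; sieve))
      (.assign 0 (.const 1))).RunsIn s2 ((B + 2) * (E * L ^ D) +
        ((B + 2) * (E * L ^ D) + 5 * ((B + 2) * (E * L ^ D)))) := by
    refine .ite (one_add_cost_le hL hE hb2 (by rw [hDdef, costDegree]; omega)) (fun hfew => ?_)
      (fun _ => (tassign 1 le_rfl).mono (by omega))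
    exact .ite (one_add_cost_le hL hE hb2 (by rw [hDdef, costDegree]; omega))
      (fun _ => (tassign 0 zero_le_one).mono (by omega)) (fun _ => thard hfew)
  exact (tl.seq tite).mono (by omega)

theorem cost_bound_le {n d k J D : ℕ} (hn : 1 ≤ n) :
    9 * ((4 * (n + 1) ^ (d + 1) * J + 2) * (2 ^ (6 * k) * (4 * (n + 1) ^ (d + 1)) ^ D)) ≤
      9 * (J + 1) * (4 * 2 ^ (d + 1)) ^ (D + 1) * 2 ^ (6 * k) * n ^ ((d + 1) * (D + 1)) := by
  set L := 4 * (n + 1) ^ (d + 1) with hLdef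
  have hL : L ≤ 4 * 2 ^ (d + 1) * n ^ (d + 1) := by
    rw [mul_assoc, ← mul_pow]
    exact Nat.mul_le_mul_left _ (Nat.pow_le_pow_left (by omega) _)
  have h2 : 2 ≤ L := by
    have : 0 < (n + 1) ^ (d + 1) := by positivity
    omega
  calc 9 * ((L * J + 2) * (2 ^ (6 * k) * L ^ D))
      ≤ 9 * ((L * (J + 1)) * (2 ^ (6 * k) * L ^ D)) := by gcongr; rw [mul_add]; omega
    _ = 9 * (J + 1) * 2 ^ (6 * k) * L ^ (D + 1) := by ring
    _ ≤ 9 * (J + 1) * 2 ^ (6 * k) * (4 * 2 ^ (d + 1) * n ^ (d + 1)) ^ (D + 1) := by gcongr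
    _ = _ := by rw [mul_pow, ← pow_mul]; ring

theorem coloringProg_error {n l : ℕ} (d : ℕ) (G : SimpleGraph (Fin n)) :
    1 - 1 / ((n : ℝ) + 1) ^ d ≤ fairCoins.real
      {coins | ((coloringProg d).run (coloringInput G l coins)).regs 0 ≠ 0 ↔ G.Colorable l} := by
  obtain ⟨σ, m, c, hlist⟩ := listing_spec G l fun _ => false
  set s := listing.run (coloringInput G l fun _ => false) with hs
  have hrun : ∀ coins, listing.run (coloringInput G l coins) = { s with coins := coins } :=
    fun coins => Prog.run_withCoins listing (by decide) (coloringInput G l fun _ => false) coins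
  have hle₁ := hlist.greedy.le₁
  have hle₂ := hlist.greedy.le₂
  have hcol : (G.comap σ).Colorable l ↔ G.Colorable l :=
    ⟨fun h => h.of_hom (SimpleGraph.Iso.comap σ G).symm.toHom,
      fun h => h.of_hom (SimpleGraph.Iso.comap σ G).toHom⟩
  have hfew : ∀ coins, fewColors.eval { s with coins := coins } ≠ 0 ↔
      l < m / 3 + (c - m) / 2 + (n - c) := by
    intro coins
    simp [fewColors, hlist.colors, hlist.triples, hlist.pairs, hlist.size]
  have hmany : ∀ coins, manyVertices.eval { s with coins := coins } ≠ 0 ↔ 2 * l < n - m := by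
    intro coins
    simp [manyVertices, hlist.colors, hlist.triples, hlist.size]
    omega
  have hsure : (∀ coins, (((coloringProg d).run (coloringInput G l coins)).regs 0 ≠ 0 ↔
      G.Colorable l)) → 1 - 1 / ((n : ℝ) + 1) ^ d ≤ fairCoins.real
      {coins | ((coloringProg d).run (coloringInput G l coins)).regs 0 ≠ 0 ↔ G.Colorable l} := by
    intro h
    have hall : {coins | ((coloringProg d).run (coloringInput G l coins)).regs 0 ≠ 0 ↔
        G.Colorable l} = Set.univ := Set.eq_univ_of_forall h
    rw [hall, MeasureTheory.probReal_univ]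
    have : 0 ≤ 1 / ((n : ℝ) + 1) ^ d := by positivity
    linarith
  by_cases c1 : l < m / 3 + (c - m) / 2 + (n - c)
  swap
  · refine hsure fun coins => ?_
    have hyes := hcol.1 (hlist.greedy.colorable (l := l) (by omega))
    have hf := not_not.1 (mt (hfew coins).1 c1)
    simp [coloringProg, hrun, hf, hyes]
  by_cases c2 : 2 * l < n - m
  · refine hsure fun coins => ?_
    have hno : ¬ G.Colorable l := fun h => by
      have := hlist.greedy.le_of_colorable (hcol.2 h)
      omega
    have hf := (hfew coins).2 c1
    have hm := (hmany coins).2 c2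
    simp [coloringProg, hrun, hf, hm, hno]
  · obtain ⟨q, p, hprep⟩ := prepare_spec (d := d) hlist
    have herr := sieve_error (hle₁.trans hle₂) (by omega) hprep hlist.greedy.no_triple (by omega)
    have hset : {coins | ((coloringProg d).run (coloringInput G l coins)).regs 0 ≠ 0 ↔
        G.Colorable l} = {coins | (sieve.run { (prepare d).run s with coins := coins }).regs 0 ≠ 0 ↔
        (G.comap σ).Colorable l} := by
      ext coins
      have hf := (hfew coins).2 c1
      have hm := not_not.1 (mt (hmany coins).1 c2)
      have hp : (prepare d).run { s with coins := coins } =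
          { (prepare d).run s with coins := coins } := Prog.run_withCoins _ rfl _ _
      simp [coloringProg, hrun, hf, hm, hcol, hp]
    rw [hset]
    exact herr

end CoinRAM

theorem theorem2 :
    ∀ d : ℕ, ∃ (p : CoinRAM.Cmd) (C c : ℕ),
      ∀ (n : ℕ) (G : SimpleGraph (Fin n)) (k l : ℕ),
        1 ≤ k → l + k = G.cliqueNum + matchingNumber Gᶜ →
          (∀ coins : ℕ → Bool,
            CoinRAM.HaltsWithin p (CoinRAM.coloringInput G l coins) (C * 2 ^ (6 * k) * n ^ c)) ∧
          1 - 1 / ((n : ℝ) + 1) ^ d ≤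
            CoinRAM.fairCoins.real
              {coins | CoinRAM.Decides p (CoinRAM.coloringInput G l coins) (G.Colorable l)} := by
  intro d
  refine ⟨(CoinRAM.coloringProg d).toCmd,
    9 * (CoinRAM.valueFactor d + 1) * (4 * 2 ^ (d + 1)) ^ (CoinRAM.costDegree d + 1),
    (d + 1) * (CoinRAM.costDegree d + 1), fun n G k l hk1 hk => ?_⟩
  have hn : 1 ≤ n := by
    have h1 := G.cliqueNum_le_card
    have h2 := Gᶜ.matchingNumber_le_card
    rw [Fintype.card_fin] at h1 h2
    omega
  refine ⟨fun coins => ?_, (CoinRAM.coloringProg_error d G (l := l)).trans ?_⟩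
  · obtain ⟨t, he, ht⟩ := (CoinRAM.coloringProg_runsIn (d := d) hk coins).mono
      (CoinRAM.cost_bound_le hn)
    exact ⟨_, t, he, ht⟩
  · refine MeasureTheory.measureReal_mono fun coins hc => ?_
    obtain ⟨t, he, -⟩ := CoinRAM.coloringProg_runsIn (d := d) hk coins
    exact ⟨_, t, he, hc⟩
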